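/- **Theorem.** The Minkowski Sum Selection problem with two parallel linear constraints and a linear objective function can be solved deterministically in $O(n\log n)$ time in the worst case on a real RAM. In detail: an instance consists of two $n$-point multisets $P,Q\subseteq\mathbb{R}^2$ (given as unordered lists of points), an integer $k\ge 1$, two linear constraints $a_1x+b_1y\ge \gamma_1$ and $a_2x+b_2y\ge\gamma_2$ that are parallel, i.e. $a_1b_2=a_2b_1$, and a linear objective $f(x,y)=dx+ey$, all with real coefficients. In particular, a strip $c_1\le ax+by\le c_2$ is the case $(a_1,b_1,\gamma_1)=(a,b,c_1)$, $(a_2,b_2,\gamma_2)=(-a,-b,-c_2)$. The constrained Minkowski sum is the multiset of all sums $p+q$, $p\in P$, $q\in Q$ (with multiplicity), that satisfy both constraints. The task is to output the $k$-th largest value of $f$ on this multiset (values counted with multiplicity), or to report that it has fewer than $k$ elements. There are a single real-RAM program and a function $T:\mathbb{N}\to\mathbb{N}$ with $T(n)=O(n\log n)$ such that on every such instance the program halts with the correct output after at most $T(n)$ steps. Here the real RAM performs exact arithmetic $(+,-,\times,/)$ and comparisons on real numbers, with rational constants only and without rounding or conversion of reals to integers, and arithmetic $(+,-,\times,\lfloor\cdot/\cdot\rfloor)$,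 comparisons and array addressing on machine words, each at unit cost; machine words are natural numbers bounded by a fixed power of $n+k+2$. -/

import Mathlib

open Filter Asymptotics

/-! ### The selection problem -/

/-- The multiset of all sums of a point of `P` and a point of `Q` (with multiplicity) that satisfy
the `m` linear constraints `A r ≥ b`. -/
noncomputable def constrainedMinkowskiSum {m : ℕ} (A : Matrix (Fin m) (Fin 2) ℝ) (b : Fin m → ℝ)
    (P Q : Multiset (Fin 2 → ℝ)) : Multiset (Fin 2 → ℝ) :=
  open Classical in
  ((P ×ˢ Q).map fun z => z.1 + z.2).filter fun r => A.mulVec r ≥ b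

/-- The `k`-th largest element of a multiset of reals, counted with multiplicity (`k = 1` is the
maximum); `none` if there are fewer than `k` elements. Only meant for `k ≥ 1`. -/
noncomputable def kthLargest (M : Multiset ℝ) (k : ℕ) : Option ℝ :=
  (M.sort (· ≥ ·))[k - 1]?

/-- The multiset formed by the values of a finite family. -/
def familyMultiset {n : ℕ} (P : Fin n → Fin 2 → ℝ) : Multiset (Fin 2 → ℝ) :=
  Finset.univ.val.map P

/-- The answer to the selection problem: the `k`-th largest value of the linear objective
`r ↦ f 0 * r 0 + f 1 * r 1` over the constrained Minkowski sum. -/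
noncomputable def selectionAnswer {m : ℕ} (A : Matrix (Fin m) (Fin 2) ℝ) (b : Fin m → ℝ)
    (f : Fin 2 → ℝ) (P Q : Multiset (Fin 2 → ℝ)) (k : ℕ) : Option ℝ :=
  kthLargest ((constrainedMinkowskiSum A b P Q).map fun r => f 0 * r 0 + f 1 * r 1) k

/-! ### The real RAM

A machine with registers and arrays for real numbers (exact arithmetic and comparisons at unit
cost) and registers and arrays for machine words (natural numbers at most `W`, used for counting
and addressing). There is no rounding and no conversion from reals to words. -/

namespace RealRAM

/-- Machine state: word registers, real registers, and arrays of words and of reals. An array is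
named by a number that is fixed in the program text and is addressed by a word. -/
structure State where
  wreg : ℕ → ℕ
  rreg : ℕ → ℝ
  wmem : ℕ → ℕ → ℕ
  rmem : ℕ → ℕ → ℝ

/-- Word expressions. Subtraction is truncated at `0`, division is rounded down. -/
inductive WExp where
  | const (c : ℕ)
  | reg (i : ℕ)
  | load (arr : ℕ) (idx : WExp)
  | add (e₁ e₂ : WExp)
  | sub (e₁ e₂ : WExp)
  | mul (e₁ e₂ : WExp)
  | div (e₁ e₂ : WExp)

/-- Real expressions, with rational constants only. -/
inductive RExp where
  | const (q : ℚ)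
  | reg (i : ℕ)
  | load (arr : ℕ) (idx : WExp)
  | add (e₁ e₂ : RExp)
  | sub (e₁ e₂ : RExp)
  | mul (e₁ e₂ : RExp)
  | div (e₁ e₂ : RExp)

/-- Tests: comparisons of words and of reals, and Boolean combinations of them. -/
inductive Test where
  | wlt (e₁ e₂ : WExp)
  | rlt (e₁ e₂ : RExp)
  | not (t : Test)
  | and (t₁ t₂ : Test)

/-- Programs. -/
inductive Prog where
  | skip
  | setW (i : ℕ) (e : WExp)
  | setR (i : ℕ) (e : RExp)
  | storeW (arr : ℕ) (idx : WExp) (e : WExp)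
  | storeR (arr : ℕ) (idx : WExp) (e : RExp)
  | seq (p q : Prog)
  | cond (t : Test) (p q : Prog)
  | loop (t : Test) (p : Prog)

/-- A word operation succeeds only if its result fits into a word. -/
def fit (W z : ℕ) : Option ℕ := if z ≤ W then some z else none

/-- The value of a word expression; `none` if some intermediate result exceeds `W`. -/
def WExp.eval (W : ℕ) (s : State) : WExp → Option ℕ
  | .const c => fit W c
  | .reg i => fit W (s.wreg i)
  | .load arr idx => (idx.eval W s).bind fun j => fit W (s.wmem arr j)
  | .add e₁ e₂ => (e₁.eval W s).bind fun x => (e₂.eval W s).bind fun y => fit W (x + y)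
  | .sub e₁ e₂ => (e₁.eval W s).bind fun x => (e₂.eval W s).bind fun y => fit W (x - y)
  | .mul e₁ e₂ => (e₁.eval W s).bind fun x => (e₂.eval W s).bind fun y => fit W (x * y)
  | .div e₁ e₂ => (e₁.eval W s).bind fun x => (e₂.eval W s).bind fun y => fit W (x / y)

/-- The value of a real expression; `none` if the evaluation of an address fails. -/
noncomputable def RExp.eval (W : ℕ) (s : State) : RExp → Option ℝ
  | .const q => some (q : ℝ)
  | .reg i => some (s.rreg i)
  | .load arr idx => (idx.eval W s).bind fun j => some (s.rmem arr j)
  | .add e₁ e₂ => (e₁.eval W s).bind fun x => (e₂.eval W s).bind fun y => some (x + y)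
  | .sub e₁ e₂ => (e₁.eval W s).bind fun x => (e₂.eval W s).bind fun y => some (x - y)
  | .mul e₁ e₂ => (e₁.eval W s).bind fun x => (e₂.eval W s).bind fun y => some (x * y)
  | .div e₁ e₂ => (e₁.eval W s).bind fun x => (e₂.eval W s).bind fun y => some (x / y)

/-- The outcome of a test; `none` if the evaluation of an operand fails. -/
noncomputable def Test.eval (W : ℕ) (s : State) : Test → Option Bool
  | .wlt e₁ e₂ => (e₁.eval W s).bind fun x => (e₂.eval W s).bind fun y => some (decide (x < y))
  | .rlt e₁ e₂ => (e₁.eval W s).bind fun x => (e₂.eval W s).bind fun y =>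
      open Classical in some (decide (x < y))
  | .not t => (t.eval W s).bind fun x => some (!x)
  | .and t₁ t₂ => (t₁.eval W s).bind fun x => (t₂.eval W s).bind fun y => some (x && y)

/-- The number of elementary operations in a word expression. -/
def WExp.cost : WExp → ℕ
  | .const _ => 1
  | .reg _ => 1
  | .load _ idx => idx.cost + 1
  | .add e₁ e₂ => e₁.cost + e₂.cost + 1
  | .sub e₁ e₂ => e₁.cost + e₂.cost + 1
  | .mul e₁ e₂ => e₁.cost + e₂.cost + 1
  | .div e₁ e₂ => e₁.cost + e₂.cost + 1

/-- The number of elementary operations in a real expression. -/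
def RExp.cost : RExp → ℕ
  | .const _ => 1
  | .reg _ => 1
  | .load _ idx => idx.cost + 1
  | .add e₁ e₂ => e₁.cost + e₂.cost + 1
  | .sub e₁ e₂ => e₁.cost + e₂.cost + 1
  | .mul e₁ e₂ => e₁.cost + e₂.cost + 1
  | .div e₁ e₂ => e₁.cost + e₂.cost + 1

/-- The number of elementary operations in a test. -/
def Test.cost : Test → ℕ
  | .wlt e₁ e₂ => e₁.cost + e₂.cost + 1
  | .rlt e₁ e₂ => e₁.cost + e₂.cost + 1
  | .not t => t.cost + 1
  | .and t₁ t₂ => t₁.cost + t₂.cost + 1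

/-- `Run W p s t s'`: with words bounded by `W`, program `p` started in state `s` halts in state
`s'` after exactly `t` elementary steps. A run in which a word exceeds `W` does not halt properly,
so no such statement holds for it. -/
inductive Run (W : ℕ) : Prog → State → ℕ → State → Prop where
  | skip (s : State) : Run W .skip s 1 s
  | setW {s : State} {i : ℕ} {e : WExp} {v : ℕ} (he : e.eval W s = some v) :
      Run W (.setW i e) s (e.cost + 1) { s with wreg := Function.update s.wreg i v }
  | setR {s : State} {i : ℕ} {e : RExp} {v : ℝ} (he : e.eval W s = some v) :
      Run W (.setR i e) s (e.cost + 1) { s with rreg := Function.update s.rreg i v }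
  | storeW {s : State} {arr : ℕ} {idx e : WExp} {j v : ℕ}
      (hi : idx.eval W s = some j) (he : e.eval W s = some v) :
      Run W (.storeW arr idx e) s (idx.cost + e.cost + 1)
        { s with wmem := Function.update s.wmem arr (Function.update (s.wmem arr) j v) }
  | storeR {s : State} {arr : ℕ} {idx : WExp} {e : RExp} {j : ℕ} {v : ℝ}
      (hi : idx.eval W s = some j) (he : e.eval W s = some v) :
      Run W (.storeR arr idx e) s (idx.cost + e.cost + 1)
        { s with rmem := Function.update s.rmem arr (Function.update (s.rmem arr) j v) }
  | seq {p q : Prog} {s s' s'' : State} {t t' : ℕ}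
      (hp : Run W p s t s') (hq : Run W q s' t' s'') : Run W (.seq p q) s (t + t') s''
  | cond_true {b : Test} {p q : Prog} {s s' : State} {t : ℕ}
      (hb : b.eval W s = some true) (hp : Run W p s t s') :
      Run W (.cond b p q) s (b.cost + 1 + t) s'
  | cond_false {b : Test} {p q : Prog} {s s' : State} {t : ℕ}
      (hb : b.eval W s = some false) (hq : Run W q s t s') :
      Run W (.cond b p q) s (b.cost + 1 + t) s'
  | loop_true {b : Test} {p : Prog} {s s' s'' : State} {t t' : ℕ}
      (hb : b.eval W s = some true) (hp : Run W p s t s') (hl : Run W (.loop b p) s' t' s'') :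
      Run W (.loop b p) s (b.cost + 1 + t + t') s''
  | loop_false {b : Test} {p : Prog} {s : State} (hb : b.eval W s = some false) :
      Run W (.loop b p) s (b.cost + 1) s

/-- A finite sequence of reals as the initial segment of an array that is `0` elsewhere. -/
noncomputable def arrayOf {n : ℕ} (u : Fin n → ℝ) : ℕ → ℝ :=
  fun j => if h : j < n then u ⟨j, h⟩ else 0

/-- The initial state for an instance with two constraints: word registers `0, 1` hold `n, k`; real
registers `0, …, 7` hold the entries of `A` row by row, then `b`, then `f`; the real arrays
`0, 1, 2, 3` hold the coordinates of the points of `P` (two arrays) and of `Q` (two arrays), in the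
order in which they are given. Everything else is `0`. -/
noncomputable def initState {n : ℕ} (k : ℕ) (A : Matrix (Fin 2) (Fin 2) ℝ) (b f : Fin 2 → ℝ)
    (P Q : Fin n → Fin 2 → ℝ) : State where
  wreg
    | 0 => n
    | 1 => k
    | _ => 0
  rreg
    | 0 => A 0 0
    | 1 => A 0 1
    | 2 => A 1 0
    | 3 => A 1 1
    | 4 => b 0
    | 5 => b 1
    | 6 => f 0
    | 7 => f 1
    | _ => 0
  wmem _ _ := 0
  rmem
    | 0 => arrayOf fun i => P i 0
    | 1 => arrayOf fun i => P i 1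
    | 2 => arrayOf fun i => Q i 0
    | 3 => arrayOf fun i => Q i 1
    | _ => fun _ => 0

/-- The output of a halted machine: word register `0` holds `1` and real register `0` holds the
answer, or word register `0` holds `0` to report that there is no answer. -/
def State.Outputs (s : State) : Option ℝ → Prop
  | some v => s.wreg 0 = 1 ∧ s.rreg 0 = v
  | none => s.wreg 0 = 0

end RealRAM

/-! Geometry. The two constraint normals are parallel, so both left-hand sides are monotone along
one common direction (`parallel_mono`, `Arranged.directed`). Once `Q` is sorted by its product with
that direction, the feasible partners of a point of `P` form a window of consecutive positions,
found by one binary search per constraint (`bound_spec`, `window_spec`).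

Decomposition. Let `H` be the binary logarithm of `n`, rounded up. A bottom-up merge sort of `Q` by
the objective that starts from this order and keeps all its levels stores, for the nodes of a binary
tree over the positions, the descending list of objective values below the node. A window is a
disjoint union of at most `2 * (H + 1)` canonical nodes (`canon_sum_levels`). The points of `P` are
treated in descending order of the objective, and each hands its value to the canonical nodes of its
window. Every node `v` then owns two descending lists `U v` and `R v`, and the objective values on
the constrained Minkowski sum are exactly the entries `U v i + R v j` of these sorted matrices
(`exists_rects`, `sum_windows`, `sum_good`). There are `O(n)` matrices with `O(n log n)` rows and
columns altogether.

Selection in sorted matrices. Keep only every `s`-th row and column. For an upward closed set of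
values, `s * s` times the coarse count is at least the true count and exceeds it by at most `s * s *
dim s` (`Rects.count_bounds`). Hence the coarse entries of ranks `k / s²` (rounded up) and `k / s² +
dim s` enclose the answer, and only `9 * dim (s / 2)` entries of the next finer matrices lie
strictly between them (`Rects.IsAnswer.narrow_hi`, `Rects.IsAnswer.narrow_lo`, `Rects.mid_le`).
Those are listed by walking along the two staircases (`enumerate_spec`), and the new ends are chosen
among them in linear time (`select_spec`). The stride `s` is halved from `2 ^ H` down to `1`, where
the upper end is the answer (`levels_spec`). The dimensions decrease geometrically up to rounding
(`Rects.sum_dim_le`), so the total time is `O(n log n)`.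

Linear-time selection. The splitter is the median of a sample made by merging sorted runs and
dropping every other element until one run is left. Dropping disturbs ranks by at most one element
per run, and these errors sum geometrically, so at most `11/16` of the values lie on either side of
the splitter (`Sample.median`).

Ties are handled throughout by describing the `k`-th largest value `z` by two counts: fewer than `k`
values exceed `z`, and at least `k` values are at least `z`. Multisets are compared through sums or
counts over arbitrary functions or predicates. The programs are verified with the judgement `Ht`,
which carries a time bound, and with frame conditions `Keeps`. -/

set_option linter.unusedSimpArgs false

namespace RealRAM

/-! ### Total semantics of expressions -/

/-- The value of a word expression when words are unbounded. -/
def WExp.val (s : State) : WExp → ℕ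
  | .const c => c
  | .reg i => s.wreg i
  | .load arr idx => s.wmem arr (idx.val s)
  | .add e₁ e₂ => e₁.val s + e₂.val s
  | .sub e₁ e₂ => e₁.val s - e₂.val s
  | .mul e₁ e₂ => e₁.val s * e₂.val s
  | .div e₁ e₂ => e₁.val s / e₂.val s

/-- The conditions under which a word expression can be evaluated, given that all stored words
fit. -/
def WExp.ok (W : ℕ) (s : State) : WExp → Prop
  | .const c => c ≤ W
  | .reg _ => True
  | .load _ idx => idx.ok W s
  | .add e₁ e₂ => e₁.ok W s ∧ e₂.ok W s ∧ e₁.val s + e₂.val s ≤ W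
  | .sub e₁ e₂ => e₁.ok W s ∧ e₂.ok W s
  | .mul e₁ e₂ => e₁.ok W s ∧ e₂.ok W s ∧ e₁.val s * e₂.val s ≤ W
  | .div e₁ e₂ => e₁.ok W s ∧ e₂.ok W s

/-- The value of a real expression. -/
noncomputable def RExp.val (s : State) : RExp → ℝ
  | .const q => (q : ℝ)
  | .reg i => s.rreg i
  | .load arr idx => s.rmem arr (idx.val s)
  | .add e₁ e₂ => e₁.val s + e₂.val s
  | .sub e₁ e₂ => e₁.val s - e₂.val s
  | .mul e₁ e₂ => e₁.val s * e₂.val s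
  | .div e₁ e₂ => e₁.val s / e₂.val s

/-- The conditions under which a real expression can be evaluated. -/
def RExp.ok (W : ℕ) (s : State) : RExp → Prop
  | .const _ => True
  | .reg _ => True
  | .load _ idx => idx.ok W s
  | .add e₁ e₂ => e₁.ok W s ∧ e₂.ok W s
  | .sub e₁ e₂ => e₁.ok W s ∧ e₂.ok W s
  | .mul e₁ e₂ => e₁.ok W s ∧ e₂.ok W s
  | .div e₁ e₂ => e₁.ok W s ∧ e₂.ok W s

/-- The proposition decided by a test. -/
def Test.val (s : State) : Test → Prop
  | .wlt e₁ e₂ => e₁.val s < e₂.val s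
  | .rlt e₁ e₂ => e₁.val s < e₂.val s
  | .not t => ¬ t.val s
  | .and t₁ t₂ => t₁.val s ∧ t₂.val s

/-- The conditions under which a test can be evaluated. -/
def Test.ok (W : ℕ) (s : State) : Test → Prop
  | .wlt e₁ e₂ => e₁.ok W s ∧ e₂.ok W s
  | .rlt e₁ e₂ => e₁.ok W s ∧ e₂.ok W s
  | .not t => t.ok W s
  | .and t₁ t₂ => t₁.ok W s ∧ t₂.ok W s

/-- All stored words fit. -/
structure WF (W : ℕ) (s : State) : Prop where
  wreg : ∀ i, s.wreg i ≤ W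
  wmem : ∀ a j, s.wmem a j ≤ W

theorem fit_of_le {W z : ℕ} (h : z ≤ W) : fit W z = some z := if_pos h

theorem WExp.val_le {W : ℕ} {s : State} (hs : WF W s) (e : WExp) (h : e.ok W s) :
    e.val s ≤ W := by
  induction e with
  | const c => exact h
  | reg i => exact hs.wreg i
  | load a e ih => exact hs.wmem a _
  | add e₁ e₂ _ _ => exact h.2.2
  | sub e₁ e₂ ih₁ _ => exact (Nat.sub_le _ _).trans (ih₁ h.1)
  | mul e₁ e₂ _ _ => exact h.2.2
  | div e₁ e₂ ih₁ _ => exact (Nat.div_le_self _ _).trans (ih₁ h.1)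

theorem WExp.eval_eq {W : ℕ} {s : State} (hs : WF W s) (e : WExp) (h : e.ok W s) :
    e.eval W s = some (e.val s) := by
  have hle := WExp.val_le hs e h
  induction e with
  | const c => exact fit_of_le hle
  | reg i => exact fit_of_le hle
  | load a e ih =>
    simp only [WExp.eval, ih h (WExp.val_le hs e h), Option.bind_some]
    exact fit_of_le hle
  | add e₁ e₂ ih₁ ih₂ =>
    simp only [WExp.eval, ih₁ h.1 (WExp.val_le hs _ h.1), ih₂ h.2.1 (WExp.val_le hs _ h.2.1),
      Option.bind_some]
    exact fit_of_le hle
  | mul e₁ e₂ ih₁ ih₂ =>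
    simp only [WExp.eval, ih₁ h.1 (WExp.val_le hs _ h.1), ih₂ h.2.1 (WExp.val_le hs _ h.2.1),
      Option.bind_some]
    exact fit_of_le hle
  | sub e₁ e₂ ih₁ ih₂ =>
    simp only [WExp.eval, ih₁ h.1 (WExp.val_le hs _ h.1), ih₂ h.2 (WExp.val_le hs _ h.2),
      Option.bind_some]
    exact fit_of_le hle
  | div e₁ e₂ ih₁ ih₂ =>
    simp only [WExp.eval, ih₁ h.1 (WExp.val_le hs _ h.1), ih₂ h.2 (WExp.val_le hs _ h.2),
      Option.bind_some]
    exact fit_of_le hle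

theorem RExp.eval_eq {W : ℕ} {s : State} (hs : WF W s) (e : RExp) (h : e.ok W s) :
    e.eval W s = some (e.val s) := by
  induction e with
  | const c => rfl
  | reg i => rfl
  | load a e => simp only [RExp.eval, WExp.eval_eq hs e h, Option.bind_some, RExp.val]
  | add e₁ e₂ ih₁ ih₂ => simp only [RExp.eval, ih₁ h.1, ih₂ h.2, Option.bind_some, RExp.val]
  | mul e₁ e₂ ih₁ ih₂ => simp only [RExp.eval, ih₁ h.1, ih₂ h.2, Option.bind_some, RExp.val]
  | sub e₁ e₂ ih₁ ih₂ => simp only [RExp.eval, ih₁ h.1, ih₂ h.2, Option.bind_some, RExp.val]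
  | div e₁ e₂ ih₁ ih₂ => simp only [RExp.eval, ih₁ h.1, ih₂ h.2, Option.bind_some, RExp.val]

theorem Test.eval_eq {W : ℕ} {s : State} (hs : WF W s) (b : Test) (h : b.ok W s) :
    ∃ v, b.eval W s = some v ∧ (v = true ↔ b.val s) := by
  induction b with
  | wlt e₁ e₂ =>
    exact ⟨_, by simp only [Test.eval, WExp.eval_eq hs _ h.1, WExp.eval_eq hs _ h.2,
      Option.bind_some]; rfl, by simp [Test.val]⟩
  | rlt e₁ e₂ =>
    exact ⟨_, by simp only [Test.eval, RExp.eval_eq hs _ h.1, RExp.eval_eq hs _ h.2,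
      Option.bind_some]; rfl, by simp [Test.val]⟩
  | not t ih =>
    obtain ⟨v, hv, hv'⟩ := ih h
    exact ⟨!v, by simp [Test.eval, hv], by simp [Test.val, ← hv']⟩
  | and t₁ t₂ ih₁ ih₂ =>
    obtain ⟨v, hv, hv'⟩ := ih₁ h.1
    obtain ⟨w, hw, hw'⟩ := ih₂ h.2
    exact ⟨v && w, by simp [Test.eval, hv, hw], by simp [Test.val, ← hv', ← hw']⟩

theorem Test.eval_true {W : ℕ} {s : State} (hs : WF W s) (b : Test) (h : b.ok W s)
    (hb : b.val s) : b.eval W s = some true := by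
  obtain ⟨v, hv, hv'⟩ := Test.eval_eq hs b h
  rw [hv, hv'.2 hb]

theorem Test.eval_false {W : ℕ} {s : State} (hs : WF W s) (b : Test) (h : b.ok W s)
    (hb : ¬ b.val s) : b.eval W s = some false := by
  obtain ⟨v, hv, hv'⟩ := Test.eval_eq hs b h
  rw [hv, Bool.eq_false_iff.2 (mt hv'.1 hb)]

/-! ### State updates -/

/-- Store a word in a register. -/
def State.putW (s : State) (i v : ℕ) : State := { s with wreg := Function.update s.wreg i v }

/-- Store a real number in a register. -/
noncomputable def State.putR (s : State) (i : ℕ) (v : ℝ) : State :=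
  { s with rreg := Function.update s.rreg i v }

/-- Store a word in an array. -/
def State.putWM (s : State) (a j v : ℕ) : State :=
  { s with wmem := Function.update s.wmem a (Function.update (s.wmem a) j v) }

/-- Store a real number in an array. -/
noncomputable def State.putRM (s : State) (a j : ℕ) (v : ℝ) : State :=
  { s with rmem := Function.update s.rmem a (Function.update (s.rmem a) j v) }

section simps
variable (s : State) (i j a b v : ℕ) (x : ℝ)

@[simp] theorem putW_wreg : (s.putW i v).wreg j = if j = i then v else s.wreg j :=
  Function.update_apply _ _ _ _
@[simp] theorem putW_rreg : (s.putW i v).rreg = s.rreg := rfl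
@[simp] theorem putW_wmem : (s.putW i v).wmem = s.wmem := rfl
@[simp] theorem putW_rmem : (s.putW i v).rmem = s.rmem := rfl
@[simp] theorem putR_rreg : (s.putR i x).rreg j = if j = i then x else s.rreg j :=
  Function.update_apply _ _ _ _
@[simp] theorem putR_wreg : (s.putR i x).wreg = s.wreg := rfl
@[simp] theorem putR_wmem : (s.putR i x).wmem = s.wmem := rfl
@[simp] theorem putR_rmem : (s.putR i x).rmem = s.rmem := rfl
@[simp] theorem putWM_wmem :
    (s.putWM a j v).wmem b = if b = a then Function.update (s.wmem a) j v else s.wmem b :=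
  Function.update_apply _ _ _ _
@[simp] theorem putWM_wreg : (s.putWM a j v).wreg = s.wreg := rfl
@[simp] theorem putWM_rreg : (s.putWM a j v).rreg = s.rreg := rfl
@[simp] theorem putWM_rmem : (s.putWM a j v).rmem = s.rmem := rfl
@[simp] theorem putRM_rmem :
    (s.putRM a j x).rmem b = if b = a then Function.update (s.rmem a) j x else s.rmem b :=
  Function.update_apply _ _ _ _
@[simp] theorem putRM_wreg : (s.putRM a j x).wreg = s.wreg := rfl
@[simp] theorem putRM_rreg : (s.putRM a j x).rreg = s.rreg := rfl
@[simp] theorem putRM_wmem : (s.putRM a j x).wmem = s.wmem := rfl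
end simps

theorem WF.putW {W : ℕ} {s : State} (hs : WF W s) (i : ℕ) {v : ℕ} (hv : v ≤ W) :
    WF W (s.putW i v) :=
  ⟨fun j => by rw [putW_wreg]; split_ifs; exacts [hv, hs.wreg j], hs.wmem⟩

theorem WF.putR {W : ℕ} {s : State} (hs : WF W s) (i : ℕ) (v : ℝ) : WF W (s.putR i v) :=
  ⟨hs.wreg, hs.wmem⟩

theorem WF.putRM {W : ℕ} {s : State} (hs : WF W s) (a j : ℕ) (v : ℝ) : WF W (s.putRM a j v) :=
  ⟨hs.wreg, hs.wmem⟩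

theorem WF.putWM {W : ℕ} {s : State} (hs : WF W s) (a j : ℕ) {v : ℕ} (hv : v ≤ W) :
    WF W (s.putWM a j v) := by
  refine ⟨hs.wreg, fun b x => ?_⟩
  rw [putWM_wmem]
  split_ifs with h
  · rw [Function.update_apply]
    split_ifs
    exacts [hv, hs.wmem a x]
  · exact hs.wmem b x

/-! ### Timed total correctness -/

/-- From `s` the program halts within `c` steps in a state that satisfies `Q`. -/
def Ht (W : ℕ) (p : Prog) (s : State) (c : ℕ) (Q : State → Prop) : Prop :=
  ∃ t s', t ≤ c ∧ Run W p s t s' ∧ WF W s' ∧ Q s'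

variable {W : ℕ}

theorem Ht.mono {p : Prog} {s : State} {c c' : ℕ} {Q Q' : State → Prop} (h : Ht W p s c Q)
    (hc : c ≤ c') (hQ : ∀ s', WF W s' → Q s' → Q' s') : Ht W p s c' Q' := by
  obtain ⟨t, s', ht, hr, hw, hq⟩ := h
  exact ⟨t, s', ht.trans hc, hr, hw, hQ s' hw hq⟩

theorem Ht.seq {p q : Prog} {s : State} {c c' c'' : ℕ} {Q R : State → Prop} (hp : Ht W p s c Q)
    (hq : ∀ s', WF W s' → Q s' → Ht W q s' c' R) (hc : c + c' ≤ c'') :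
    Ht W (p.seq q) s c'' R := by
  obtain ⟨t, s', ht, hr, hw, h⟩ := hp
  obtain ⟨t', s'', ht', hr', hw', h'⟩ := hq s' hw h
  exact ⟨t + t', s'', by omega, hr.seq hr', hw', h'⟩

theorem Ht.cond {b : Test} {p q : Prog} {s : State} {c c' : ℕ} {Q : State → Prop} (hs : WF W s)
    (hb : b.ok W s) (hp : b.val s → Ht W p s c Q) (hq : ¬ b.val s → Ht W q s c Q)
    (hc : b.cost + 1 + c ≤ c') : Ht W (.cond b p q) s c' Q := by
  by_cases h : b.val s
  · obtain ⟨t, s', ht, hr, hw, h'⟩ := hp h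
    have he := Test.eval_true hs b hb h
    exact ⟨_, s', by omega, Run.cond_true he hr, hw, h'⟩
  · obtain ⟨t, s', ht, hr, hw, h'⟩ := hq h
    have he := Test.eval_false hs b hb h
    exact ⟨_, s', by omega, Run.cond_false he hr, hw, h'⟩

/-- The time bound of a loop-free program. -/
def Prog.cost : Prog → ℕ
  | .skip => 1
  | .setW _ e => e.cost + 1
  | .setR _ e => e.cost + 1
  | .storeW _ i e => i.cost + e.cost + 1
  | .storeR _ i e => i.cost + e.cost + 1
  | .seq p q => p.cost + q.cost
  | .cond b p q => b.cost + 1 + max p.cost q.cost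
  | .loop _ _ => 0

/-- Weakest preconditions of loop-free programs. -/
def Prog.wp (W : ℕ) : Prog → (State → Prop) → State → Prop
  | .skip, Q, s => Q s
  | .setW i e, Q, s => e.ok W s ∧ Q (s.putW i (e.val s))
  | .setR i e, Q, s => e.ok W s ∧ Q (s.putR i (e.val s))
  | .storeW a i e, Q, s => i.ok W s ∧ e.ok W s ∧ Q (s.putWM a (i.val s) (e.val s))
  | .storeR a i e, Q, s => i.ok W s ∧ e.ok W s ∧ Q (s.putRM a (i.val s) (e.val s))
  | .seq p q, Q, s => p.wp W (fun s' => q.wp W Q s') s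
  | .cond b p q, Q, s => b.ok W s ∧ (b.val s → p.wp W Q s) ∧ (¬ b.val s → q.wp W Q s)
  | .loop _ _, _, _ => False

/-- Loop-free code is verified by unfolding `Prog.wp`; its time bound is read off the syntax, taking
the dearer branch of each conditional. The value `0` of `Prog.cost` on a loop is harmless because
the `wp` of a loop is `False`. -/
theorem Ht.of_wp {p : Prog} {s : State} {c : ℕ} {Q : State → Prop} (hs : WF W s)
    (h : p.wp W Q s) (hc : p.cost ≤ c) : Ht W p s c Q := by
  suffices Ht W p s p.cost Q from this.mono hc fun _ _ h => h
  clear hc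
  induction p generalizing s Q with
  | skip => exact ⟨_, s, le_rfl, Run.skip s, hs, h⟩
  | setW i e =>
    exact ⟨_, _, le_rfl, Run.setW (WExp.eval_eq hs e h.1), hs.putW i (WExp.val_le hs e h.1), h.2⟩
  | setR i e => exact ⟨_, _, le_rfl, Run.setR (RExp.eval_eq hs e h.1), hs.putR i _, h.2⟩
  | storeW a i e =>
    exact ⟨_, _, le_rfl, Run.storeW (WExp.eval_eq hs i h.1) (WExp.eval_eq hs e h.2.1),
      hs.putWM a _ (WExp.val_le hs e h.2.1), h.2.2⟩
  | storeR a i e =>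
    exact ⟨_, _, le_rfl, Run.storeR (WExp.eval_eq hs i h.1) (RExp.eval_eq hs e h.2.1),
      hs.putRM a _ _, h.2.2⟩
  | seq p q ihp ihq => exact (ihp hs h).seq (fun s' hs' h' => ihq hs' h') le_rfl
  | cond b p q ihp ihq =>
    exact Ht.cond hs h.1 (fun hb => (ihp hs (h.2.1 hb)).mono (le_max_left _ _) fun _ _ h => h)
      (fun hb => (ihq hs (h.2.2 hb)).mono (le_max_right _ _) fun _ _ h => h) le_rfl
  | loop b p => exact h.elim

theorem Ht.seq_wp {p q : Prog} {s : State} {c c' : ℕ} {Q R : State → Prop} (hs : WF W s)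
    (hp : p.wp W Q s) (hq : ∀ s', WF W s' → Q s' → Ht W q s' c' R) (hc : p.cost + c' ≤ c) :
    Ht W (p.seq q) s c R :=
  (Ht.of_wp hs hp le_rfl).seq hq hc

/-- Loops with an invariant `I` and a potential `Φ` that pays for each iteration. -/
theorem Ht.loop {b : Test} {p : Prog} (I : State → Prop) (Φ : State → ℕ) {s : State} {c : ℕ}
    {Q : State → Prop} (hs : WF W s) (hI : I s) (hb : ∀ s, WF W s → I s → b.ok W s)
    (hp : ∀ s, WF W s → I s → b.val s →
      ∃ c, Ht W p s c fun s' => I s' ∧ Φ s' + c + b.cost + 1 ≤ Φ s)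
    (hQ : ∀ s, WF W s → I s → ¬ b.val s → Q s) (hc : Φ s + b.cost + 1 ≤ c) :
    Ht W (.loop b p) s c Q := by
  suffices ∀ N s, Φ s ≤ N → WF W s → I s → Ht W (.loop b p) s (Φ s + b.cost + 1) Q from
    (this _ s le_rfl hs hI).mono hc fun _ _ h => h
  intro N
  induction N with
  | zero =>
    intro s hN hs hI
    by_cases h : b.val s
    -- An iteration consumes at least one unit of potential, so none can start at potential `0`.
    · obtain ⟨c, t, s', -, -, -, -, h'⟩ := hp s hs hI h
      omega
    · have he := Test.eval_false hs b (hb s hs hI) h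
      exact ⟨_, s, by omega, Run.loop_false he, hs, hQ s hs hI h⟩
  | succ N ih =>
    intro s hN hs hI
    by_cases h : b.val s
    · obtain ⟨c, t, s', ht, hr, hw, hI', h'⟩ := hp s hs hI h
      obtain ⟨t', s'', ht', hr', hw', hq⟩ := ih s' (by omega) hw hI'
      have he := Test.eval_true hs b (hb s hs hI) h
      exact ⟨_, s'', by omega, Run.loop_true he hr hr', hw', hq⟩
    · have he := Test.eval_false hs b (hb s hs hI) h
      exact ⟨_, s, by omega, Run.loop_false he, hs, hQ s hs hI h⟩

/-- Loops with a known number of iterations. -/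
theorem Ht.loop_count {b : Test} {p : Prog} (I : ℕ → State → Prop) (N : ℕ) (f : ℕ → ℕ)
    {s : State} {c : ℕ} {Q : State → Prop} (hs : WF W s) (hI : I 0 s)
    (hb : ∀ j s, WF W s → I j s → b.ok W s ∧ (b.val s ↔ j < N))
    (hp : ∀ j s, j < N → WF W s → I j s → Ht W p s (f j) (I (j + 1)))
    (hQ : ∀ s, WF W s → I N s → Q s)
    (hc : ∑ j ∈ Finset.range N, (f j + b.cost + 1) + b.cost + 1 ≤ c) :
    Ht W (.loop b p) s c Q := by
  suffices ∀ M j s, j + M = N → WF W s → I j s → Ht W (.loop b p) s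
      (∑ i ∈ Finset.Ico j N, (f i + b.cost + 1) + b.cost + 1) Q by
    have := this N 0 s (Nat.zero_add N) hs hI
    rw [← Finset.range_eq_Ico] at this
    exact this.mono hc fun _ _ h => h
  intro M
  induction M with
  | zero =>
    intro j s hN hs hI
    have h1 := hb j s hs hI
    have he := Test.eval_false hs b h1.1 (by rw [h1.2]; omega)
    have : j = N := by omega
    subst this
    exact ⟨_, s, by omega, Run.loop_false he, hs, hQ s hs hI⟩
  | succ M ih =>
    intro j s hN hs hI
    have h1 := hb j s hs hI
    have hj : j < N := by omega
    have he := Test.eval_true hs b h1.1 (h1.2.2 hj)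
    obtain ⟨t, s', ht, hr, hw, hI'⟩ := hp j s hj hs hI
    obtain ⟨t', s'', ht', hr', hw', hq⟩ := ih (j + 1) s' (by omega) hw hI'
    refine ⟨_, s'', ?_, Run.loop_true he hr hr', hw', hq⟩
    rw [Finset.sum_eq_sum_Ico_succ_bot hj]
    omega

/-! ### Frames -/

/-- `s'` agrees with `s` on the word registers below `c`, the real registers below `r`, and all
arrays other than the listed ones. -/
structure Keeps (c r : ℕ) (lw lr : List ℕ) (s s' : State) : Prop where
  wreg : ∀ i < c, s'.wreg i = s.wreg i
  rreg : ∀ i < r, s'.rreg i = s.rreg i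
  wmem : ∀ a, a ∉ lw → s'.wmem a = s.wmem a
  rmem : ∀ a, a ∉ lr → s'.rmem a = s.rmem a

theorem Keeps.rfl {c r : ℕ} {lw lr : List ℕ} {s : State} : Keeps c r lw lr s s :=
  ⟨fun _ _ => .refl _, fun _ _ => .refl _, fun _ _ => .refl _, fun _ _ => .refl _⟩

theorem Keeps.trans {c r : ℕ} {lw lr : List ℕ} {s s' s'' : State} (h : Keeps c r lw lr s s')
    (h' : Keeps c r lw lr s' s'') : Keeps c r lw lr s s'' :=
  ⟨fun i hi => (h'.wreg i hi).trans (h.wreg i hi), fun i hi => (h'.rreg i hi).trans (h.rreg i hi),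
    fun a ha => (h'.wmem a ha).trans (h.wmem a ha), fun a ha => (h'.rmem a ha).trans (h.rmem a ha)⟩

theorem Keeps.mono {c r c' r' : ℕ} {lw lr lw' lr' : List ℕ} {s s' : State}
    (h : Keeps c r lw lr s s') (hc : c' ≤ c) (hr : r' ≤ r) (hw : lw ⊆ lw') (hl : lr ⊆ lr') :
    Keeps c' r' lw' lr' s s' :=
  ⟨fun i hi => h.wreg i (by omega), fun i hi => h.rreg i (by omega),
    fun a ha => h.wmem a fun h' => ha (hw h'), fun a ha => h.rmem a fun h' => ha (hl h')⟩

section keeps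
variable {c r : ℕ} {lw lr : List ℕ} {s s' : State} {i j v : ℕ} {x : ℝ}

theorem Keeps.putW (h : Keeps c r lw lr s s') (hi : c ≤ i) : Keeps c r lw lr s (s'.putW i v) :=
  ⟨fun k hk => by rw [putW_wreg, if_neg (by omega)]; exact h.wreg k hk, h.rreg, h.wmem, h.rmem⟩

theorem Keeps.putR (h : Keeps c r lw lr s s') (hi : r ≤ i) : Keeps c r lw lr s (s'.putR i x) :=
  ⟨h.wreg, fun k hk => by rw [putR_rreg, if_neg (by omega)]; exact h.rreg k hk, h.wmem, h.rmem⟩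

theorem Keeps.putWM (h : Keeps c r lw lr s s') (hi : i ∈ lw) :
    Keeps c r lw lr s (s'.putWM i j v) :=
  ⟨h.wreg, h.rreg, fun a ha => by
    rw [putWM_wmem, if_neg (by rintro rfl; exact ha hi)]; exact h.wmem a ha, h.rmem⟩

theorem Keeps.putRM (h : Keeps c r lw lr s s') (hi : i ∈ lr) :
    Keeps c r lw lr s (s'.putRM i j x) :=
  ⟨h.wreg, h.rreg, h.wmem, fun a ha => by
    rw [putRM_rmem, if_neg (by rintro rfl; exact ha hi)]; exact h.rmem a ha⟩
end keeps


/-! ### One pass of merge sort -/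

/-- The sequence `σ`, cut into runs of length `w`, has every run sorted by descending keys. -/
def RunSorted (w m : ℕ) (κ : ℕ → ℝ) (σ : ℕ → ℕ) : Prop :=
  ∀ o o', o ≤ o' → o' < m → o / w = o' / w → κ (σ o') ≤ κ (σ o)

/-- The sequences `σ` and `τ`, cut into runs of length `w`, agree run by run as multisets. -/
def BlockPerm (w m : ℕ) (σ τ : ℕ → ℕ) : Prop :=
  ∀ φ : ℕ → ℕ → ℕ, ∑ o ∈ Finset.range m, φ (o / w) (τ o) = ∑ o ∈ Finset.range m, φ (o / w) (σ o)

theorem BlockPerm.refl (w m : ℕ) (σ : ℕ → ℕ) : BlockPerm w m σ σ := fun _ => rfl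

/-- A run of length `2w` consists of two runs of length `w`, so a weight that depends on the long
run is in particular a weight that depends on the short one. -/
theorem BlockPerm.double {w m : ℕ} {σ τ : ℕ → ℕ} (h : BlockPerm w m σ τ) :
    BlockPerm (w * 2) m σ τ := fun φ => by
  simpa only [Nat.div_div_eq_div_mul] using h fun b => φ (b / 2)

theorem BlockPerm.trans {w m : ℕ} {σ τ υ : ℕ → ℕ} (h : BlockPerm w m σ τ)
    (h' : BlockPerm w m τ υ) : BlockPerm w m σ υ := fun φ => (h' φ).trans (h φ)

theorem BlockPerm.sum {w m : ℕ} {σ τ : ℕ → ℕ} (h : BlockPerm w m σ τ) (φ : ℕ → ℕ) :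
    ∑ o ∈ Finset.range m, φ (τ o) = ∑ o ∈ Finset.range m, φ (σ o) := h fun _ => φ

theorem div_eq_of_mem_block {w B b e : ℕ} (hb : b = B * w) (h : b ≤ e) (h' : e < b + w) :
    e / w = B := by
  subst hb
  rw [Nat.div_eq_iff (by omega)]
  omega

/-- The invariant of the merge loop: `τ` has been filled up to `o`, the current pair of runs
starts at `b`, and `i`, `j` are the next positions of the two runs. -/
structure MergeInv (w m : ℕ) (κ : ℕ → ℝ) (σ τ : ℕ → ℕ) (b i j o : ℕ) : Prop where
  block : ∃ B, b = B * (w * 2)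
  le_i : b ≤ i
  i_le : i ≤ b + w
  le_j : b + w ≤ j
  j_le : j ≤ b + w * 2
  add : i + j = o + b + w
  i_le_m : i ≤ m
  j_le_m : j ≤ m ∨ j = b + w
  sum : ∀ φ : ℕ → ℕ → ℕ, ∑ e ∈ Finset.range o, φ (e / (w * 2)) (τ e) =
    ∑ e ∈ Finset.range b, φ (e / (w * 2)) (σ e) + ∑ e ∈ Finset.Ico b i, φ (e / (w * 2)) (σ e) +
      ∑ e ∈ Finset.Ico (b + w) j, φ (e / (w * 2)) (σ e)
  sorted : RunSorted (w * 2) o κ τ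
  heads_i : ∀ e, b ≤ e → e < o → ∀ i', i ≤ i' → i' < b + w → i' < m → κ (σ i') ≤ κ (τ e)
  heads_j : ∀ e, b ≤ e → e < o → ∀ j', j ≤ j' → j' < b + w * 2 → j' < m → κ (σ j') ≤ κ (τ e)

namespace MergeInv

variable {w m b i j o : ℕ} {κ : ℕ → ℝ} {σ τ τ' : ℕ → ℕ}

theorem init (w m : ℕ) (κ : ℕ → ℝ) (σ τ : ℕ → ℕ) : MergeInv w m κ σ τ 0 0 w 0 where
  block := ⟨0, by simp⟩
  le_i := le_rfl
  i_le := by omega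
  le_j := by omega
  j_le := by omega
  add := by omega
  i_le_m := by omega
  -- The second run of a pair may begin beyond the end of the sequence; this is what the alternative
  -- in `j_le_m` is for.
  j_le_m := Or.inr (by omega)
  sum φ := by simp
  sorted := fun _ _ _ h => absurd h (by omega)
  heads_i := fun _ _ h => absurd h (by omega)
  heads_j := fun _ _ h => absurd h (by omega)

theorem reset (h : MergeInv w m κ σ τ b i j o) (ho : b + w * 2 ≤ o) (hm : o < m) :
    MergeInv w m κ σ τ o o (o + w) o := by
  obtain ⟨B, hB⟩ := h.block
  have h1 := h.i_le
  have h2 := h.j_le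
  have h3 := h.add
  have hi : i = b + w := by omega
  have hj : j = b + w * 2 := by omega
  have hob : o = b + w * 2 := by omega
  refine ⟨⟨B + 1, by rw [hob, hB]; ring⟩, le_rfl, by omega, le_rfl, by omega, by omega,
    hm.le, Or.inr rfl, fun φ => ?_, h.sorted, fun _ _ _ => absurd ‹_› (by omega),
    fun _ _ _ => absurd ‹_› (by omega)⟩
  rw [h.sum φ, hi, hj, hob, Finset.range_eq_Ico, Finset.Ico_self, Finset.Ico_self,
    Finset.sum_empty, Finset.range_eq_Ico, Finset.sum_Ico_consecutive _ (by omega) (by omega),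
    Finset.sum_Ico_consecutive _ (by omega) (by omega)]
  simp

/-- Only entries of the block of `o` have to be compared with the new one, and all of them lie at
positions from `b` on. -/
theorem sorted_succ (h : MergeInv w m κ σ τ b i j o) (ho : o < b + w * 2)
    (hτ : ∀ e < o, τ' e = τ e) (hx : ∀ e, b ≤ e → e < o → κ (τ' o) ≤ κ (τ e)) :
    RunSorted (w * 2) (o + 1) κ τ' := by
  obtain ⟨B, hB⟩ := h.block
  have h1 := h.add
  have h2 := h.le_i
  have h3 := h.le_j
  intro e e' he he' hd
  rcases Nat.lt_or_ge e' o with h' | h'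
  · rw [hτ e' h', hτ e (by omega)]
    exact h.sorted e e' he h' hd
  · obtain rfl : e' = o := by omega
    rcases he.eq_or_lt with rfl | he
    · exact le_rfl
    · rw [hτ e he]
      refine hx e ?_ he
      rw [div_eq_of_mem_block hB (by omega) ho] at hd
      rw [hB, ← hd]
      exact Nat.div_mul_le_self _ _

/-- The emitted key is at most every key already emitted for this pair (`heads_i`), and it bounds
all keys still waiting: those of its own run because that run is sorted, those of the other run by
`hij`, which is vacuous when the other run is exhausted. -/
theorem take_i (h : MergeInv w m κ σ τ b i j o) (ho : o < b + w * 2) (hi : i < b + w)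
    (him : i < m) (hs : RunSorted w m κ σ)
    (hij : ∀ j', j ≤ j' → j' < b + w * 2 → j' < m → κ (σ j') ≤ κ (σ i))
    (hτ : ∀ e < o, τ' e = τ e) (ho' : τ' o = σ i) :
    MergeInv w m κ σ τ' b (i + 1) j (o + 1) := by
  obtain ⟨B, hB⟩ := h.block
  have h1 := h.add
  have h2 := h.le_i
  have h3 := h.le_j
  refine ⟨h.block, by omega, by omega, h.le_j, h.j_le, by omega, him, h.j_le_m, fun φ => ?_,
    h.sorted_succ ho hτ fun e he he' => ?_, fun e he he' i' hi' hi'' hm => ?_,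
    fun e he he' j' hj' hj'' hm => ?_⟩
  · rw [Finset.sum_range_succ, Finset.sum_congr rfl fun e he => by
      rw [hτ e (Finset.mem_range.1 he)], h.sum φ, Finset.sum_Ico_succ_top h2, ho',
      div_eq_of_mem_block hB (by omega) ho, div_eq_of_mem_block hB h2 (by omega)]
    ring
  · rw [ho']
    exact h.heads_i e he he' i le_rfl hi him
  · rcases Nat.lt_or_ge e o with h' | h'
    · rw [hτ e h']
      exact h.heads_i e he h' i' (by omega) hi'' hm
    · obtain rfl : e = o := by omega
      rw [ho']
      have hB' : b = B * 2 * w := by rw [hB]; ring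
      refine hs i i' (by omega) hm ?_
      rw [div_eq_of_mem_block hB' h2 hi, div_eq_of_mem_block hB' (by omega) hi'']
  · rcases Nat.lt_or_ge e o with h' | h'
    · rw [hτ e h']
      exact h.heads_j e he h' j' hj' hj'' hm
    · obtain rfl : e = o := by omega
      rw [ho']
      exact hij j' hj' hj'' hm

theorem take_j (h : MergeInv w m κ σ τ b i j o) (ho : o < b + w * 2) (hj : j < b + w * 2)
    (hjm : j < m) (hs : RunSorted w m κ σ)
    (hij : ∀ i', i ≤ i' → i' < b + w → i' < m → κ (σ i') ≤ κ (σ j))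
    (hτ : ∀ e < o, τ' e = τ e) (ho' : τ' o = σ j) :
    MergeInv w m κ σ τ' b i (j + 1) (o + 1) := by
  obtain ⟨B, hB⟩ := h.block
  have h1 := h.add
  have h2 := h.le_i
  have h3 := h.le_j
  refine ⟨h.block, h2, h.i_le, by omega, by omega, by omega, h.i_le_m, by omega, fun φ => ?_,
    h.sorted_succ ho hτ fun e he he' => ?_, fun e he he' i' hi' hi'' hm => ?_,
    fun e he he' j' hj' hj'' hm => ?_⟩
  · rw [Finset.sum_range_succ, Finset.sum_congr rfl fun e he => by
      rw [hτ e (Finset.mem_range.1 he)], h.sum φ, Finset.sum_Ico_succ_top h3, ho',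
      div_eq_of_mem_block hB (by omega) ho, div_eq_of_mem_block hB (by omega) hj]
    ring
  · rw [ho']
    exact h.heads_j e he he' j le_rfl hj hjm
  · rcases Nat.lt_or_ge e o with h' | h'
    · rw [hτ e h']
      exact h.heads_i e he h' i' hi' hi'' hm
    · obtain rfl : e = o := by omega
      rw [ho']
      exact hij i' hi' hi'' hm
  · rcases Nat.lt_or_ge e o with h' | h'
    · rw [hτ e h']
      exact h.heads_j e he h' j' (by omega) hj'' hm
    · obtain rfl : e = o := by omega
      rw [ho']
      have hB' : b + w = (B * 2 + 1) * w := by rw [hB]; ring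
      refine hs j j' (by omega) hm ?_
      rw [div_eq_of_mem_block hB' h3 (by omega), div_eq_of_mem_block hB' (by omega) (by omega)]

/-- When `m` entries have been written, the last pair may be truncated: either the second run is cut
off at `m`, or it is absent and the first run is cut off. -/
theorem blockPerm (h : MergeInv w m κ σ τ b i j m) : BlockPerm (w * 2) m σ τ := fun φ => by
  have h1 := h.add
  have h2 := h.le_i
  have h3 := h.le_j
  have h4 := h.i_le
  have h5 := h.i_le_m
  have h6 := h.j_le_m
  rw [h.sum φ]
  rcases Nat.lt_or_ge (b + w) m with hm | hm
  · obtain rfl : i = b + w := by omega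
    obtain rfl : j = m := by omega
    rw [Finset.range_eq_Ico, Finset.sum_Ico_consecutive _ (by omega) (by omega),
      Finset.sum_Ico_consecutive _ (by omega) (by omega), Finset.range_eq_Ico]
  · obtain rfl : j = b + w := by omega
    obtain rfl : i = m := by omega
    rw [Finset.range_eq_Ico, Finset.sum_Ico_consecutive _ (by omega) (by omega),
      Finset.Ico_self, Finset.sum_empty, add_zero, Finset.range_eq_Ico]

end MergeInv

/-- Append the next element of the first run. -/
def takeFst (a : ℕ) : Prog :=
  .seq (.storeW a (.add (.reg 71) (.reg 74)) (.load a (.add (.reg 70) (.reg 75))))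
    (.setW 75 (.add (.reg 75) (.const 1)))

/-- Append the next element of the second run. -/
def takeSnd (a : ℕ) : Prog :=
  .seq (.storeW a (.add (.reg 71) (.reg 74)) (.load a (.add (.reg 70) (.reg 76))))
    (.setW 76 (.add (.reg 76) (.const 1)))

/-- Start with the next pair of runs if the current one is exhausted. -/
def mergeReset : Prog :=
  .cond (.wlt (.reg 74) (.add (.reg 77) (.mul (.reg 72) (.const 2)))) .skip
    (.seq (.setW 77 (.reg 74)) (.seq (.setW 75 (.reg 74))
      (.setW 76 (.add (.reg 74) (.reg 72)))))

/-- Append the larger of the next elements of the two runs. -/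
def mergeTake (a K : ℕ) : Prog :=
  .cond (.and (.wlt (.reg 76) (.add (.reg 77) (.mul (.reg 72) (.const 2))))
      (.wlt (.reg 76) (.reg 73)))
    (.cond (.wlt (.reg 75) (.add (.reg 77) (.reg 72)))
      (.cond (.rlt (.load K (.load a (.add (.reg 70) (.reg 75))))
          (.load K (.load a (.add (.reg 70) (.reg 76))))) (takeSnd a) (takeFst a))
      (takeSnd a))
    (takeFst a)

/-- Merge the consecutive pairs of sorted runs of length `wreg 72` of the sequence of `wreg 73`
indices at position `wreg 70` of the word array `a`, comparing by the keys in the real array `K`;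
write the result to position `wreg 71`. -/
def mergePass (a K : ℕ) : Prog :=
  .seq (.seq (.setW 74 (.const 0)) (.seq (.setW 75 (.const 0))
    (.seq (.setW 76 (.reg 72)) (.setW 77 (.const 0)))))
  (.loop (.wlt (.reg 74) (.reg 73))
    (.seq mergeReset (.seq (mergeTake a K) (.setW 74 (.add (.reg 74) (.const 1))))))

/-- The state of the merge loop. -/
structure MergeState (a K src dst w m : ℕ) (s₀ : State) (b i j o : ℕ) (s : State) : Prop where
  keeps : Keeps 74 100 [a] [] s₀ s
  r74 : s.wreg 74 = o
  r75 : s.wreg 75 = i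
  r76 : s.wreg 76 = j
  r77 : s.wreg 77 = b
  mem : ∀ x, x < dst ∨ dst + o ≤ x → s.wmem a x = s₀.wmem a x
  inv : MergeInv w m (s₀.rmem K) (fun e => s₀.wmem a (src + e)) (fun e => s.wmem a (dst + e)) b i j o

section mergePass
variable {W a K src dst w m : ℕ} {s₀ : State}

theorem mergeReset_wp (hw : 0 < w) (h72 : s₀.wreg 72 = w) (hW : m + w * 2 + 2 ≤ W) {s : State} {b i j o : ℕ}
    (ho : o < m) (h : MergeState a K src dst w m s₀ b i j o s) :
    mergeReset.wp W (fun s' => ∃ b i j, o < b + w * 2 ∧ MergeState a K src dst w m s₀ b i j o s')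
      s := by
  have e72 : s.wreg 72 = w := by rw [h.keeps.wreg 72 (by norm_num), h72]
  have h1 := h.inv.add
  have h2 := h.inv.le_i
  have h3 := h.inv.le_j
  simp only [mergeReset, Prog.wp, Test.ok, Test.val, WExp.ok, WExp.val, h.r74, h.r77, e72, putW_wreg,
    true_and]
  refine ⟨by omega, fun hlt => ⟨b, i, j, hlt, h⟩, fun hge => ⟨?_, ?_⟩⟩
  · have : o + w ≤ W := by omega
    simpa [h.r74, e72] using this
  · have h' := h.inv.reset (by omega) ho
    refine ⟨o, o, o + w, by omega, ?_, ?_, ?_, ?_, ?_, ?_, ?_⟩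
    · exact ((h.keeps.putW (by norm_num)).putW (by norm_num)).putW (by norm_num)
    · simp [h.r74]
    · simp [h.r74]
    · simp [h.r74, e72]
    · simp
    · exact h.mem
    · exact h'

/-- Bookkeeping common to both runs: `r` is the pointer that advances, and `hinv` is later supplied
by `MergeInv.take_i` or `MergeInv.take_j`. The source ends before `dst`, so writing never disturbs
it. -/
theorem MergeState.step {s : State} {b i j o : ℕ}
    (hd : src + m ≤ dst) (h : MergeState a K src dst w m s₀ b i j o s)
    {x i' j' r v : ℕ} (hr : r = 75 ∧ j' = j ∧ i' = v ∨ r = 76 ∧ i' = i ∧ j' = v) (hx : x < m)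
    (hinv : ∀ τ', (∀ e < o, τ' e = s.wmem a (dst + e)) → τ' o = s₀.wmem a (src + x) →
      MergeInv w m (s₀.rmem K) (fun e => s₀.wmem a (src + e)) τ' b i' j' (o + 1)) :
    MergeState a K src dst w m s₀ b i' j' (o + 1)
      (((s.putWM a (dst + o) (s.wmem a (src + x))).putW r v).putW 74 (o + 1)) := by
  refine ⟨?_, by simp, ?_, ?_, ?_, fun y hy => ?_, ?_⟩
  · exact ((h.keeps.putWM (by simp)).putW (by omega)).putW (by norm_num)
  · rcases hr with ⟨rfl, rfl, rfl⟩ | ⟨rfl, rfl, rfl⟩ <;> simp [h.r75]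
  · rcases hr with ⟨rfl, rfl, rfl⟩ | ⟨rfl, rfl, rfl⟩ <;> simp [h.r76]
  · rcases hr with ⟨rfl, rfl, rfl⟩ | ⟨rfl, rfl, rfl⟩ <;> simp [h.r77]
  · simp only [putW_wmem, putWM_wmem, if_true]
    rw [Function.update_of_ne (by omega)]
    exact h.mem y (by omega)
  · refine hinv _ (fun e he => ?_) ?_
    · simp only [putW_wmem, putWM_wmem, if_true]
      rw [Function.update_of_ne (by omega)]
    · simp only [putW_wmem, putWM_wmem, if_true, Function.update_self]
      exact h.mem _ (by omega)

theorem mergeTake_wp (h70 : s₀.wreg 70 = src) (h71 : s₀.wreg 71 = dst) (h72 : s₀.wreg 72 = w)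
    (h73 : s₀.wreg 73 = m) (hd : src + m ≤ dst) (hW : dst + m + w * 2 + 2 ≤ W)
    (hs : RunSorted w m (s₀.rmem K) fun e => s₀.wmem a (src + e)) {s : State} {b i j o : ℕ}
    (ho : o < m) (hob : o < b + w * 2) (h : MergeState a K src dst w m s₀ b i j o s) :
    (mergeTake a K).wp W (fun s' => (Prog.setW 74 (.add (.reg 74) (.const 1))).wp W
      (fun s' => ∃ b i j, MergeState a K src dst w m s₀ b i j (o + 1) s') s') s := by
  have e70 : s.wreg 70 = src := by rw [h.keeps.wreg 70 (by norm_num), h70]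
  have e71 : s.wreg 71 = dst := by rw [h.keeps.wreg 71 (by norm_num), h71]
  have e72 : s.wreg 72 = w := by rw [h.keeps.wreg 72 (by norm_num), h72]
  have e73 : s.wreg 73 = m := by rw [h.keeps.wreg 73 (by norm_num), h73]
  have h1 := h.inv.add
  have h2 := h.inv.le_i
  have h3 := h.inv.le_j
  have h4 := h.inv.i_le_m
  have h5 := h.inv.j_le_m
  have h6 := h.inv.i_le
  have h7 := h.inv.j_le
  have key : ∀ x, x < m → s.rmem K (s.wmem a (src + x)) = s₀.rmem K (s₀.wmem a (src + x)) :=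
    fun x hx => by rw [h.mem _ (by omega), h.keeps.rmem K (by simp)]
  simp only [mergeTake, takeFst, takeSnd, Prog.wp, Test.ok, Test.val, RExp.ok, RExp.val, WExp.ok,
    WExp.val, e70, e71, e72, e73, h.r74, h.r75, h.r76, h.r77, putW_wreg, putWM_wreg, true_and,
    and_true, if_true, Nat.reduceEqDiff, if_false]
  have fst : i < b + w → i < m →
      (∀ j', j ≤ j' → j' < b + w * 2 → j' < m →
        s₀.rmem K (s₀.wmem a (src + j')) ≤ s₀.rmem K (s₀.wmem a (src + i))) →
      (dst + o ≤ W ∧ src + i ≤ W ∧ (1 ≤ W ∧ i + 1 ≤ W) ∧ (1 ≤ W ∧ o + 1 ≤ W) ∧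
      ∃ b' i' j', MergeState a K src dst w m s₀ b' i' j' (o + 1)
      (((s.putWM a (dst + o) (s.wmem a (src + i))).putW 75 (i + 1)).putW 74 (o + 1))) :=
    fun hi him hle => ⟨by omega, by omega, by omega, by omega, b, i + 1, j, h.step (x := i) hd
      (Or.inl ⟨rfl, rfl, rfl⟩) him fun τ' hτ hτ' => h.inv.take_i hob hi him hs hle hτ hτ'⟩
  have snd : j < b + w * 2 → j < m →
      (∀ i', i ≤ i' → i' < b + w → i' < m →
        s₀.rmem K (s₀.wmem a (src + i')) ≤ s₀.rmem K (s₀.wmem a (src + j))) →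
      (dst + o ≤ W ∧ src + j ≤ W ∧ (1 ≤ W ∧ j + 1 ≤ W) ∧ (1 ≤ W ∧ o + 1 ≤ W) ∧
      ∃ b' i' j', MergeState a K src dst w m s₀ b' i' j' (o + 1)
      (((s.putWM a (dst + o) (s.wmem a (src + j))).putW 76 (j + 1)).putW 74 (o + 1))) :=
    fun hj hjm hle => ⟨by omega, by omega, by omega, by omega, b, i, j + 1, h.step (x := j) hd
      (Or.inr ⟨rfl, rfl, rfl⟩) hjm fun τ' hτ hτ' => h.inv.take_j hob hj hjm hs hle hτ hτ'⟩
  obtain ⟨B, hB⟩ := h.inv.block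
  have hB1 : b = B * 2 * w := by rw [hB]; ring
  have hB2 : b + w = (B * 2 + 1) * w := by rw [hB]; ring
  refine ⟨by omega, fun ⟨hj, hjm⟩ => ⟨by omega, fun hi => ⟨by omega, fun hlt => ?_, fun hge => ?_⟩,
    fun hi => ?_⟩, fun hj => ?_⟩
  · refine snd hj hjm fun i' hi' hi'' him => ?_
    rw [key i (by omega), key j hjm] at hlt
    refine (hs i i' hi' him ?_).trans hlt.le
    rw [div_eq_of_mem_block hB1 h2 hi, div_eq_of_mem_block hB1 (by omega) hi'']
  · refine fst hi (by omega) fun j' hj' hj'' hjm' => ?_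
    rw [key i (by omega), key j hjm] at hge
    refine (hs j j' hj' hjm' ?_).trans (not_lt.1 hge)
    rw [div_eq_of_mem_block hB2 h3 (by omega), div_eq_of_mem_block hB2 (by omega) (by omega)]
  · exact snd hj hjm fun i' hi' hi'' => absurd hi'' (by omega)
  -- With the second run exhausted, `o < m` and `i + j = o + b + w` guarantee that the first run
  -- still has an entry.
  · exact fst (by omega) (by omega) fun j' hj' hj'' hjm' => absurd hjm' (by omega)

theorem mergePass_spec (hwf : WF W s₀) (hw : 0 < w) (h70 : s₀.wreg 70 = src)
    (h71 : s₀.wreg 71 = dst) (h72 : s₀.wreg 72 = w) (h73 : s₀.wreg 73 = m) (hd : src + m ≤ dst)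
    (hW : dst + m + w * 2 + 2 ≤ W)
    (hs : RunSorted w m (s₀.rmem K) fun e => s₀.wmem a (src + e)) :
    Ht W (mergePass a K) s₀ (70 * m + 20) fun s => Keeps 74 100 [a] [] s₀ s ∧
      (∀ x, x < dst ∨ dst + m ≤ x → s.wmem a x = s₀.wmem a x) ∧
      BlockPerm (w * 2) m (fun e => s₀.wmem a (src + e)) (fun e => s.wmem a (dst + e)) ∧
      RunSorted (w * 2) m (s₀.rmem K) (fun e => s.wmem a (dst + e)) := by
  have hinit : (Prog.seq (.setW 74 (.const 0)) (.seq (.setW 75 (.const 0))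
      (.seq (.setW 76 (.reg 72)) (.setW 77 (.const 0))))).wp W
      (MergeState a K src dst w m s₀ 0 0 w 0) s₀ := by
    simp only [Prog.wp, WExp.ok, WExp.val, zero_le, true_and, putW_wreg, h72]
    refine ⟨(((Keeps.rfl.putW ?_).putW ?_).putW ?_).putW ?_, ?_, ?_, ?_, ?_, fun x hx => rfl,
      MergeInv.init _ _ _ _ _⟩ <;> simp [h72]
  refine Ht.seq_wp (c' := 70 * m + 5) hwf hinit (fun s hs' h => ?_) (by simp [Prog.cost, WExp.cost]; omega)
  refine Ht.loop_count (fun o s => ∃ b i j, MergeState a K src dst w m s₀ b i j o s) m (fun _ => 64)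
    hs' ⟨_, _, _, h⟩ ?_ ?_ ?_ ?_
  · rintro o s - ⟨b, i, j, h⟩
    have e73 : s.wreg 73 = m := by rw [h.keeps.wreg 73 (by norm_num), h73]
    simp [Test.ok, Test.val, WExp.ok, WExp.val, h.r74, e73]
  · rintro o s ho hwf' ⟨b, i, j, h⟩
    refine Ht.seq_wp (c' := 48) hwf' (mergeReset_wp hw h72 (by omega) ho h)
      (fun s' hwf'' ⟨b, i, j, hob, h⟩ => Ht.of_wp hwf''
        (mergeTake_wp h70 h71 h72 h73 hd hW hs ho hob h) ?_) ?_
    · simp [Prog.cost, WExp.cost, mergeTake, takeFst, takeSnd, Test.cost, RExp.cost]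
    · simp [Prog.cost, WExp.cost, mergeReset, Test.cost, RExp.cost]
  · rintro s - ⟨b, i, j, h⟩
    exact ⟨h.keeps, h.mem, h.inv.blockPerm, h.inv.sorted⟩
  · simp [Test.cost, WExp.cost]
    omega

end mergePass


/-! ### Bottom-up merge sort with all levels kept. -/

/-- Repeated merge passes; the sequence of `wreg 73` indices obtained after `h` passes, which
consists of sorted runs of length `2 ^ h`, is stored at position `wreg 70 + h * wreg 73` of the
array `a`. -/
def passes (a K : ℕ) : Prog :=
  .loop (.wlt (.reg 72) (.reg 60))
    (.seq (mergePass a K) (.seq (.setW 70 (.reg 71)) (.seq (.setW 71 (.add (.reg 71) (.reg 73)))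
      (.setW 72 (.mul (.reg 72) (.const 2))))))

theorem RunSorted.one (m : ℕ) (κ : ℕ → ℝ) (σ : ℕ → ℕ) : RunSorted 1 m κ σ := by
  intro o o' _ _ h
  simp only [Nat.div_one] at h
  rw [h]

/-- The result of the first `h` merge passes. -/
structure PassState (a K base m h : ℕ) (s₀ s : State) : Prop where
  keeps : Keeps 70 100 [a] [] s₀ s
  mem_low : ∀ x < base + m, s.wmem a x = s₀.wmem a x
  mem_high : ∀ x, base + (h + 1) * m ≤ x → s.wmem a x = s₀.wmem a x
  r70 : s.wreg 70 = base + h * m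
  r71 : s.wreg 71 = base + (h + 1) * m
  r72 : s.wreg 72 = 2 ^ h
  r73 : s.wreg 73 = m
  level : ∀ g ≤ h, BlockPerm (2 ^ g) m (fun e => s₀.wmem a (base + e))
      (fun e => s.wmem a (base + g * m + e)) ∧
    RunSorted (2 ^ g) m (s₀.rmem K) (fun e => s.wmem a (base + g * m + e))

theorem PassState.succ {W a K base m h : ℕ} {s₀ s : State} (hs : PassState a K base m h s₀ s)
    (hwf : WF W s) (hW : base + (h + 2) * m + 2 ^ h * 2 + 2 ≤ W) :
    Ht W (.seq (mergePass a K) (.seq (.setW 70 (.reg 71)) (.seq (.setW 71 (.add (.reg 71) (.reg 73)))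
      (.setW 72 (.mul (.reg 72) (.const 2)))))) s (70 * m + 40) (PassState a K base m (h + 1) s₀) := by
  have hm : base + (h + 2) * m = base + (h + 1) * m + m := by ring
  have hm' : base + (h + 1) * m = base + h * m + m := by ring
  have hκ : s.rmem K = s₀.rmem K := hs.keeps.rmem K (by simp)
  refine (mergePass_spec (K := K) hwf (pow_pos two_pos h) hs.r70 hs.r71 hs.r72 hs.r73 (by omega)
    (by omega) (by rw [hκ]; exact (hs.level h le_rfl).2)).seq (c' := 20) ?_ le_rfl
  rintro s' hwf' ⟨hk, hmem, hperm, hsort⟩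
  refine Ht.of_wp hwf' ?_ (by simp [Prog.cost, WExp.cost])
  have e71 : s'.wreg 71 = base + (h + 1) * m := by rw [hk.wreg 71 (by norm_num), hs.r71]
  have e72 : s'.wreg 72 = 2 ^ h := by rw [hk.wreg 72 (by norm_num), hs.r72]
  have e73 : s'.wreg 73 = m := by rw [hk.wreg 73 (by norm_num), hs.r73]
  simp only [Prog.wp, WExp.ok, WExp.val, putW_wreg, Nat.reduceEqDiff, if_false, true_and, e71, e72,
    e73]
  refine ⟨by omega, by omega, ?_, fun x hx => ?_, fun x hx => ?_, ?_, ?_, ?_, ?_, fun g hg => ?_⟩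
  · exact (((hs.keeps.trans (hk.mono (by norm_num) le_rfl (by simp) (by simp))).putW
      (by norm_num)).putW (by norm_num)).putW (by norm_num)
  · simp only [putW_wmem]
    rw [hmem x (Or.inl (by rw [hm']; have := Nat.le_mul_of_pos_left m (Nat.succ_pos h); nlinarith)),
      hs.mem_low x hx]
  · simp only [putW_wmem]
    rw [hmem x (Or.inr (by linarith)), hs.mem_high x (by linarith)]
  · simp
  · simp; ring
  · simp [pow_succ]
  · simp [e73]
  · simp only [putW_wmem]
    rcases Nat.lt_or_ge g (h + 1) with hg' | hg'
    · obtain ⟨h1, h2⟩ := hs.level g (by omega)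
      have : ∀ e < m, s'.wmem a (base + g * m + e) = s.wmem a (base + g * m + e) := fun e he => by
        refine hmem _ (Or.inl ?_)
        have : g * m ≤ h * m := Nat.mul_le_mul_right m (by omega)
        omega
      refine ⟨fun φ => ?_, fun o o' ho ho' hd => ?_⟩
      · rw [← h1 φ]
        exact Finset.sum_congr rfl fun e he => by
          simp only [this e (Finset.mem_range.1 he)]
      · simp only [this o (by omega), this o' ho']
        exact h2 o o' ho ho' hd
    · obtain rfl : g = h + 1 := by omega
      rw [pow_succ, ← hκ]
      exact ⟨(hs.level h le_rfl).1.double.trans hperm, hsort⟩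

/-- The target run length `lim` is separate from the length `m` of the sequence: sorting uses `lim =
m`, whereas the sampling in `findSplitter` stops at runs of length `32`. -/
theorem passes_spec {W a K base m lim : ℕ} {s₀ : State} (hwf : WF W s₀) (h60 : s₀.wreg 60 = lim)
    (h70 : s₀.wreg 70 = base) (h71 : s₀.wreg 71 = base + m) (h72 : s₀.wreg 72 = 1)
    (h73 : s₀.wreg 73 = m) (hW : base + (Nat.clog 2 lim + 1) * m + lim * 2 + 2 ≤ W) :
    Ht W (passes a K) s₀ (Nat.clog 2 lim * (70 * m + 50) + 10)
      (PassState a K base m (Nat.clog 2 lim) s₀) := by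
  refine Ht.loop_count (fun h s => h ≤ Nat.clog 2 lim ∧ PassState a K base m h s₀ s) (Nat.clog 2 lim)
    (fun _ => 70 * m + 40) hwf ⟨zero_le, ?_⟩ ?_ ?_ ?_ ?_
  · refine ⟨Keeps.rfl, fun _ _ => rfl, fun _ _ => rfl, by simp [h70], by simp [h71], by simp [h72],
      h73, fun g hg => ?_⟩
    obtain rfl : g = 0 := by omega
    simpa using ⟨BlockPerm.refl _ _ _, RunSorted.one _ _ _⟩
  · rintro h s - ⟨hh, hs⟩
    have e60 : s.wreg 60 = lim := by rw [hs.keeps.wreg 60 (by norm_num), h60]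
    simp only [Test.ok, Test.val, WExp.ok, WExp.val, hs.r72, e60, true_and]
    rw [← not_le, ← not_le, not_iff_not]
    exact (Nat.clog_le_iff_le_pow one_lt_two).symm
  · rintro h s hlt hwf' ⟨hh, hs⟩
    have h1 : (h + 2) * m ≤ (Nat.clog 2 lim + 1) * m := Nat.mul_le_mul_right m (by omega)
    have h2 : 2 ^ h < lim := by
      rw [← not_le] at hlt ⊢
      exact fun h' => hlt (((Nat.clog_le_iff_le_pow one_lt_two).symm).1 h')
    exact (hs.succ hwf' (by omega)).mono le_rfl fun s' _ h' => ⟨hlt, h'⟩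
  · rintro s - ⟨-, hs⟩
    exact hs
  · simp [Test.cost, WExp.cost]
    ring_nf
    omega


/-! ### Counting and ranks -/

open Classical in
/-- The number of indices below `m` whose value satisfies `p`. -/
noncomputable def cnt (p : ℝ → Prop) (f : ℕ → ℝ) (m : ℕ) : ℕ :=
  ∑ e ∈ Finset.range m, if p (f e) then 1 else 0

section cnt
variable {p r : ℝ → Prop} {f g : ℕ → ℝ} {m : ℕ}

open Classical in
theorem cnt_succ : cnt p f (m + 1) = cnt p f m + if p (f m) then 1 else 0 :=
  Finset.sum_range_succ _ _

theorem cnt_succ_pos (h : p (f m)) : cnt p f (m + 1) = cnt p f m + 1 := by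
  rw [cnt_succ, if_pos h]

theorem cnt_succ_neg (h : ¬ p (f m)) : cnt p f (m + 1) = cnt p f m := by
  rw [cnt_succ, if_neg h, add_zero]

theorem cnt_zero : cnt p f 0 = 0 := rfl

theorem cnt_true : cnt (fun _ => True) f m = m := by simp [cnt]

theorem cnt_congr (h : ∀ e < m, p (f e) ↔ r (g e)) : cnt p f m = cnt r g m := by
  classical
  exact Finset.sum_congr rfl fun e he => by simp [h e (Finset.mem_range.1 he)]

theorem cnt_mono (h : ∀ e < m, p (f e) → r (g e)) : cnt p f m ≤ cnt r g m := by
  classical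
  refine Finset.sum_le_sum fun e he => ?_
  have := h e (Finset.mem_range.1 he)
  split_ifs <;> simp_all

theorem cnt_le : cnt p f m ≤ m :=
  (cnt_mono (r := fun _ => True) (g := f) fun _ _ _ => trivial).trans cnt_true.le

theorem cnt_add_not : cnt p f m + cnt (fun x => ¬ p x) f m = m := by
  classical
  conv_rhs => rw [← cnt_true (f := f) (m := m)]
  rw [cnt, cnt, cnt, ← Finset.sum_add_distrib]
  exact Finset.sum_congr rfl fun e _ => by by_cases h : p (f e) <;> simp [h]

theorem cnt_split (q : ℝ → Prop) :
    cnt p f m = cnt (fun x => q x ∧ p x) f m + cnt (fun x => ¬ q x ∧ p x) f m := by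
  classical
  rw [cnt, cnt, cnt, ← Finset.sum_add_distrib]
  exact Finset.sum_congr rfl fun e _ => by by_cases h : q (f e) <;> simp [h]

theorem exists_of_cnt_pos (h : 0 < cnt p f m) : ∃ e < m, p (f e) := by
  classical
  by_contra! hn
  refine h.ne' (Finset.sum_eq_zero fun e he => if_neg (hn e (Finset.mem_range.1 he)))

theorem BlockPerm.cnt {w : ℕ} {σ τ : ℕ → ℕ} (h : BlockPerm w m σ τ) (κ : ℕ → ℝ) :
    cnt p (fun e => κ (τ e)) m = cnt p (fun e => κ (σ e)) m := by
  classical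
  exact h.sum fun x => if p (κ x) then 1 else 0

/-- Sum the indicator of failure over both sequences. -/
theorem BlockPerm.forall {w : ℕ} {σ τ : ℕ → ℕ} (h : BlockPerm w m σ τ) {p : ℕ → Prop}
    (hσ : ∀ e < m, p (σ e)) : ∀ e < m, p (τ e) := by
  classical
  by_contra! hn
  obtain ⟨e, he, hn⟩ := hn
  have h1 := h.sum fun x => if p x then 0 else 1
  rw [Finset.sum_eq_zero (s := Finset.range m) (f := fun o => if p (σ o) then 0 else 1)
    fun e he => if_pos (hσ e (Finset.mem_range.1 he)), Finset.sum_eq_zero_iff] at h1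
  have := h1 e (Finset.mem_range.2 he)
  rw [if_neg hn] at this
  omega

theorem BlockPerm.lt {w n : ℕ} {σ τ : ℕ → ℕ} (h : BlockPerm w m σ τ) (hσ : ∀ e < m, σ e < n) :
    ∀ e < m, τ e < n :=
  h.forall (p := fun x => x < n) hσ

end cnt

/-- `v` is the `q`-th largest of the values `f 0, …, f (m - 1)`. -/
def IsKth (f : ℕ → ℝ) (m q : ℕ) (v : ℝ) : Prop :=
  cnt (fun x => v < x) f m < q ∧ q ≤ cnt (fun x => v ≤ x) f m

/-- At least `q` values exceed `z`, so the discarded values, all at most `z`, cannot influence rank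
`q`. If `v` were below `z`, all listed values would exceed `v`, too many for rank `q`. -/
theorem IsKth.of_gt {f g : ℕ → ℝ} {m m' q : ℕ} {v z : ℝ}
    (h : ∀ r : ℝ → Prop, cnt r g m' = cnt (fun x => z < x ∧ r x) f m)
    (hq : q ≤ cnt (fun x => z < x) f m) (hv : IsKth g m' q v) : IsKth f m q v := by
  obtain ⟨h1, h2⟩ := hv
  rw [h] at h1 h2
  refine ⟨?_, h2.trans (cnt_mono fun _ _ h => h.2)⟩
  rcases lt_or_ge v z with hvz | hvz
  · exact absurd (hq.trans (cnt_mono (r := fun x => z < x ∧ v < x) fun _ _ h => ⟨h, hvz.trans h⟩))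
      (by omega)
  · exact (cnt_mono fun _ _ h => ⟨hvz.trans_lt h, h⟩).trans_lt h1

/-- Some listed value is at least `v`, so `v < z`; hence all discarded values exceed `v`, and they
shift its rank by exactly their number. -/
theorem IsKth.of_lt {f g : ℕ → ℝ} {m m' q : ℕ} {v z : ℝ}
    (h : ∀ r : ℝ → Prop, cnt r g m' = cnt (fun x => x < z ∧ r x) f m)
    (hq : cnt (fun x => z ≤ x) f m < q) (hv : IsKth g m' (q - cnt (fun x => z ≤ x) f m) v) :
    IsKth f m q v := by
  obtain ⟨h1, h2⟩ := hv
  rw [h] at h1 h2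
  obtain ⟨e, -, he⟩ := exists_of_cnt_pos (lt_of_lt_of_le (by omega) h2)
  have hvz : v < z := he.2.trans_lt he.1
  have e1 := cnt_split (p := fun x => v < x) (f := f) (m := m) fun x => x < z
  have e2 := cnt_split (p := fun x => v ≤ x) (f := f) (m := m) fun x => x < z
  rw [cnt_congr (p := fun x => ¬ x < z ∧ v < x) (r := fun x => z ≤ x) (g := f)
    fun e _ => by simpa using fun h => hvz.trans_le h] at e1
  rw [cnt_congr (p := fun x => ¬ x < z ∧ v ≤ x) (r := fun x => z ≤ x) (g := f)
    fun e _ => by simpa using fun h => (hvz.trans_le h).le] at e2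
  constructor <;> omega

/-! ### Thinning sorted runs -/

theorem sum_range_two_mul (f : ℕ → ℕ) (M : ℕ) :
    ∑ x ∈ Finset.range (2 * M), f x = ∑ e ∈ Finset.range M, (f (2 * e) + f (2 * e + 1)) := by
  induction M with
  | zero => rfl
  | succ M ih =>
    rw [Finset.sum_range_succ, ← ih, Nat.mul_succ, Finset.sum_range_succ, Finset.sum_range_succ]
    ring

/-- An upward closed predicate. -/
def Upper (p : ℝ → Prop) : Prop := ∀ x y, x ≤ y → p x → p y

theorem RunSorted.thin {v L : ℕ} {κ : ℕ → ℝ} {σ σ' : ℕ → ℕ} (h : RunSorted (v * 2) L κ σ)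
    (hσ : ∀ e < (L + 1) / 2, σ' e = σ (2 * e)) : RunSorted v ((L + 1) / 2) κ σ' := by
  intro e e' he he' hd
  rw [hσ e (by omega), hσ e' he']
  refine h _ _ (by omega) (by omega) ?_
  rw [mul_comm v, Nat.mul_div_mul_left _ _ two_pos, Nat.mul_div_mul_left _ _ two_pos, hd]

/-- In each sorted run an upper set occupies an initial segment. Runs have even length `v * 2` and
so start at even positions; the even positions of a segment are half of it, rounded up. Doubling
therefore overcounts by at most one per run, and there are at most `L / (v * 2) + 1` runs. -/
theorem cnt_thin {v L : ℕ} {κ : ℕ → ℝ} {σ σ' : ℕ → ℕ} {p : ℝ → Prop} (hp : Upper p)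
    (h : RunSorted (v * 2) L κ σ) (hσ : ∀ e < (L + 1) / 2, σ' e = σ (2 * e)) :
    cnt p (fun e => κ (σ e)) L ≤ 2 * cnt p (fun e => κ (σ' e)) ((L + 1) / 2) ∧
    2 * cnt p (fun e => κ (σ' e)) ((L + 1) / 2) ≤
      cnt p (fun e => κ (σ e)) L + (L / (v * 2) + 1) := by
  classical
  set M := (L + 1) / 2 with hM
  -- Extending the indicator by `0` beyond `L` lets positions be paired also when `L` is odd.
  set g : ℕ → ℕ := fun x => if x < L ∧ p (κ (σ x)) then 1 else 0 with hg
  have hrun : ∀ e x, 2 * e ≤ x → x < L → 2 * e / (v * 2) = x / (v * 2) → p (κ (σ x)) →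
      p (κ (σ (2 * e))) := fun e x hx hL hd hpx => hp _ _ (h _ _ hx hL hd) hpx
  have hdiv : ∀ e, (2 * e + 1) / (v * 2) = e / v := fun e => by
    rw [mul_comm v, ← Nat.div_div_eq_div_mul]; congr 1; omega
  have hdiv' : ∀ e, 2 * e / (v * 2) = e / v := fun e => by
    rw [mul_comm v, ← Nat.div_div_eq_div_mul]; congr 1; omega
  have e1 : cnt p (fun e => κ (σ e)) L = ∑ e ∈ Finset.range M, (g (2 * e) + g (2 * e + 1)) := by
    rw [← sum_range_two_mul, cnt]
    have : Finset.range L ⊆ Finset.range (2 * M) := Finset.range_subset_range.2 (by omega)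
    rw [← Finset.sum_subset this]
    · exact Finset.sum_congr rfl fun e he => by simp [hg, Finset.mem_range.1 he]
    · intro x _ hx
      simp only [Finset.mem_range] at hx
      simp [hg, hx]
  have e2 : cnt p (fun e => κ (σ' e)) M = ∑ e ∈ Finset.range M, g (2 * e) := by
    refine Finset.sum_congr rfl fun e he => ?_
    have he := Finset.mem_range.1 he
    simp only [hg, hσ e he, show 2 * e < L by omega, true_and]
  have hle : ∀ e, g (2 * e + 1) ≤ g (2 * e) := fun e => by
    simp only [hg]
    split_ifs with h1 h2 <;> try simp
    exact h2 ⟨by omega, hrun e _ (by omega) h1.1 (by rw [hdiv, hdiv']) h1.2⟩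
  rw [e1, e2, Finset.mul_sum]
  refine ⟨Finset.sum_le_sum fun e _ => by have := hle e; omega, ?_⟩
  -- A pair is overcounted only where the segment of a run ends, hence at most once per run: the run
  -- number `e / v` is injective on such pairs.
  have e3 : ∑ e ∈ Finset.range M, (g (2 * e) - g (2 * e + 1)) ≤ L / (v * 2) + 1 := by
    have : ∀ e ∈ Finset.range M, g (2 * e) - g (2 * e + 1) =
        if (p (κ (σ (2 * e))) ∧ ¬ (2 * e + 1 < L ∧ p (κ (σ (2 * e + 1))))) then 1 else 0 := by
      intro e he
      have he := Finset.mem_range.1 he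
      have := hle e
      simp only [hg, show 2 * e < L by omega, true_and]
      by_cases h1 : p (κ (σ (2 * e))) <;>
        by_cases h2 : 2 * e + 1 < L ∧ p (κ (σ (2 * e + 1))) <;> simp [h1, h2]
    rw [Finset.sum_congr rfl this, ← Finset.card_filter, ← Finset.card_range (L / (v * 2) + 1)]
    refine Finset.card_le_card_of_injOn (fun e => e / v) (fun e he => ?_) ?_
    · simp only [Finset.coe_filter, Finset.mem_range, Set.mem_ofPred_eq] at he
      simp only [Finset.coe_range, Set.mem_Iio, Nat.lt_succ_iff]
      rw [← hdiv']
      exact Nat.div_le_div_right (by omega)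
    · have aux : ∀ e e', e < e' → e' < M → e / v = e' / v → p (κ (σ (2 * e'))) →
          2 * e + 1 < L ∧ p (κ (σ (2 * e + 1))) := fun e e' hlt he' hd hp' =>
        ⟨by omega, hp _ _ (h (2 * e + 1) (2 * e') (by omega) (by omega)
          (by rw [hdiv, hdiv', hd])) hp'⟩
      intro e he e' he' hd
      simp only [Finset.coe_filter, Finset.mem_range, Set.mem_ofPred_eq] at he he'
      rcases lt_trichotomy e e' with hlt | heq | hlt
      · exact absurd (aux e e' hlt he'.1 hd he'.2.1) he.2.2
      · exact heq
      · exact absurd (aux e' e hlt he.1 hd.symm he.2.1) he'.2.2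
  have e4 : ∑ e ∈ Finset.range M, 2 * g (2 * e) =
      ∑ e ∈ Finset.range M, (g (2 * e) + g (2 * e + 1)) +
        ∑ e ∈ Finset.range M, (g (2 * e) - g (2 * e + 1)) := by
    rw [← Finset.sum_add_distrib]
    exact Finset.sum_congr rfl fun e _ => by have := hle e; omega
  omega

/-- `σ` lists `L` indices below `m`, in sorted runs of length `w = 32 * 2 ^ t`, such that
`2 ^ t` times the number of listed values in an upper set approximates the number of all values
in that set. -/
structure Sample (X : ℕ → ℝ) (m w L t : ℕ) (σ : ℕ → ℕ) : Prop where
  width : w = 32 * 2 ^ t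
  sorted : RunSorted w L X σ
  lt : ∀ e < L, σ e < m
  lower : ∀ p, Upper p → cnt p X m ≤ 2 ^ t * cnt p (fun e => X (σ e)) L
  upper : ∀ p, Upper p →
    w * (2 ^ t * cnt p (fun e => X (σ e)) L) + 6 * m ≤ w * cnt p X m + 6 * m * 2 ^ t

namespace Sample
variable {X : ℕ → ℝ} {m w L t : ℕ} {σ : ℕ → ℕ}

theorem init (hs : RunSorted 32 m X σ) (hσ : BlockPerm 32 m (fun e => e) σ) :
    Sample X m 32 m 0 σ where
  width := rfl
  sorted := hs
  lt := hσ.lt fun _ h => h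
  lower p _ := by rw [hσ.cnt]; simp
  upper p _ := by rw [hσ.cnt]; simp

/-- Dividing `Sample.upper` by `w = 32 * 2 ^ t` bounds the overestimate of a count by `(6 / 32) * m
* (1 - 2 ^ (-t))`. For the set of all values this is the factor `38 / 32 = 1 + 6 / 32`. -/
theorem length_le (h : Sample X m w L t σ) : 32 * (2 ^ t * L) ≤ 38 * m := by
  have h1 := h.upper (fun _ => True) fun _ _ _ h => h
  rw [cnt_true, cnt_true, h.width] at h1
  have h2 : 0 < 2 ^ t := by positivity
  refine Nat.le_of_mul_le_mul_left (c := 2 ^ t) ?_ h2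
  nlinarith

theorem le_length (h : Sample X m w L t σ) : m ≤ 2 ^ t * L := by
  have h1 := h.lower (fun _ => True) fun _ _ _ h => h
  rwa [cnt_true, cnt_true] at h1

/-- Two merge passes quadruple the run length and the thinning halves it again, so runs double while
the sample halves. The new rank error is one element per run of length `4w`, weighted by `2 ^ t`;
since `w < L`, this is small compared with the sample. -/
theorem thin (h : Sample X m w L t σ) (hL : w < L) {τ τ' : ℕ → ℕ}
    (hp : BlockPerm (w * 2 * 2) L σ τ) (hs : RunSorted (w * 2 * 2) L X τ)
    (hτ : ∀ e < (L + 1) / 2, τ' e = τ (2 * e)) :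
    Sample X m (w * 2) ((L + 1) / 2) (t + 1) τ' := by
  have hw : 0 < w := by rw [h.width]; positivity
  refine ⟨by rw [h.width]; ring, hs.thin hτ, fun e he => ?_, fun p hp' => ?_, fun p hp' => ?_⟩
  · rw [hτ e he]
    exact hp.lt h.lt _ (by omega)
  · have h1 := h.lower p hp'
    have h2 := (cnt_thin hp' hs hτ).1
    rw [hp.cnt] at h2
    rw [pow_succ, mul_assoc]
    exact h1.trans (Nat.mul_le_mul_left _ h2)
  · have h1 := h.upper p hp'
    have h2 := (cnt_thin hp' hs hτ).2
    rw [hp.cnt] at h2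
    have h3 := h.length_le
    have h4 : w * (L / (w * 2 * 2) + 1) * 4 ≤ 5 * L := by
      have := Nat.div_mul_le_self L (w * 2 * 2)
      nlinarith
    -- The budget `3 * m` is what the recursion allows: `2 * (6 * m * 2 ^ t - 6 * m) + 2 * (3 * m) =
    -- 6 * m * 2 ^ (t + 1) - 6 * m`.
    have h5 : 2 ^ t * (w * (L / (w * 2 * 2) + 1)) ≤ 3 * m := by
      have := Nat.mul_le_mul_left (2 ^ t) h4
      nlinarith
    have h6 := Nat.mul_le_mul_left (w * 2 * 2 ^ t) h2
    rw [pow_succ]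
    nlinarith

/-- For `L ≤ w` the sample is a single sorted run. At most half of it exceeds the median, so at most
`19/32` of all values do. At least half of it is at least the median, which after subtracting the
error `6/32` leaves at least `5/16` of all values there, so at most `11/16` are smaller. -/
theorem median (h : Sample X m w L t σ) (hL : L ≤ w) (hm : 0 < m) :
    σ (L / 2) < m ∧ 16 * cnt (fun x => X (σ (L / 2)) < x) X m ≤ 11 * m ∧
      16 * cnt (fun x => x < X (σ (L / 2))) X m ≤ 11 * m := by
  have h1 := h.length_le
  have h2 := h.le_length
  have hL0 : 0 < L := by
    rcases Nat.eq_zero_or_pos L with rfl | h'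
    · omega
    · exact h'
  have hsort : ∀ o o', o ≤ o' → o' < L → X (σ o') ≤ X (σ o) := fun o o' h' h'' =>
    h.sorted o o' h' h'' (by rw [Nat.div_eq_of_lt (by omega), Nat.div_eq_of_lt (by omega)])
  set z := X (σ (L / 2)) with hz
  have gt : cnt (fun x => z < x) (fun e => X (σ e)) L ≤ L / 2 := by
    classical
    rw [cnt, ← Finset.card_filter]
    conv_rhs => rw [← Finset.card_range (L / 2)]
    refine Finset.card_le_card fun e he => ?_
    simp only [Finset.mem_filter, Finset.mem_range] at he ⊢
    by_contra! hge
    exact absurd he.2 (not_lt.2 (hsort _ _ hge he.1))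
  have ge : L / 2 + 1 ≤ cnt (fun x => z ≤ x) (fun e => X (σ e)) L := by
    classical
    rw [cnt, ← Finset.card_filter]
    conv_lhs => rw [← Finset.card_range (L / 2 + 1)]
    refine Finset.card_le_card fun e he => ?_
    simp only [Finset.mem_filter, Finset.mem_range] at he ⊢
    exact ⟨by omega, hsort _ _ (by omega) (by omega)⟩
  have u1 : Upper fun x => z < x := fun x y hxy hx => hx.trans_le hxy
  have u2 : Upper fun x => z ≤ x := fun x y hxy hx => hx.trans hxy
  refine ⟨h.lt _ (by omega), ?_, ?_⟩
  · have h3 := (h.lower _ u1).trans (Nat.mul_le_mul_left _ gt)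
    have h4 : 2 * (2 ^ t * (L / 2)) ≤ 2 ^ t * L := by
      have : 2 * (L / 2) ≤ L := by omega
      calc 2 * (2 ^ t * (L / 2)) = 2 ^ t * (2 * (L / 2)) := by ring
        _ ≤ _ := Nat.mul_le_mul_left _ this
    omega
  · have h3 := h.upper _ u2
    have h4 : 2 ^ t * L ≤ 2 * (2 ^ t * cnt (fun x => z ≤ x) (fun e => X (σ e)) L) := by
      have : L ≤ 2 * cnt (fun x => z ≤ x) (fun e => X (σ e)) L := by omega
      calc 2 ^ t * L ≤ 2 ^ t * (2 * _) := Nat.mul_le_mul_left _ this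
        _ = _ := by ring
    have h5 : cnt (fun x => z ≤ x) X m + cnt (fun x => x < z) X m = m := by
      simpa only [not_le] using cnt_add_not (p := fun x => z ≤ x) (f := X) (m := m)
    have h6 : 32 * (2 ^ t * cnt (fun x => z ≤ x) (fun e => X (σ e)) L) ≤
        32 * cnt (fun x => z ≤ x) X m + 6 * m := by
      refine Nat.le_of_mul_le_mul_left (c := 2 ^ t) ?_ (by positivity)
      rw [h.width] at h3
      nlinarith
    omega

end Sample


/-! ### Linear-time selection -/

/-- Fill the index array `7` with `0, 1, …, wreg 40 - 1`. -/
def fillIndices : Prog :=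
  .seq (.setW 50 (.const 0)) (.loop (.wlt (.reg 50) (.reg 40))
    (.seq (.storeW 7 (.reg 50) (.reg 50)) (.setW 50 (.add (.reg 50) (.const 1)))))

theorem fillIndices_spec {W m : ℕ} {s₀ : State} (hwf : WF W s₀) (h40 : s₀.wreg 40 = m)
    (hW : m + 1 ≤ W) : Ht W fillIndices s₀ (20 * m + 20) fun s =>
      Keeps 50 100 [7] [] s₀ s ∧ ∀ e < m, s.wmem 7 e = e := by
  refine Ht.seq_wp (c' := 20 * m + 10) (Q := fun s => Keeps 50 100 [7] [] s₀ s ∧ s.wreg 50 = 0)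
    hwf ?_ (fun s hs h => ?_) (by simp [Prog.cost, WExp.cost]; omega)
  · simp [Prog.wp, WExp.ok, WExp.val, Keeps.rfl.putW]
  refine Ht.loop_count (fun j s => j ≤ m ∧ Keeps 50 100 [7] [] s₀ s ∧ s.wreg 50 = j ∧
    ∀ e < j, s.wmem 7 e = e) m (fun _ => 10) hs ⟨zero_le, h.1, h.2, by simp⟩ ?_ ?_ ?_ ?_
  · rintro j s - ⟨-, hk, hj, -⟩
    simp [Test.ok, Test.val, WExp.ok, WExp.val, hj, hk.wreg 40, h40]
  · rintro j s hj hs ⟨-, hk, h50, hm⟩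
    refine Ht.of_wp hs ?_ (by simp [Prog.cost, WExp.cost])
    have h1 : 1 ≤ W := by omega
    have h2 : j + 1 ≤ W := by omega
    simp only [Prog.wp, WExp.ok, WExp.val, h50, putWM_wreg, true_and, h1, h2]
    refine ⟨hj, (hk.putWM (by simp)).putW (by simp), by simp, fun e he => ?_⟩
    simp only [putW_wmem, putWM_wmem, if_true, Function.update_apply]
    split_ifs with he'
    · exact he'.symm
    · exact hm e (by omega)
  · rintro s - ⟨-, hk, -, hm⟩
    exact ⟨hk, hm⟩
  · simp [Test.cost, WExp.cost]
    omega

/-- Copy every other element of the sequence at `wreg 70` to position `wreg 71`. -/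
def thinCopy : Prog :=
  .loop (.wlt (.reg 50) (.reg 51))
    (.seq (.storeW 7 (.add (.reg 71) (.reg 50))
      (.load 7 (.add (.reg 70) (.mul (.const 2) (.reg 50)))))
      (.setW 50 (.add (.reg 50) (.const 1))))

theorem thinCopy_spec {W M src dst : ℕ} {s₀ : State} (hwf : WF W s₀) (h50 : s₀.wreg 50 = 0)
    (h51 : s₀.wreg 51 = M) (h70 : s₀.wreg 70 = src) (h71 : s₀.wreg 71 = dst)
    (hd : src + 2 * M ≤ dst + 1) (hW : dst + M + 2 ≤ W) :
    Ht W thinCopy s₀ (30 * M + 10) fun s => Keeps 50 100 [7] [] s₀ s ∧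
      (∀ i, i ≠ 50 → s.wreg i = s₀.wreg i) ∧
      ∀ e < M, s.wmem 7 (dst + e) = s₀.wmem 7 (src + 2 * e) := by
  refine Ht.loop_count (fun j s => Keeps 50 100 [7] [] s₀ s ∧
    (∀ i, i ≠ 50 → s.wreg i = s₀.wreg i) ∧ s.wreg 50 = j ∧ (∀ x < dst, s.wmem 7 x = s₀.wmem 7 x) ∧
    ∀ e < j, s.wmem 7 (dst + e) = s₀.wmem 7 (src + 2 * e)) M (fun _ => 20) hwf
    ⟨Keeps.rfl, fun _ _ => rfl, h50, fun _ _ => rfl, by simp⟩ ?_ ?_ ?_ ?_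
  · rintro j s - ⟨-, hk, hj, -⟩
    simp [Test.ok, Test.val, WExp.ok, WExp.val, hj, hk 51, h51]
  · rintro j s hj hs ⟨hk, hr, h50, hl, hm⟩
    refine Ht.of_wp hs ?_ (by simp [Prog.cost, WExp.cost])
    have e70 : s.wreg 70 = src := by rw [hr 70 (by norm_num), h70]
    have e71 : s.wreg 71 = dst := by rw [hr 71 (by norm_num), h71]
    simp only [Prog.wp, WExp.ok, WExp.val, h50, putWM_wreg, true_and, e70, e71]
    refine ⟨by omega, ⟨⟨by omega, by omega⟩, by omega⟩, ⟨by omega, by omega⟩,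
      (hk.putWM (by simp)).putW (by simp), fun i hi => by simp [hi, hr i hi], by simp,
      fun x hx => ?_, fun e he => ?_⟩
    · simp only [putW_wmem, putWM_wmem, if_true]
      rw [Function.update_of_ne (by omega), hl x hx]
    · simp only [putW_wmem, putWM_wmem, if_true, Function.update_apply]
      split_ifs with he'
      · obtain rfl : e = j := by omega
        exact hl _ (by omega)
      · exact hm e (by omega)
  · rintro s - ⟨hk, hr, -, -, hm⟩
    exact ⟨hk, hr, hm⟩
  · simp [Test.cost, WExp.cost]
    omega

/-- Two merge passes, after which every other element is dropped. -/
def thinRound : Prog :=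
  .seq (mergePass 7 11) (.seq
    (.seq (.setW 70 (.reg 71)) (.seq (.setW 71 (.add (.reg 71) (.reg 73)))
      (.setW 72 (.mul (.reg 72) (.const 2)))))
    (.seq (mergePass 7 11) (.seq
      (.seq (.setW 70 (.reg 71)) (.seq (.setW 71 (.add (.reg 71) (.reg 73)))
        (.seq (.setW 50 (.const 0)) (.setW 51 (.div (.add (.reg 73) (.const 1)) (.const 2))))))
      (.seq thinCopy
        (.seq (.setW 70 (.reg 71)) (.seq (.setW 73 (.reg 51))
          (.setW 71 (.add (.reg 71) (.reg 51)))))))))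

/-- The state of the thinning loop. -/
structure ThinState (s₀ : State) (m L t src : ℕ) (s : State) : Prop where
  keeps : Keeps 50 90 [7] [] s₀ s
  r70 : s.wreg 70 = src
  r71 : s.wreg 71 = src + L
  r72 : s.wreg 72 = 32 * 2 ^ t
  r73 : s.wreg 73 = L
  space : src + 7 * L ≤ 12 * m
  sample : Sample (s₀.rmem 11) m (32 * 2 ^ t) L t (fun e => s.wmem 7 (src + e))

/-- `ThinState.space` bounds the memory used: a round moves the start of the sequence by `3 * L` and
halves `L`, and `3 * L + 7 * ((L + 1) / 2) ≤ 7 * L` because `L > 32`. -/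
theorem thinRound_spec {W m L t src : ℕ} {s₀ s : State} (hwf : WF W s) (hW : 20 * m + 100 ≤ W)
    (h : ThinState s₀ m L t src s) (hL : 32 * 2 ^ t < L) :
    Ht W thinRound s (170 * L + 150)
      (ThinState s₀ m ((L + 1) / 2) (t + 1) (src + L + L + L)) := by
  have hsp := h.space
  have hκ : s.rmem 11 = s₀.rmem 11 := h.keeps.rmem 11 (by simp)
  have ht : 1 ≤ 2 ^ t := Nat.one_le_two_pow
  refine (mergePass_spec (K := 11) hwf (by omega) h.r70 h.r71 h.r72 h.r73 le_rfl (by omega)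
    (by rw [hκ]; exact h.sample.sorted)).seq (c' := 100 * L + 130) ?_ (by omega)
  rintro s1 hwf1 ⟨hk1, -, hp1, hs1⟩
  refine Ht.seq_wp (c' := 100 * L + 120) (Q := fun s2 => Keeps 70 100 [] [] s1 s2 ∧
    s2.wreg 70 = src + L ∧ s2.wreg 71 = src + L + L ∧ s2.wreg 72 = 32 * 2 ^ t * 2 ∧
    s2.wreg 73 = L ∧ s2.wmem = s1.wmem) hwf1 ?_ ?_ (by simp [Prog.cost, WExp.cost]; omega)
  · have e71 := hk1.wreg 71 (by norm_num)
    have e72 := hk1.wreg 72 (by norm_num)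
    have e73 := hk1.wreg 73 (by norm_num)
    rw [h.r71] at e71
    rw [h.r72] at e72
    rw [h.r73] at e73
    simp only [Prog.wp, WExp.ok, WExp.val, putW_wreg, Nat.reduceEqDiff, if_false, true_and, e71,
      e72, e73]
    exact ⟨by omega, by omega, ((Keeps.rfl.putW (by simp)).putW (by simp)).putW (by simp),
      by simp [e73]⟩
  rintro s2 hwf2 ⟨hk2, e70, e71, e72, e73, hm2⟩
  have hκ2 : s2.rmem 11 = s₀.rmem 11 := by
    rw [hk2.rmem 11 (by simp), hk1.rmem 11 (by simp), hκ]
  refine (mergePass_spec (K := 11) hwf2 (by omega) e70 e71 e72 e73 le_rfl (by omega)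
    (by rw [hκ2, hm2, ← hκ]; exact hs1)).seq (c' := 30 * L + 95) ?_ (by omega)
  rintro s3 hwf3 ⟨hk3, -, hp3, hs3⟩
  refine Ht.seq_wp (c' := 30 * L + 75) (Q := fun s4 => Keeps 50 100 [] [] s3 s4 ∧
    s4.wreg 70 = src + L + L ∧ s4.wreg 71 = src + L + L + L ∧ s4.wreg 72 = 32 * 2 ^ t * 2 ∧
    s4.wreg 50 = 0 ∧ s4.wreg 51 = (L + 1) / 2 ∧ s4.wmem = s3.wmem) hwf3 ?_ ?_
    (by simp [Prog.cost, WExp.cost]; omega)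
  · have e71' := hk3.wreg 71 (by norm_num)
    have e72' := hk3.wreg 72 (by norm_num)
    have e73' := hk3.wreg 73 (by norm_num)
    rw [e71] at e71'
    rw [e72] at e72'
    rw [e73] at e73'
    simp only [Prog.wp, WExp.ok, WExp.val, putW_wreg, Nat.reduceEqDiff, if_false, true_and, e71',
      e72', e73']
    exact ⟨by omega, by omega, ⟨⟨by omega, by omega⟩, by omega⟩,
      (((Keeps.rfl.putW (by simp)).putW (by simp)).putW (by simp)).putW (by simp),
      by simp [e72', e73']⟩
  rintro s4 hwf4 ⟨hk4, f70, f71, f72, f50, f51, hm4⟩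
  refine (thinCopy_spec hwf4 f50 f51 f70 f71 (by omega) (by omega)).seq (c' := 15) ?_ (by omega)
  rintro s5 hwf5 ⟨hk5, hr5, hm5⟩
  refine Ht.of_wp hwf5 ?_ (by simp [Prog.cost, WExp.cost])
  simp only [Prog.wp, WExp.ok, WExp.val, putW_wreg, Nat.reduceEqDiff, if_false, true_and,
    hr5 71 (by norm_num), hr5 51 (by norm_num), f71, f51]
  refine ⟨by omega, ?_, by simp, by simp, ?_, by simp, by omega, ?_⟩
  · refine (((Keeps.trans ?_ (hk5.mono le_rfl (by norm_num) (by simp) (by simp))).putW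
      (by simp)).putW (by simp)).putW (by simp)
    exact (((h.keeps.trans (hk1.mono (by norm_num) (by norm_num) (by simp) (by simp))).trans
      (hk2.mono (by norm_num) (by norm_num) (by simp) (by simp))).trans
      (hk3.mono (by norm_num) (by norm_num) (by simp) (by simp))).trans
      (hk4.mono (by norm_num) (by norm_num) (by simp) (by simp))
  · simp only [putW_wreg, Nat.reduceEqDiff, if_false, hr5 72 (by norm_num), f72]
    ring
  · have := h.sample.thin hL (τ := fun e => s3.wmem 7 (src + L + L + e))
      (τ' := fun e => s5.wmem 7 (src + L + L + L + e)) ?_ ?_ ?_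
    · rw [pow_succ, ← mul_assoc]
      exact this
    · rw [hm2] at hp3
      exact hp1.double.trans hp3
    · rw [← hκ2]
      exact hs3
    · intro e he
      rw [hm5 e he, hm4]

/-- Move the elements of the array `11` that pass the test to the front, and set `wreg 40` to
their number. -/
def keepIf (b : Test) : Prog :=
  .seq (.seq (.setW 52 (.const 0)) (.setW 53 (.const 0)))
    (.seq (.loop (.wlt (.reg 52) (.reg 40))
      (.seq (.cond b (.seq (.storeR 11 (.reg 53) (.load 11 (.reg 52)))
          (.setW 53 (.add (.reg 53) (.const 1)))) .skip)
        (.setW 52 (.add (.reg 52) (.const 1)))))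
      (.setW 40 (.reg 53)))

/-- The compaction works in place because the write position never passes the read position.
Counting with an arbitrary `r` describes the surviving values as a multiset. -/
theorem keepIf_spec {W m : ℕ} {s₀ : State} {b : Test} {p : ℝ → Prop} (hwf : WF W s₀)
    (h40 : s₀.wreg 40 = m) (hW : m + 1 ≤ W) (hb : ∀ s, b.ok W s) (hbc : b.cost ≤ 5)
    (hbv : ∀ s, s.rreg 91 = s₀.rreg 91 → (b.val s ↔ p (s.rmem 11 (s.wreg 52)))) :
    Ht W (keepIf b) s₀ (40 * m + 40) fun s => Keeps 40 100 [] [11] s₀ s ∧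
      s.wreg 41 = s₀.wreg 41 ∧ s.wreg 40 = cnt p (s₀.rmem 11) m ∧
      ∀ r : ℝ → Prop, cnt r (s.rmem 11) (s.wreg 40) = cnt (fun x => p x ∧ r x) (s₀.rmem 11) m := by
  refine Ht.seq_wp (c' := 40 * m + 20) (Q := fun s => Keeps 50 100 [] [11] s₀ s ∧ s.wreg 52 = 0 ∧
    s.wreg 53 = 0 ∧ s.rmem = s₀.rmem) hwf ?_ (fun s hs h => ?_)
    (by simp [Prog.cost, WExp.cost]; omega)
  · simp [Prog.wp, WExp.ok, WExp.val]
    exact (Keeps.rfl.putW (by simp)).putW (by simp)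
  refine Ht.seq (c := 40 * m + 15) (c' := 5) (Q := fun s => Keeps 50 100 [] [11] s₀ s ∧
    s.wreg 53 = cnt p (s₀.rmem 11) m ∧ ∀ r : ℝ → Prop, cnt r (s.rmem 11) (s.wreg 53) =
      cnt (fun x => p x ∧ r x) (s₀.rmem 11) m) ?_ ?_ (by omega)
  · refine Ht.loop_count (fun j s => Keeps 50 100 [] [11] s₀ s ∧ s.wreg 52 = j ∧
      s.wreg 53 = cnt p (s₀.rmem 11) j ∧ (∀ x, j ≤ x → s.rmem 11 x = s₀.rmem 11 x) ∧
      ∀ r : ℝ → Prop, cnt r (s.rmem 11) (s.wreg 53) = cnt (fun x => p x ∧ r x) (s₀.rmem 11) j) m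
      (fun _ => 25) hs ⟨h.1, h.2.1, h.2.2.1, fun _ _ => by rw [h.2.2.2], ?_⟩ ?_ ?_ ?_ ?_
    · intro r
      rw [h.2.2.1, cnt_zero, cnt_zero]
    · rintro j s - ⟨hk, hj, -⟩
      simp [Test.ok, Test.val, WExp.ok, WExp.val, hj, hk.wreg 40, h40]
    · rintro j s hj hs ⟨hk, h52, h53, hx, hr⟩
      refine Ht.of_wp hs ?_ (by simp [Prog.cost, WExp.cost, RExp.cost]; omega)
      have hbv' := hbv s (hk.rreg 91 (by norm_num))
      rw [h52, hx j le_rfl] at hbv'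
      have hle : cnt p (s₀.rmem 11) j ≤ j := cnt_le
      simp only [Prog.wp, hbv', WExp.ok, WExp.val, RExp.ok, RExp.val, h52, h53, putW_wreg,
        putRM_wreg, true_and, Nat.reduceEqDiff, if_false]
      refine ⟨hb s, fun hp => ⟨⟨by omega, by omega⟩, ⟨by omega, by omega⟩, ?_, by simp,
        by simp [cnt_succ_pos hp], fun x hjx => ?_, fun r => ?_⟩, fun hp => ⟨⟨by omega, by omega⟩,
        ?_, by simp, by simp [cnt_succ_neg hp, h53], fun x hjx => hx x (by omega), fun r => ?_⟩⟩
      · exact ((hk.putRM (by simp)).putW (by simp)).putW (by simp)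
      · simp only [putW_rmem, putRM_rmem, if_true]
        rw [Function.update_of_ne (by omega), hx x (by omega)]
      · have e1 : cnt r (Function.update (s.rmem 11) (cnt p (s₀.rmem 11) j) (s.rmem 11 j))
            (cnt p (s₀.rmem 11) j) = cnt (fun x => p x ∧ r x) (s₀.rmem 11) j := by
          rw [← hr r, h53]
          exact cnt_congr fun e he => by rw [Function.update_of_ne (by omega)]
        simp only [putW_rmem, putRM_rmem, if_true, putW_wreg, Nat.reduceEqDiff, if_false]
        by_cases hrj : r (s₀.rmem 11 j)
        · rw [cnt_succ_pos (by rwa [Function.update_self, hx j le_rfl]), e1,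
            cnt_succ_pos ⟨hp, hrj⟩]
        · rw [cnt_succ_neg (by rwa [Function.update_self, hx j le_rfl]), e1,
            cnt_succ_neg fun h => hrj h.2]
      · exact hk.putW (by simp)
      · rw [cnt_succ_neg (fun h => hp h.1), ← h53]
        exact hr r
    · rintro s - ⟨hk, -, h53, -, hr⟩
      exact ⟨hk, h53, hr⟩
    · simp [Test.cost, WExp.cost]
      omega
  · rintro s hs ⟨hk, h53, hr⟩
    refine Ht.of_wp hs ?_ (by simp [Prog.cost, WExp.cost])
    simp only [Prog.wp, WExp.ok, WExp.val, true_and]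
    exact ⟨(hk.mono (by norm_num) le_rfl (by simp) (by simp)).putW (by simp),
      by simp [hk.wreg 41], by simp [h53], by simpa using hr⟩

/-- Count the elements of the array `11` that are greater than, respectively at least, `rreg 91`. -/
def countAround : Prog :=
  .seq (.seq (.setW 52 (.const 0)) (.seq (.setW 54 (.const 0)) (.setW 55 (.const 0))))
    (.loop (.wlt (.reg 52) (.reg 40))
      (.seq (.cond (.rlt (.reg 91) (.load 11 (.reg 52))) (.setW 54 (.add (.reg 54) (.const 1))) .skip)
        (.seq (.cond (.rlt (.load 11 (.reg 52)) (.reg 91)) .skip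
          (.setW 55 (.add (.reg 55) (.const 1))))
          (.setW 52 (.add (.reg 52) (.const 1))))))

theorem countAround_spec {W m : ℕ} {z : ℝ} {s₀ : State} (hwf : WF W s₀) (h40 : s₀.wreg 40 = m)
    (h91 : s₀.rreg 91 = z) (hW : m + 1 ≤ W) :
    Ht W countAround s₀ (40 * m + 20) fun s => Keeps 50 100 [] [] s₀ s ∧
      s.wreg 54 = cnt (fun x => z < x) (s₀.rmem 11) m ∧
      s.wreg 55 = cnt (fun x => z ≤ x) (s₀.rmem 11) m := by
  refine Ht.seq_wp (c' := 40 * m + 10) (Q := fun s => Keeps 50 100 [] [] s₀ s ∧ s.wreg 52 = 0 ∧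
    s.wreg 54 = 0 ∧ s.wreg 55 = 0) hwf ?_ (fun s hs h => ?_)
    (by simp [Prog.cost, WExp.cost]; omega)
  · simp [Prog.wp, WExp.ok, WExp.val]
    exact ((Keeps.rfl.putW (by simp)).putW (by simp)).putW (by simp)
  refine Ht.loop_count (fun j s => Keeps 50 100 [] [] s₀ s ∧ s.wreg 52 = j ∧
    s.wreg 54 = cnt (fun x => z < x) (s₀.rmem 11) j ∧
    s.wreg 55 = cnt (fun x => z ≤ x) (s₀.rmem 11) j) m (fun _ => 30) hs h ?_ ?_ ?_ ?_
  · rintro j s - ⟨hk, hj, -⟩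
    simp [Test.ok, Test.val, WExp.ok, WExp.val, hj, hk.wreg 40, h40]
  · rintro j s hj hs ⟨hk, h52, h54, h55⟩
    refine Ht.of_wp hs ?_ (by simp [Prog.cost, WExp.cost, RExp.cost, Test.cost])
    have e91 : s.rreg 91 = z := by rw [hk.rreg 91 (by norm_num), h91]
    have hle : cnt (fun x => z < x) (s₀.rmem 11) j ≤ j := cnt_le
    have hle' : cnt (fun x => z ≤ x) (s₀.rmem 11) j ≤ j := cnt_le
    have hX : s.rmem 11 = s₀.rmem 11 := hk.rmem 11 (by simp)
    have b1 : 1 ≤ W := by omega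
    have b2 : j + 1 ≤ W := by omega
    have b3 : cnt (fun x => z < x) (s₀.rmem 11) j + 1 ≤ W := by omega
    have b4 : cnt (fun x => z ≤ x) (s₀.rmem 11) j + 1 ≤ W := by omega
    simp only [Prog.wp, Test.ok, Test.val, WExp.ok, WExp.val, RExp.ok, RExp.val, h52, h54, h55,
      putW_wreg, putW_rreg, putW_rmem, hX, e91, true_and, Nat.reduceEqDiff, if_false, b1, b2, b3,
      b4]
    refine ⟨fun hp => ⟨fun hq => absurd hp hq.not_gt, fun hq => ⟨?_, ?_, ?_, ?_⟩⟩,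
      fun hp => ⟨fun hq => ⟨?_, ?_, ?_, ?_⟩, fun hq => ⟨?_, ?_, ?_, ?_⟩⟩⟩
    · exact ((hk.putW (by simp)).putW (by simp)).putW (by simp)
    · simp
    · simp [cnt_succ_pos hp]
    · simp [cnt_succ_pos (p := fun x => z ≤ x) hp.le]
    · exact hk.putW (by simp)
    · simp
    · simp [cnt_succ_neg hp, h54]
    · simp [cnt_succ_neg (p := fun x => z ≤ x) hq.not_ge, h55]
    · exact (hk.putW (by simp)).putW (by simp)
    · simp
    · simp [cnt_succ_neg hp, h54]
    · simp [cnt_succ_pos (p := fun x => z ≤ x) (not_lt.1 hq)]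
  · rintro s - ⟨hk, -, h⟩
    exact ⟨hk, h⟩
  · simp [Test.cost, WExp.cost]
    omega


/-- Sample the values until the sample is sorted; put its median into `rreg 91`. -/
def findSplitter : Prog :=
  .seq fillIndices (.seq (.seq (.setW 70 (.const 0)) (.seq (.setW 71 (.reg 40))
      (.seq (.setW 72 (.const 1)) (.seq (.setW 73 (.reg 40)) (.setW 60 (.const 32))))))
    (.seq (passes 7 11) (.seq (.loop (.wlt (.reg 72) (.reg 73)) thinRound)
      (.setR 91 (.load 11 (.load 7 (.add (.reg 70) (.div (.reg 73) (.const 2)))))))))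

theorem BlockPerm.congr_left {w m : ℕ} {σ σ' τ : ℕ → ℕ} (h : BlockPerm w m σ τ)
    (hσ : ∀ e < m, σ e = σ' e) : BlockPerm w m σ' τ := fun φ => by
  rw [h φ]
  exact Finset.sum_congr rfl fun e he => by rw [hσ e (Finset.mem_range.1 he)]

theorem findSplitter_spec {W m : ℕ} {s₀ : State} (hwf : WF W s₀) (h40 : s₀.wreg 40 = m)
    (hm : 0 < m) (hW : 20 * m + 100 ≤ W) :
    Ht W findSplitter s₀ (900 * m + 400) fun s => Keeps 50 90 [7] [] s₀ s ∧
      16 * cnt (fun x => s.rreg 91 < x) (s₀.rmem 11) m ≤ 11 * m ∧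
      16 * cnt (fun x => x < s.rreg 91) (s₀.rmem 11) m ≤ 11 * m := by
  refine (fillIndices_spec hwf h40 (by omega)).seq (c' := 880 * m + 380) ?_ (by omega)
  rintro s1 hwf1 ⟨hk1, hm1⟩
  refine Ht.seq_wp (c' := 880 * m + 360) (Q := fun s2 => Keeps 50 100 [] [] s1 s2 ∧
    s2.wreg 70 = 0 ∧ s2.wreg 71 = 0 + m ∧ s2.wreg 72 = 1 ∧ s2.wreg 73 = m ∧ s2.wreg 60 = 32 ∧
    s2.wmem = s1.wmem) hwf1 ?_ ?_ (by simp [Prog.cost, WExp.cost]; omega)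
  · have b1 : 1 ≤ W := by omega
    have b2 : 32 ≤ W := by omega
    simp only [Prog.wp, WExp.ok, WExp.val, putW_wreg, Nat.reduceEqDiff, if_false, true_and,
      zero_le, hk1.wreg 40 (by norm_num), h40, b1, b2]
    exact ⟨((((Keeps.rfl.putW (by simp)).putW (by simp)).putW (by simp)).putW (by simp)).putW
      (by simp), by simp⟩
  rintro s2 hwf2 ⟨hk2, e70, e71, e72, e73, e60, hm2⟩
  have hclog : Nat.clog 2 32 = 5 := Nat.clog_pow 2 5 one_lt_two
  refine (passes_spec (a := 7) (K := 11) hwf2 e60 e70 e71 e72 e73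
    (by rw [hclog]; omega)).seq (c' := 520 * m + 50) ?_ (by rw [hclog]; omega)
  intro s3 hwf3 h3
  rw [hclog] at h3
  have hκ : s2.rmem 11 = s₀.rmem 11 := by rw [hk2.rmem 11 (by simp), hk1.rmem 11 (by simp)]
  have hT : ThinState s₀ m m 0 (0 + 5 * m) s3 := by
    refine ⟨?_, h3.r70, by rw [h3.r71]; ring, by rw [h3.r72]; norm_num, h3.r73, by omega, ?_⟩
    · exact ((hk1.mono (by norm_num) (by norm_num) (by simp) (by simp)).trans
        (hk2.mono (by norm_num) (by norm_num) (by simp) (by simp))).trans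
        (h3.keeps.mono (by norm_num) (by norm_num) (by simp) (by simp))
    · obtain ⟨hp, hs⟩ := h3.level 5 le_rfl
      rw [hκ] at hs
      exact Sample.init hs (hp.congr_left fun e he => by rw [hm2, zero_add, hm1 e he])
  refine Ht.seq (c := 500 * m + 5) (c' := 20) (Q := fun s => ∃ L t src, L ≤ 32 * 2 ^ t ∧
    ThinState s₀ m L t src s) ?_ ?_ (by omega)
  -- A round costs about `170 * L` and halves `L`, so a potential of `500 * L` pays for all rounds.
  · refine Ht.loop (fun s => ∃ L t src, ThinState s₀ m L t src s) (fun s => 500 * s.wreg 73) hwf3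
      ⟨_, _, _, hT⟩ ?_ ?_ ?_ ?_
    · rintro s - ⟨L, t, src, h⟩
      simp [Test.ok, WExp.ok]
    · rintro s hwfs ⟨L, t, src, h⟩ hb
      simp only [Test.val, WExp.val, h.r72, h.r73] at hb
      refine ⟨_, (thinRound_spec hwfs hW h hb).mono le_rfl fun s' _ h' => ⟨⟨_, _, _, h'⟩, ?_⟩⟩
      have : 1 ≤ 2 ^ t := Nat.one_le_two_pow
      simp only [h.r73, h'.r73, Test.cost, WExp.cost]
      omega
    · rintro s - ⟨L, t, src, h⟩ hb
      simp only [Test.val, WExp.val, h.r72, h.r73] at hb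
      exact ⟨L, t, src, by omega, h⟩
    · simp only [h3.r73, Test.cost, WExp.cost]
      omega
  · rintro s hwfs ⟨L, t, src, hL, h⟩
    refine Ht.of_wp hwfs ?_ (by simp [Prog.cost, WExp.cost, RExp.cost])
    obtain ⟨-, h1, h2⟩ := h.sample.median hL hm
    have := h.space
    simp only [Prog.wp, WExp.ok, WExp.val, RExp.ok, RExp.val, h.r70, h.r73, true_and]
    refine ⟨⟨by omega, by omega⟩, h.keeps.putR (by simp), ?_⟩
    simp only [putR_rreg, if_true, h.keeps.rmem 11 (by simp)]
    exact ⟨h1, h2⟩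

/-- Reduce the selection problem to the values on one side of the splitter. -/
def selectRound : Prog :=
  .seq findSplitter (.seq countAround (.cond (.wlt (.reg 54) (.reg 41))
    (.cond (.wlt (.reg 55) (.reg 41))
      (.seq (.setW 41 (.sub (.reg 41) (.reg 55))) (keepIf (.rlt (.load 11 (.reg 52)) (.reg 91))))
      (.seq (.setR 90 (.reg 91)) (.setW 40 (.const 0))))
    (keepIf (.rlt (.reg 91) (.load 11 (.reg 52))))))

/-- Put the `wreg 41`-th largest of the first `wreg 40` elements of the real array `11` into
`rreg 90`. -/
def select : Prog := .loop (.wlt (.const 0) (.reg 40)) selectRound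

/-- Either the splitter itself has rank `q`, and the loop is ended by setting `wreg 40` to `0`, or
one side of it remains, with at most `11/16` of the values and the rank adjusted. -/
theorem selectRound_spec {W m q : ℕ} {s₀ : State} (hwf : WF W s₀) (h40 : s₀.wreg 40 = m)
    (h41 : s₀.wreg 41 = q) (hq : 1 ≤ q) (hqm : q ≤ m) (hW : 20 * m + 100 ≤ W) :
    Ht W selectRound s₀ (980 * m + 500) fun s => Keeps 40 90 [7] [11] s₀ s ∧
      16 * s.wreg 40 ≤ 11 * m ∧
      (s.wreg 40 = 0 ∧ IsKth (s₀.rmem 11) m q (s.rreg 90) ∨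
        1 ≤ s.wreg 41 ∧ s.wreg 41 ≤ s.wreg 40 ∧
        ∀ v, IsKth (s.rmem 11) (s.wreg 40) (s.wreg 41) v → IsKth (s₀.rmem 11) m q v) := by
  refine (findSplitter_spec hwf h40 (by omega) hW).seq (c' := 80 * m + 100) ?_ (by omega)
  rintro s1 hwf1 ⟨hk1, hgt, hlt⟩
  have e40 : s1.wreg 40 = m := by rw [hk1.wreg 40 (by norm_num), h40]
  have hX : s1.rmem 11 = s₀.rmem 11 := hk1.rmem 11 (by simp)
  refine (countAround_spec hwf1 e40 rfl (by omega)).seq (c' := 40 * m + 80) ?_ (by omega)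
  rintro s2 hwf2 ⟨hk2, e54, e55⟩
  have e40' : s2.wreg 40 = m := by rw [hk2.wreg 40 (by norm_num), e40]
  have e41 : s2.wreg 41 = q := by
    rw [hk2.wreg 41 (by norm_num), hk1.wreg 41 (by norm_num), h41]
  have e91 : s2.rreg 91 = s1.rreg 91 := hk2.rreg 91 (by norm_num)
  have hX2 : s2.rmem 11 = s₀.rmem 11 := by rw [hk2.rmem 11 (by simp), hX]
  rw [hX] at e54 e55
  have hk : Keeps 40 90 [7] [11] s₀ s2 :=
    (hk1.mono (by norm_num) (by norm_num) (by simp) (by simp)).trans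
      (hk2.mono (by norm_num) (by norm_num) (by simp) (by simp))
  refine Ht.cond (c := 40 * m + 70) hwf2 (by simp [Test.ok, WExp.ok]) (fun h1 => ?_) (fun h1 => ?_)
    (by simp [Test.cost, WExp.cost]; omega)
  · simp only [Test.val, WExp.val, e54, e41] at h1
    refine Ht.cond (c := 40 * m + 60) hwf2 (by simp [Test.ok, WExp.ok]) (fun h2 => ?_) (fun h2 => ?_)
      (by simp [Test.cost, WExp.cost]; omega)
    · simp only [Test.val, WExp.val, e55, e41] at h2
      refine Ht.seq_wp (c' := 40 * m + 40) (Q := fun s => s = s2.putW 41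
        (q - cnt (fun x => s1.rreg 91 ≤ x) (s₀.rmem 11) m)) hwf2
        (by simp [Prog.wp, WExp.ok, WExp.val, e41, e55]) ?_
        (by simp [Prog.cost, WExp.cost]; omega)
      rintro s hwfs rfl
      refine (keepIf_spec (p := fun x => x < s1.rreg 91) hwfs (by simpa using e40') (by omega)
        (by simp [Test.ok, RExp.ok, WExp.ok]) (by simp [Test.cost, RExp.cost, WExp.cost])
        (by intro s hs; simp [Test.val, RExp.val, WExp.val, hs, e91])).mono le_rfl ?_
      rintro s - ⟨hk3, f41, f40, hr⟩
      simp only [putW_rmem, hX2, putW_wreg, if_true] at hr f41 f40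
      have hc : cnt (fun x => s1.rreg 91 ≤ x) (s₀.rmem 11) m +
          cnt (fun x => x < s1.rreg 91) (s₀.rmem 11) m = m := by
        simpa only [not_le] using cnt_add_not (p := fun x => s1.rreg 91 ≤ x) (f := s₀.rmem 11)
      refine ⟨?_, by rw [f40]; exact hlt, Or.inr ⟨by omega, by omega, fun v hv => ?_⟩⟩
      · exact (hk.trans (Keeps.rfl.putW (i := 41) (by simp))).trans
          (hk3.mono (by norm_num) (by norm_num) (by simp) (by simp))
      · rw [f41] at hv
        exact IsKth.of_lt hr h2 hv
    · simp only [Test.val, WExp.val, e55, e41] at h2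
      refine Ht.of_wp hwf2 ?_ (by simp [Prog.cost, WExp.cost, RExp.cost])
      simp only [Prog.wp, WExp.ok, WExp.val, RExp.ok, RExp.val, true_and, zero_le]
      refine ⟨(hk.putR (by simp)).putW (by simp), by simp, Or.inl ⟨by simp, ?_, ?_⟩⟩
      · simpa [e91] using h1
      · simpa [e91] using h2
  · simp only [Test.val, WExp.val, e54, e41] at h1
    refine (keepIf_spec (p := fun x => s1.rreg 91 < x) hwf2 e40' (by omega)
      (by simp [Test.ok, RExp.ok, WExp.ok]) (by simp [Test.cost, RExp.cost, WExp.cost])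
      (by intro s hs; simp [Test.val, RExp.val, WExp.val, hs, e91])).mono (by omega) ?_
    rintro s - ⟨hk3, f41, f40, hr⟩
    simp only [hX2] at hr f40
    rw [f41, e41]
    refine ⟨hk.trans (hk3.mono (by norm_num) (by norm_num) (by simp) (by simp)),
      by rw [f40]; exact hgt, Or.inr ⟨hq, by omega, fun v hv => IsKth.of_gt hr (by omega) hv⟩⟩

theorem select_spec {W m q : ℕ} {s₀ : State} (hwf : WF W s₀) (h40 : s₀.wreg 40 = m)
    (h41 : s₀.wreg 41 = q) (hq : 1 ≤ q) (hqm : q ≤ m) (hW : 20 * m + 100 ≤ W) :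
    Ht W select s₀ (6000 * m + 10) fun s => Keeps 40 90 [7] [11] s₀ s ∧
      IsKth (s₀.rmem 11) m q (s.rreg 90) := by
  -- A round on `m` values costs `980 * m + 500` and leaves at most `11/16` of them; the released
  -- potential `6000 * (5 / 16) * m = 1875 * m` covers this for `m ≥ 1`.
  refine Ht.loop (fun s => Keeps 40 90 [7] [11] s₀ s ∧ s.wreg 40 ≤ m ∧
    (s.wreg 40 = 0 ∧ IsKth (s₀.rmem 11) m q (s.rreg 90) ∨ 1 ≤ s.wreg 41 ∧ s.wreg 41 ≤ s.wreg 40 ∧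
      ∀ v, IsKth (s.rmem 11) (s.wreg 40) (s.wreg 41) v → IsKth (s₀.rmem 11) m q v))
    (fun s => 6000 * s.wreg 40) hwf ⟨Keeps.rfl, h40.le, Or.inr ?_⟩ ?_ ?_ ?_ ?_
  · rw [h40, h41]
    exact ⟨hq, hqm, fun v hv => hv⟩
  · intro s _ _
    simp [Test.ok, WExp.ok]
  · rintro s hwfs ⟨hk, hle, h⟩ hb
    simp only [Test.val, WExp.val] at hb
    obtain ⟨h1, h2, h3⟩ := h.resolve_left fun h => by omega
    refine ⟨_, (selectRound_spec hwfs rfl rfl h1 h2 (by omega)).mono le_rfl ?_⟩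
    rintro s' - ⟨hk', hle', h'⟩
    refine ⟨⟨hk.trans hk', by omega, ?_⟩, by simp only [Test.cost, WExp.cost]; omega⟩
    rcases h' with ⟨h4, h5⟩ | ⟨h4, h5, h6⟩
    · exact Or.inl ⟨h4, h3 _ h5⟩
    · exact Or.inr ⟨h4, h5, fun v hv => h3 v (h6 v hv)⟩
  · rintro s - ⟨hk, hle, h⟩ hb
    simp only [Test.val, WExp.val] at hb
    exact ⟨hk, (h.resolve_right fun h => by omega).2⟩
  · simp only [h40, Test.cost, WExp.cost]
    omega


/-! ### Families of sorted sum matrices and their coarsenings -/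

/-- A family of matrices `U v i + R v j` whose rows and columns are sorted in descending order. -/
structure Rects where
  /-- the number of matrices -/
  V : ℕ
  /-- the number of rows -/
  A : ℕ → ℕ
  /-- the number of columns -/
  B : ℕ → ℕ
  /-- the row summands -/
  U : ℕ → ℕ → ℝ
  /-- the column summands -/
  R : ℕ → ℕ → ℝ
  anti_U : ∀ v < V, ∀ i i', i ≤ i' → i' < A v → U v i' ≤ U v i
  -- Nothing is required of a matrix without rows: the block of a tree node that no window uses may
  -- reach past the end of the stored data.
  anti_R : ∀ v < V, 0 < A v → ∀ j j', j ≤ j' → j' < B v → R v j' ≤ R v j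

/-- Division rounded up. -/
def cdiv (x s : ℕ) : ℕ := (x + s - 1) / s

theorem cdiv_le_iff {x s y : ℕ} (hs : 0 < s) : cdiv x s ≤ y ↔ x ≤ s * y := by
  rw [cdiv, ← Nat.lt_succ_iff, Nat.div_lt_iff_lt_mul hs, Nat.succ_mul, mul_comm]
  omega

theorem lt_cdiv_iff {x s y : ℕ} (hs : 0 < s) : y < cdiv x s ↔ s * y < x := by
  rw [← not_le, cdiv_le_iff hs, not_le]

theorem le_mul_cdiv {x s : ℕ} (hs : 0 < s) : x ≤ s * cdiv x s := (cdiv_le_iff hs).1 le_rfl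

theorem cdiv_one (x : ℕ) : cdiv x 1 = x := by simp [cdiv]

theorem cdiv_anti {x s t : ℕ} (hs : 0 < s) (hst : s ≤ t) : cdiv x t ≤ cdiv x s :=
  (cdiv_le_iff (hs.trans_le hst)).2 ((le_mul_cdiv hs).trans (Nat.mul_le_mul_right _ hst))

/-- Each block of `s` consecutive terms is at most `s` times its first term. -/
theorem sum_le_sum_lattice {f : ℕ → ℕ} (hf : Antitone f) {s : ℕ} (hs : 0 < s) (A : ℕ) :
    ∑ x ∈ Finset.range A, f x ≤ s * ∑ i ∈ Finset.range (cdiv A s), f (s * i) := by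
  have key : ∀ M, ∑ x ∈ Finset.range (s * M), f x ≤ s * ∑ i ∈ Finset.range M, f (s * i) := by
    intro M
    induction M with
    | zero => simp
    | succ M ih =>
      rw [Nat.mul_succ, Finset.sum_range_add, Finset.sum_range_succ, mul_add]
      refine add_le_add ih ?_
      calc ∑ x ∈ Finset.range s, f (s * M + x) ≤ ∑ _x ∈ Finset.range s, f (s * M) :=
            Finset.sum_le_sum fun x _ => hf (Nat.le_add_right _ _)
        _ = s * f (s * M) := by simp
  exact (Finset.sum_le_sum_of_subset (Finset.range_subset_range.2 (le_mul_cdiv hs))).trans (key _)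

/-- The same comparison shifted by one block: `s` times the first term of a block is at most the sum
over the preceding block, and only the very first term has no predecessor. -/
theorem sum_lattice_le_sum {f : ℕ → ℕ} (hf : Antitone f) {s : ℕ} (hs : 0 < s) (A : ℕ) :
    s * ∑ i ∈ Finset.range (cdiv A s), f (s * i) ≤ ∑ x ∈ Finset.range A, f x + s * f 0 := by
  have key : ∀ M, s * ∑ i ∈ Finset.range (M + 1), f (s * i) ≤
      ∑ x ∈ Finset.range (s * M), f x + s * f 0 := by
    intro M
    induction M with
    | zero => simp
    | succ M ih =>
      have e : ∑ x ∈ Finset.range (s * (M + 1)), f x =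
          ∑ x ∈ Finset.range (s * M), f x + ∑ x ∈ Finset.range s, f (s * M + x) := by
        rw [Nat.mul_succ, Finset.sum_range_add]
      rw [Finset.sum_range_succ, mul_add, e]
      have : s * f (s * (M + 1)) ≤ ∑ x ∈ Finset.range s, f (s * M + x) := by
        calc s * f (s * (M + 1)) = ∑ _x ∈ Finset.range s, f (s * (M + 1)) := by simp
          _ ≤ _ := Finset.sum_le_sum fun x hx => hf (by
            have := Finset.mem_range.1 hx
            rw [Nat.mul_succ]
            omega)
      omega
  rcases Nat.eq_zero_or_pos (cdiv A s) with h | h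
  · simp [h]
  · obtain ⟨M, hM⟩ := Nat.exists_eq_succ_of_ne_zero h.ne'
    have hM' : s * M < A := (lt_cdiv_iff hs).1 (by omega)
    rw [hM]
    exact (key M).trans (Nat.add_le_add_right (Finset.sum_le_sum_of_subset
      (Finset.range_subset_range.2 hM'.le)) _)

namespace Rects
variable (F : Rects)

/-- The number of values satisfying `p` among the entries in every `s`-th row and column. -/
noncomputable def count (s : ℕ) (p : ℝ → Prop) : ℕ :=
  ∑ v ∈ Finset.range F.V, ∑ i ∈ Finset.range (cdiv (F.A v) s),
    cnt p (fun j => F.U v (s * i) + F.R v (s * j)) (cdiv (F.B v) s)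

/-- The total number of rows and columns of the coarsened matrices. -/
def dim (s : ℕ) : ℕ := ∑ v ∈ Finset.range F.V, (cdiv (F.A v) s + cdiv (F.B v) s)

variable {F} {s : ℕ} {p r : ℝ → Prop}

theorem dim_anti {t : ℕ} (hs : 0 < s) (hst : s ≤ t) : F.dim t ≤ F.dim s :=
  Finset.sum_le_sum fun _ _ => add_le_add (cdiv_anti hs hst) (cdiv_anti hs hst)

theorem count_mono (h : ∀ x, p x → r x) : F.count s p ≤ F.count s r :=
  Finset.sum_le_sum fun _ _ => Finset.sum_le_sum fun _ _ => cnt_mono fun _ _ => h _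

theorem count_congr (h : ∀ x, p x ↔ r x) : F.count s p = F.count s r :=
  le_antisymm (count_mono fun x => (h x).1) (count_mono fun x => (h x).2)

theorem count_split (q : ℝ → Prop) :
    F.count s p = F.count s (fun x => q x ∧ p x) + F.count s fun x => ¬ q x ∧ p x := by
  simp only [count, ← Finset.sum_add_distrib]
  exact Finset.sum_congr rfl fun _ _ => Finset.sum_congr rfl fun _ _ => cnt_split q

/-- An upper set cuts a staircase out of a sorted matrix. The two lattice comparisons are applied to
the columns and then to the rows. Thinning the columns costs at most `s` per retained row, thinning
the rows at most one full row, of length at most `s * cdiv B s`; a further factor `s` turns these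
into `s * s * cdiv A s` and `s * s * cdiv B s`. -/
theorem count_bounds (hs : 0 < s) (hp : Upper p) :
    F.count 1 p ≤ s * s * F.count s p ∧ s * s * F.count s p ≤ F.count 1 p + s * s * F.dim s := by
  classical
  simp only [count, dim, cdiv_one, one_mul, Finset.mul_sum, ← Finset.sum_add_distrib]
  suffices ∀ v ∈ Finset.range F.V,
      ∑ i ∈ Finset.range (F.A v), cnt p (fun j => F.U v i + F.R v j) (F.B v) ≤
        s * s * ∑ i ∈ Finset.range (cdiv (F.A v) s),
          cnt p (fun j => F.U v (s * i) + F.R v (s * j)) (cdiv (F.B v) s) ∧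
      s * s * ∑ i ∈ Finset.range (cdiv (F.A v) s),
          cnt p (fun j => F.U v (s * i) + F.R v (s * j)) (cdiv (F.B v) s) ≤
        ∑ i ∈ Finset.range (F.A v), cnt p (fun j => F.U v i + F.R v j) (F.B v) +
          s * s * (cdiv (F.A v) s + cdiv (F.B v) s) by
    simp only [Finset.mul_sum] at this
    exact ⟨Finset.sum_le_sum fun v hv => (this v hv).1, Finset.sum_le_sum fun v hv => (this v hv).2⟩
  intro v hv
  have hU := F.anti_U v (Finset.mem_range.1 hv)
  have hR := F.anti_R v (Finset.mem_range.1 hv)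
  set A := F.A v
  set B := F.B v
  -- Truncating the indicator to the matrix makes it antitone in both indices without any range
  -- conditions.
  set f : ℕ → ℕ → ℕ := fun i j => if i < A ∧ j < B ∧ p (F.U v i + F.R v j) then 1 else 0 with hf
  have hf1 : ∀ i j, f i j ≤ 1 := fun i j => by simp only [hf]; split_ifs <;> simp
  have hfj : ∀ i, Antitone (f i) := fun i j j' hj => by
    simp only [hf]
    split_ifs with h1 h2 <;> try simp
    exact h2 ⟨h1.1, by omega, hp _ _ (add_le_add_right (hR (by omega) j j' hj h1.2.1) _) h1.2.2⟩
  have hfi : ∀ j, Antitone fun i => f i j := fun j i i' hi => by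
    simp only [hf]
    split_ifs with h1 h2 <;> try simp
    exact h2 ⟨by omega, h1.2.1, hp _ _ (add_le_add_left (hU i i' hi h1.1) _) h1.2.2⟩
  have hF : Antitone fun i => ∑ j ∈ Finset.range B, f i j := fun i i' hi =>
    Finset.sum_le_sum fun j _ => hfi j hi
  have e1 : ∑ i ∈ Finset.range A, cnt p (fun j => F.U v i + F.R v j) B =
      ∑ i ∈ Finset.range A, ∑ j ∈ Finset.range B, f i j :=
    Finset.sum_congr rfl fun i hi => Finset.sum_congr rfl fun j hj => by
      simp only [hf, Finset.mem_range.1 hi, Finset.mem_range.1 hj, true_and]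
  have e2 : ∑ i ∈ Finset.range (cdiv A s),
      cnt p (fun j => F.U v (s * i) + F.R v (s * j)) (cdiv B s) =
      ∑ i ∈ Finset.range (cdiv A s), ∑ j ∈ Finset.range (cdiv B s), f (s * i) (s * j) :=
    Finset.sum_congr rfl fun i hi => Finset.sum_congr rfl fun j hj => by
      simp only [hf, (lt_cdiv_iff hs).1 (Finset.mem_range.1 hi),
        (lt_cdiv_iff hs).1 (Finset.mem_range.1 hj), true_and]
  rw [e1, e2]
  have up1 := sum_le_sum_lattice hF hs A
  have lo1 := sum_lattice_le_sum hF hs A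
  have up2 : ∑ i ∈ Finset.range (cdiv A s), ∑ j ∈ Finset.range B, f (s * i) j ≤
      s * ∑ i ∈ Finset.range (cdiv A s), ∑ j ∈ Finset.range (cdiv B s), f (s * i) (s * j) := by
    rw [Finset.mul_sum]
    exact Finset.sum_le_sum fun i _ => sum_le_sum_lattice (hfj _) hs B
  have lo2 : s * ∑ i ∈ Finset.range (cdiv A s), ∑ j ∈ Finset.range (cdiv B s), f (s * i) (s * j) ≤
      ∑ i ∈ Finset.range (cdiv A s), ∑ j ∈ Finset.range B, f (s * i) j + s * cdiv A s := by
    calc _ ≤ ∑ i ∈ Finset.range (cdiv A s), (∑ j ∈ Finset.range B, f (s * i) j + s * 1) := by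
          rw [Finset.mul_sum]
          exact Finset.sum_le_sum fun i _ => (sum_lattice_le_sum (hfj _) hs B).trans
            (Nat.add_le_add_left (Nat.mul_le_mul_left _ (hf1 _ _)) _)
      _ = _ := by rw [Finset.sum_add_distrib]; simp [mul_comm]
  have lo3 : ∑ j ∈ Finset.range B, f 0 j ≤ s * cdiv B s := by
    refine le_trans ?_ (le_mul_cdiv hs)
    calc _ ≤ ∑ _j ∈ Finset.range B, 1 := Finset.sum_le_sum fun j _ => hf1 _ _
      _ = B := by simp
  have up2' := Nat.mul_le_mul_left s up2
  have lo2' := Nat.mul_le_mul_left s lo2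
  have lo3' := Nat.mul_le_mul_left s lo3
  constructor <;> nlinarith

/-! ### Narrowing the search interval -/

/-- `z` is the `k`-th largest entry of the matrices of the family. -/
def IsAnswer (F : Rects) (k : ℕ) (z : ℝ) : Prop :=
  F.count 1 (fun x => z < x) < k ∧ k ≤ F.count 1 fun x => z ≤ x

theorem upper_lt (z : ℝ) : Upper fun x => z < x := fun _ _ h h' => h'.trans_le h
theorem upper_le (z : ℝ) : Upper fun x => z ≤ x := fun _ _ h h' => h'.trans h

/-- Together with `IsAnswer.count_lt` this encloses the answer: a coarse entry of rank `cdiv k (s *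
s)` is not below `z`, and one of rank `cdiv k (s * s) + F.dim s` is not above it. -/
theorem IsAnswer.le_count {k : ℕ} {z : ℝ} (h : F.IsAnswer k z) (hs : 0 < s) :
    cdiv k (s * s) ≤ F.count s fun x => z ≤ x :=
  (cdiv_le_iff (Nat.mul_pos hs hs)).2 (h.2.trans (count_bounds hs (upper_le z)).1)

theorem IsAnswer.count_lt {k : ℕ} {z : ℝ} (h : F.IsAnswer k z) (hs : 0 < s) :
    F.count s (fun x => z < x) < cdiv k (s * s) + F.dim s := by
  have h1 := (count_bounds (F := F) hs (upper_lt z)).2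
  have h2 := le_mul_cdiv (x := k) (Nat.mul_pos hs hs)
  have h3 := h.1
  refine Nat.lt_of_mul_lt_mul_left (a := s * s) ?_
  rw [mul_add]
  omega

/-- `z'` is the `j`-th largest entry of the coarsened matrices, clamped to `[lo, hi]`; the
entries strictly between `lo` and `hi` are listed by `f`. -/
def Clamped (f : ℕ → ℝ) (m c j : ℕ) (lo hi z' : ℝ) : Prop :=
  (j ≤ c ∧ z' = hi) ∨ (c < j ∧ j ≤ c + m ∧ IsKth f m (j - c) z') ∨ (c + m < j ∧ z' = lo)

section narrow
variable {f : ℕ → ℝ} {m c k j : ℕ} {lo hi z z' : ℝ}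

/-- A set that contains `[hi, ∞)` and lies in `(lo, ∞)` is counted by the entries from `hi` on,
which are only numbered, and the entries strictly between, which are listed. -/
theorem count_of_mid (hm : ∀ r : ℝ → Prop, cnt r f m = F.count s fun x => (lo < x ∧ x < hi) ∧ r x)
    (hc : c = F.count s fun x => hi ≤ x) {q : ℝ → Prop} (hq : ∀ x, hi ≤ x → q x)
    (hq' : ∀ x, q x → lo < x) : F.count s q = c + cnt q f m := by
  rw [count_split (fun x => hi ≤ x), hc, hm]
  congr 1
  · exact count_congr fun x => ⟨fun h => h.1, fun h => ⟨h, hq x h⟩⟩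
  · exact count_congr fun x => ⟨fun h => ⟨⟨hq' x h.2, not_le.1 h.1⟩, h.2⟩,
      fun h => ⟨not_le.2 h.1.2, h.2⟩⟩

theorem mem_mid (hm : ∀ r : ℝ → Prop, cnt r f m = F.count s fun x => (lo < x ∧ x < hi) ∧ r x)
    {q : ℕ} (h : IsKth f m q z') : lo < z' ∧ z' < hi := by
  have hall : ∀ e < m, lo < f e ∧ f e < hi := by
    by_contra! hn
    obtain ⟨e, he, hne⟩ := hn
    -- Counting the listed values outside the interval with `hm` gives zero.
    have h0 := hm fun x => ¬ (lo < x ∧ x < hi)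
    rw [count_congr (r := fun _ => False) (by tauto)] at h0
    have h1 : F.count s (fun _ => False) = 0 := by simp [count, cnt]
    rw [h1] at h0
    classical
    rw [cnt, Finset.sum_eq_zero_iff] at h0
    have := h0 e (Finset.mem_range.2 he)
    rw [if_pos (fun h => (hne h.1).not_gt h.2)] at this
    omega
  constructor
  · by_contra! hle
    have : cnt (fun x => z' ≤ x) f m ≤ cnt (fun x => z' < x) f m :=
      cnt_mono fun e he _ => hle.trans_lt (hall e he).1
    exact absurd h.2 (by have := h.1; omega)
  · obtain ⟨e, he, h'⟩ := exists_of_cnt_pos (p := fun x => z' ≤ x) (f := f) (m := m)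
      (by have := h.1; have := h.2; omega)
    exact h'.trans_lt (hall e he).2

/-- If the rank is already reached at `hi`, the old bound is kept. If the list is too short for the
rank, fewer than `cdiv k (s * s)` coarse entries exceed `lo`, which forces `z = lo`. Otherwise the
selected value has the required counts. -/
theorem IsAnswer.narrow_hi (h : F.IsAnswer k z) (hs : 0 < s) (hlo : lo ≤ z) (hhi : z ≤ hi)
    (hm : ∀ r : ℝ → Prop, cnt r f m = F.count s fun x => (lo < x ∧ x < hi) ∧ r x)
    (hc : c = F.count s fun x => hi ≤ x) (hz : Clamped f m c (cdiv k (s * s)) lo hi z') :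
    z ≤ z' ∧ cdiv k (s * s) ≤ F.count s fun x => z' ≤ x := by
  have ha := h.le_count hs
  rcases hz with ⟨hj, rfl⟩ | ⟨hj, hj', hk⟩ | ⟨hj, rfl⟩
  · exact ⟨hhi, hc ▸ hj⟩
  · obtain ⟨h1, h2⟩ := mem_mid hm hk
    obtain ⟨h3, h4⟩ := hk
    constructor
    · by_contra! hlt
      have h5 : F.count s (fun x => z ≤ x) ≤ F.count s fun x => z' < x :=
        count_mono fun x hx => hlt.trans_le hx
      rw [count_of_mid hm hc (q := fun x => z' < x) (fun x hx => h2.trans_le hx)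
        fun x hx => h1.trans hx] at h5
      omega
    · rw [count_of_mid hm hc (q := fun x => z' ≤ x) (fun x hx => h2.le.trans hx)
        fun x hx => h1.trans_le hx]
      omega
  · have : z = z' := by
      refine le_antisymm ?_ hlo
      by_contra! hlt
      have h5 : F.count s (fun x => z ≤ x) ≤ F.count s fun x => z' < x :=
        count_mono fun x hx => hlt.trans_le hx
      rw [count_of_mid hm hc (q := fun x => z' < x) (fun x hx => (hlt.trans_le hhi).trans_le hx)
        fun x hx => hx] at h5
      have := cnt_le (p := fun x => z' < x) (f := f) (m := m)
      omega
    exact ⟨this.le, this ▸ ha⟩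

theorem IsAnswer.narrow_lo (h : F.IsAnswer k z) (hs : 0 < s) (hlo : lo ≤ z) (hhi : z ≤ hi)
    (hm : ∀ r : ℝ → Prop, cnt r f m = F.count s fun x => (lo < x ∧ x < hi) ∧ r x)
    (hc : c = F.count s fun x => hi ≤ x)
    (hz : Clamped f m c (cdiv k (s * s) + F.dim s) lo hi z') :
    z' ≤ z ∧ F.count s (fun x => z' < x) < cdiv k (s * s) + F.dim s := by
  have hb := h.count_lt hs
  rcases hz with ⟨hj, rfl⟩ | ⟨hj, hj', hk⟩ | ⟨hj, rfl⟩
  · have : z = z' := by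
      refine le_antisymm hhi ?_
      by_contra! hlt
      have h5 : F.count s (fun x => z' ≤ x) ≤ F.count s fun x => z < x :=
        count_mono fun x hx => hlt.trans_le hx
      omega
    exact ⟨this.ge, this ▸ hb⟩
  · obtain ⟨h1, h2⟩ := mem_mid hm hk
    obtain ⟨h3, h4⟩ := hk
    constructor
    · by_contra! hlt
      have h5 : F.count s (fun x => z' ≤ x) ≤ F.count s fun x => z < x :=
        count_mono fun x hx => hlt.trans_le hx
      rw [count_of_mid hm hc (q := fun x => z' ≤ x) (fun x hx => h2.le.trans hx)
        fun x hx => h1.trans_le hx] at h5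
      omega
    · rw [count_of_mid hm hc (q := fun x => z' < x) (fun x hx => h2.trans_le hx)
        fun x hx => h1.trans hx]
      omega
  · refine ⟨hlo, ?_⟩
    -- `count_of_mid` needs `lo < hi` here; if the interval has shrunk to a point, that point is the
    -- answer.
    rcases (hlo.trans hhi).eq_or_lt with heq | hlt
    · have : z = z' := le_antisymm (heq ▸ hhi) hlo
      exact this ▸ hb
    · rw [count_of_mid hm hc (q := fun x => z' < x) (fun x hx => hlt.trans_le hx) fun x hx => hx]
      have := cnt_le (p := fun x => z' < x) (f := f) (m := m)
      omega

/-- The constant is `4 + 4 + 1`. Passing from stride `2 * s` to stride `s` multiplies counts by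
four; the gap `F.dim (2 * s)` between the two ranks and the coarsening error at `hi` contribute four
dimensions each, and the coarsening error of stride `s` at `lo` one more. -/
theorem mid_le (hs : 0 < s) (h1 : j ≤ F.count (s * 2) fun x => hi ≤ x)
    (h2 : F.count (s * 2) (fun x => lo < x) < j + F.dim (s * 2)) :
    F.count s (fun x => lo < x ∧ x < hi) ≤ 9 * F.dim s := by
  rcases lt_or_ge lo hi with hlt | hge
  · have e : F.count s (fun x => lo < x) =
        F.count s (fun x => lo < x ∧ x < hi) + F.count s fun x => hi ≤ x := by
      rw [count_split fun x => x < hi]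
      congr 1
      · exact count_congr fun x => and_comm
      · exact count_congr fun x => ⟨fun h => not_lt.1 h.1, fun h => ⟨not_lt.2 h, hlt.trans_le h⟩⟩
    have a1 := (count_bounds (F := F) hs (upper_lt lo)).2
    have a2 := (count_bounds (F := F) hs (upper_le hi)).1
    have a3 := (count_bounds (F := F) (s := s * 2) (by omega) (upper_lt lo)).1
    have a4 := (count_bounds (F := F) (s := s * 2) (by omega) (upper_le hi)).2
    have a5 : F.dim (s * 2) ≤ F.dim s := dim_anti hs (by omega)
    refine Nat.le_of_mul_le_mul_left (c := s * s) ?_ (Nat.mul_pos hs hs)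
    have b1 := Nat.mul_le_mul_left (s * s) h1
    have b2 := Nat.mul_le_mul_left (s * s) h2.le
    have b3 := Nat.mul_le_mul_left (s * s) a5
    rw [e] at a1
    nlinarith
  · rw [count_congr (r := fun _ => False) fun x =>
      ⟨fun h => absurd (h.1.trans h.2) hge.not_gt, False.elim⟩]
    simp [count, cnt]

theorem IsAnswer.unique (h : F.IsAnswer k z) (h1 : z ≤ z') (h2 : k ≤ F.count 1 fun x => z' ≤ x) :
    z' = z := by
  refine le_antisymm ?_ h1
  by_contra! hlt
  have h5 : F.count 1 (fun x => z' ≤ x) ≤ F.count 1 fun x => z < x :=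
    count_mono fun x hx => hlt.trans_le hx
  have := h.1
  omega

/-- Starting point of the refinement: at a stride not smaller than any number of rows, each matrix
retains at most one row. -/
theorem count_le_dim (hs : 0 < s) (hA : ∀ v < F.V, F.A v ≤ s) :
    F.count s p ≤ F.dim s := by
  refine Finset.sum_le_sum fun v hv => ?_
  have h1 : cdiv (F.A v) s ≤ 1 := (cdiv_le_iff hs).2 (by simpa using hA v (Finset.mem_range.1 hv))
  calc _ ≤ ∑ i ∈ Finset.range (cdiv (F.A v) s), cdiv (F.B v) s :=
        Finset.sum_le_sum fun i _ => cnt_le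
    _ = cdiv (F.A v) s * cdiv (F.B v) s := by simp
    _ ≤ 1 * cdiv (F.B v) s := Nat.mul_le_mul_right _ h1
    _ ≤ _ := by omega

end narrow
end Rects

/-! ### Listing the entries of the coarsened matrices in an interval -/

theorem putW_putW (s : State) (i a b : ℕ) : (s.putW i a).putW i b = s.putW i b := by
  simp [State.putW]

theorem putW_self {s : State} {i a : ℕ} (h : s.wreg i = a) : s.putW i a = s := by
  subst h
  simp [State.putW]

/-- Decrease a register until it is zero or the test fails. -/
def shrink (ρ : ℕ) (t : Test) : Prog :=
  .loop (.and (.wlt (.const 0) (.reg ρ)) t) (.setW ρ (.sub (.reg ρ) (.const 1)))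

/-- `Test.and` evaluates both operands, so `t` must be evaluable even at `x = 0`, where its outcome
is irrelevant. -/
theorem shrink_spec {W ρ p q : ℕ} {t : Test} {s₀ : State} (hwf : WF W s₀) (hρ : s₀.wreg ρ = p)
    (hqp : q ≤ p) (hW : 1 ≤ W) (ht : ∀ x, q ≤ x → x ≤ p → t.ok W (s₀.putW ρ x) ∧
      (0 < x → (t.val (s₀.putW ρ x) ↔ q < x))) :
    Ht W (shrink ρ t) s₀ ((p - q) * (t.cost + 9) + t.cost + 5) fun s => s = s₀.putW ρ q := by
  refine Ht.loop_count (fun j s => j ≤ p - q ∧ s = s₀.putW ρ (p - j)) (p - q) (fun _ => 4) hwf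
    ⟨by omega, by rw [Nat.sub_zero, putW_self hρ]⟩ ?_ ?_ ?_ ?_
  · rintro j s - ⟨hj, rfl⟩
    obtain ⟨h1, h2⟩ := ht (p - j) (by omega) (by omega)
    simp only [Test.ok, Test.val, WExp.ok, WExp.val, putW_wreg, if_true, h1, and_true, true_and]
    refine ⟨zero_le, ⟨fun h => ?_, fun h => ⟨by omega, (h2 (by omega)).2 (by omega)⟩⟩⟩
    have := (h2 h.1).1 h.2
    omega
  · rintro j s hj hs ⟨-, rfl⟩
    refine Ht.of_wp hs ?_ (by simp [Prog.cost, WExp.cost])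
    simp only [Prog.wp, WExp.ok, WExp.val, true_and, hW, putW_wreg, if_true, putW_putW]
    exact ⟨hj, by rw [Nat.sub_sub]⟩
  · rintro s - ⟨-, rfl⟩
    rw [Nat.sub_sub_self hqp]
  · simp only [Finset.sum_const, Finset.card_range, smul_eq_mul, Test.cost, WExp.cost]
    ring_nf
    omega

/-- In a descending sequence an upper set is an initial segment, whose length is its count. -/
theorem cnt_iff_lt {p : ℝ → Prop} (hp : Upper p) {f : ℕ → ℝ} {m : ℕ}
    (hf : ∀ j j', j ≤ j' → j' < m → f j' ≤ f j) {j : ℕ} (hj : j < m) :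
    p (f j) ↔ j < cnt p f m := by
  classical
  rw [cnt, ← Finset.card_filter]
  constructor
  · intro h
    rw [← Nat.succ_le_iff, ← Finset.card_range j.succ]
    refine Finset.card_le_card fun e he => ?_
    simp only [Finset.mem_filter, Finset.mem_range] at he ⊢
    exact ⟨by omega, hp _ _ (hf e j (by omega) hj) h⟩
  · intro h
    by_contra hn
    refine absurd h (not_lt.2 ?_)
    conv_rhs => rw [← Finset.card_range j]
    refine Finset.card_le_card fun e he => ?_
    simp only [Finset.mem_filter, Finset.mem_range] at he ⊢
    by_contra! hge
    exact hn (hp _ _ (hf j e hge he.1) he.2)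

/-- Entry `e` of the current column summands. -/
def colExp (e : WExp) : RExp :=
  .load 9 (.load 2 (.add (.load 8 (.reg 20)) (.mul (.reg 5) e)))

/-- Append the entries of the current row between the two thresholds to the array `12`. -/
def appendRow : Prog :=
  .loop (.wlt (.reg 26) (.reg 25))
    (.seq (.storeR 12 (.reg 28) (.add (.reg 11) (colExp (.reg 26))))
      (.seq (.setW 28 (.add (.reg 28) (.const 1))) (.setW 26 (.add (.reg 26) (.const 1)))))

/-- The part of the memory that represents a family of matrices. -/
structure Holds (W n : ℕ) (F : Rects) (s : State) : Prop where
  r0 : s.wreg 0 = n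
  r4 : s.wreg 4 = F.V
  A : ∀ v < F.V, s.wmem 6 v = F.A v
  B : ∀ v < F.V, s.wmem 9 v = F.B v
  U : ∀ v < F.V, ∀ i < F.A v, s.rmem 13 (v * n + i) = F.U v i
  R : ∀ v < F.V, 0 < F.A v → ∀ j < F.B v, s.rmem 9 (s.wmem 2 (s.wmem 8 v + j)) = F.R v j
  off : ∀ v < F.V, 0 < F.A v → s.wmem 8 v + F.B v ≤ W
  A_le : ∀ v < F.V, F.A v ≤ n

theorem Holds.keep {W n : ℕ} {F : Rects} {s s' : State} (h : Holds W n F s) {c r : ℕ}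
    {lw lr : List ℕ} (hk : Keeps c r lw lr s s') (hc : 5 ≤ c) (hlw : lw ⊆ [7]) (hlr : lr ⊆ [11, 12]) :
    Holds W n F s' := by
  have hk' := hk.mono hc (Nat.zero_le r) hlw hlr
  have w6 := hk'.wmem 6 (by simp)
  have w9 := hk'.wmem 9 (by simp)
  have w2 := hk'.wmem 2 (by simp)
  have w8 := hk'.wmem 8 (by simp)
  have r13 := hk'.rmem 13 (by simp)
  have r9 := hk'.rmem 9 (by simp)
  refine ⟨?_, ?_, ?_, ?_, ?_, ?_, ?_, h.A_le⟩
  · rw [hk'.wreg 0 (by simp), h.r0]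
  · rw [hk'.wreg 4 (by simp), h.r4]
  · rw [w6]; exact h.A
  · rw [w9]; exact h.B
  · rw [r13]; exact h.U
  · rw [r9, w2, w8]; exact h.R
  · rw [w8]; exact h.off

theorem appendRow_spec {W m k₁ k₂ off t : ℕ} {u : ℝ} {g : ℕ → ℝ} {s₀ : State} (hwf : WF W s₀)
    (h25 : s₀.wreg 25 = k₂) (h26 : s₀.wreg 26 = k₁) (h28 : s₀.wreg 28 = m) (h5 : s₀.wreg 5 = t)
    (hoff : s₀.wmem 8 (s₀.wreg 20) = off) (h11 : s₀.rreg 11 = u)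
    (hg : ∀ j < k₂, u + s₀.rmem 9 (s₀.wmem 2 (off + t * j)) = g j)
    (hj : ∀ j < k₂, off + t * j ≤ W) (hW : m + (k₂ - k₁) + 1 ≤ W) (hW' : k₂ + 1 ≤ W) :
    Ht W appendRow s₀ ((k₂ - k₁) * 30 + 10) fun s => Keeps 20 100 [] [12] s₀ s ∧
      (∀ i, i ≠ 26 → i ≠ 28 → s.wreg i = s₀.wreg i) ∧ s.wreg 28 = m + (k₂ - k₁) ∧
      (∀ x < m, s.rmem 12 x = s₀.rmem 12 x) ∧ ∀ e < k₂ - k₁, s.rmem 12 (m + e) = g (k₁ + e) := by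
  refine Ht.loop_count (fun j s => Keeps 20 100 [] [12] s₀ s ∧
      (∀ i, i ≠ 26 → i ≠ 28 → s.wreg i = s₀.wreg i) ∧ s.wreg 26 = k₁ + j ∧ s.wreg 28 = m + j ∧
      (∀ x < m, s.rmem 12 x = s₀.rmem 12 x) ∧ ∀ e < j, s.rmem 12 (m + e) = g (k₁ + e)) (k₂ - k₁)
      (fun _ => 25) hwf
      ⟨Keeps.rfl, fun _ _ _ => rfl, h26, h28, fun _ _ => rfl, by simp⟩ ?_ ?_ ?_ ?_
  · rintro j s - ⟨-, hr, f26, -⟩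
    simp only [Test.ok, Test.val, WExp.ok, WExp.val, f26, hr 25 (by norm_num) (by norm_num), h25,
      true_and]
    omega
  · rintro j s hjk hs ⟨hk, hr, f26, f28, hl, hm⟩
    refine Ht.of_wp hs ?_ (by simp [Prog.cost, WExp.cost, RExp.cost, colExp])
    have b1 : 1 ≤ W := by omega
    have b2 : k₁ + j + 1 ≤ W := by omega
    have b3 : m + j + 1 ≤ W := by omega
    have b4 := hj (k₁ + j) (by omega)
    have b5 : t * (k₁ + j) ≤ W := by omega
    have e2 := hk.wmem 2 (by simp)
    have e8 := hk.wmem 8 (by simp)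
    have e9 := hk.rmem 9 (by simp)
    simp only [colExp, Prog.wp, WExp.ok, WExp.val, RExp.ok, RExp.val, f26, f28, putRM_wreg,
      putW_wreg, Nat.reduceEqDiff, if_false, true_and, b1, b2, b3, e2, e8, e9,
      hr 5 (by norm_num) (by norm_num), h5, hr 20 (by norm_num) (by norm_num), hoff, b4, b5,
      hk.rreg 11 (by norm_num), h11, hg (k₁ + j) (by omega)]
    refine ⟨((hk.putRM (by simp)).putW (by simp)).putW (by simp), fun i hi hi' => ?_, by simp; ring,
      by simp; ring, fun x hx => ?_, fun e he => ?_⟩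
    · simp [hi, hi', hr i hi hi']
    · simp only [putW_rmem, putRM_rmem, if_true]
      rw [Function.update_of_ne (by omega), hl x hx]
    · simp only [putW_rmem, putRM_rmem, if_true, Function.update_apply]
      split_ifs with he'
      · rw [show e = j by omega]
      · exact hm e (by omega)
  · rintro s - ⟨hk, hr, -, f28, hl, hm⟩
    exact ⟨hk, hr, f28, hl, hm⟩
  · simp only [Finset.sum_const, Finset.card_range, smul_eq_mul, Test.cost, WExp.cost]
    omega

/-- In a descending row the entries strictly between `lo` and `hi` occupy exactly the positions from
`k₁` up to `k₂`; if `hi ≤ lo`, both the range and the set of entries are empty. -/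
theorem cnt_append {r : ℝ → Prop} {f f' g : ℕ → ℝ} {m N k₁ k₂ : ℕ} {lo hi : ℝ}
    (hg : ∀ j j', j ≤ j' → j' < N → g j' ≤ g j)
    (h₁ : k₁ = cnt (fun x => hi ≤ x) g N) (h₂ : k₂ = cnt (fun x => lo < x) g N)
    (hl : ∀ x < m, f' x = f x) (hm : ∀ e < k₂ - k₁, f' (m + e) = g (k₁ + e)) :
    cnt r f' (m + (k₂ - k₁)) = cnt r f m + cnt (fun x => (lo < x ∧ x < hi) ∧ r x) g N := by
  classical
  have hk₂ : k₂ ≤ N := h₂ ▸ cnt_le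
  rw [cnt, Finset.sum_range_add]
  congr 1
  · exact cnt_congr fun e he => by rw [hl e he]
  · calc (∑ e ∈ Finset.range (k₂ - k₁), if r (f' (m + e)) then 1 else 0) =
          ∑ e ∈ Finset.range (k₂ - k₁), if r (g (k₁ + e)) then 1 else 0 :=
          by
            refine Finset.sum_congr rfl fun e he => ?_
            rw [hm e (Finset.mem_range.1 he)]
      _ = ∑ j ∈ Finset.Ico k₁ k₂, if r (g j) then (1 : ℕ) else 0 := by
          rw [Finset.sum_Ico_eq_sum_range]
      _ = ∑ j ∈ Finset.Ico k₁ k₂, if (lo < g j ∧ g j < hi) ∧ r (g j) then (1 : ℕ) else 0 := by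
          refine Finset.sum_congr rfl fun j hj => ?_
          obtain ⟨h3, h4⟩ := Finset.mem_Ico.1 hj
          have h5 := (cnt_iff_lt (Rects.upper_le hi) hg (j := j) (by omega)).not.2 (by omega)
          have h6 := (cnt_iff_lt (Rects.upper_lt lo) hg (j := j) (by omega)).2 (by omega)
          simp only [h6, not_le.1 h5, true_and]
      _ = cnt (fun x => (lo < x ∧ x < hi) ∧ r x) g N := by
          refine (Finset.sum_subset (s₂ := Finset.range N) (fun j hj => ?_)
            fun j hj hj' => ?_).trans (Finset.sum_congr rfl fun _ _ => by congr)
          · exact Finset.mem_range.2 (by have := Finset.mem_Ico.1 hj; omega)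
          · have hj := Finset.mem_range.1 hj
            rw [if_neg]
            rintro ⟨⟨h3, h4⟩, -⟩
            refine hj' (Finset.mem_Ico.2 ⟨?_, ?_⟩)
            · rw [h₁]
              exact not_lt.1 fun h => not_le.2 h4 ((cnt_iff_lt (Rects.upper_le hi) hg hj).2 h)
            · rw [h₂]
              exact (cnt_iff_lt (Rects.upper_lt lo) hg hj).1 h3

/-- List the entries of one row that lie strictly between `rreg 9` and `rreg 8`. -/
def rowBody : Prog :=
  .seq (.setR 11 (.load 13 (.add (.mul (.reg 20) (.reg 0)) (.mul (.reg 5) (.reg 23)))))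
    (.seq (shrink 24 (.rlt (.add (.reg 11) (colExp (.sub (.reg 24) (.const 1)))) (.reg 8)))
      (.seq (shrink 25 (.not (.rlt (.reg 9) (.add (.reg 11) (colExp (.sub (.reg 25) (.const 1)))))))
        (.seq (.seq (.setW 27 (.add (.reg 27) (.reg 24))) (.setW 26 (.reg 24)))
          (.seq appendRow (.setW 23 (.add (.reg 23) (.const 1)))))))

/-! ### Staircase walk through the rows of the coarsened matrices. -/

namespace Rects

/-- Row `i` of the coarsened matrix `v`. -/
def row (F : Rects) (s v i : ℕ) : ℕ → ℝ := fun j => F.U v (s * i) + F.R v (s * j)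

/-- The number of entries of a row of a coarsened matrix that satisfy `p`. -/
noncomputable def rowCount (F : Rects) (s : ℕ) (p : ℝ → Prop) (v i : ℕ) : ℕ :=
  cnt p (F.row s v i) (cdiv (F.B v) s)

theorem row_anti {F : Rects} {s v i : ℕ} (hs : 0 < s) (hv : v < F.V) (hi : i < cdiv (F.A v) s) :
    ∀ j j', j ≤ j' → j' < cdiv (F.B v) s → F.row s v i j' ≤ F.row s v i j := fun j j' h h' =>
  add_le_add_right (F.anti_R v hv (by have := (lt_cdiv_iff hs).1 hi; omega) _ _
    (Nat.mul_le_mul_left _ h) ((lt_cdiv_iff hs).1 h')) _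

/-- The thresholds move only to the left from one row to the next, so a single descending pointer
serves all rows of a matrix. -/
theorem rowCount_anti {F : Rects} {s v i : ℕ} {p : ℝ → Prop} (hp : Upper p) (hs : 0 < s)
    (hv : v < F.V) (hi : i + 1 < cdiv (F.A v) s) :
    F.rowCount s p v (i + 1) ≤ F.rowCount s p v i :=
  cnt_mono fun _ _ h => hp _ _ (add_le_add_left (F.anti_U v hv _ _
    (Nat.mul_le_mul_left _ (Nat.le_succ i)) ((lt_cdiv_iff hs).1 hi)) _) h

end Rects


namespace Rects

/-- The number of entries satisfying `p` in the coarsened matrices before row `i` of matrix `v`. -/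
noncomputable def upto (F : Rects) (s : ℕ) (p : ℝ → Prop) (v i : ℕ) : ℕ :=
  ∑ v' ∈ Finset.range v, ∑ i' ∈ Finset.range (cdiv (F.A v') s), F.rowCount s p v' i' +
    ∑ i' ∈ Finset.range i, F.rowCount s p v i'

variable {F : Rects} {s : ℕ} {p : ℝ → Prop}

theorem upto_succ (v i : ℕ) : F.upto s p v (i + 1) = F.upto s p v i + F.rowCount s p v i := by
  rw [upto, upto, Finset.sum_range_succ, add_assoc]

theorem upto_next (v : ℕ) : F.upto s p (v + 1) 0 = F.upto s p v (cdiv (F.A v) s) := by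
  rw [upto, upto, Finset.sum_range_succ, Finset.range_zero, Finset.sum_empty, add_zero]

theorem upto_V : F.upto s p F.V 0 = F.count s p := by
  rw [upto, Finset.range_zero, Finset.sum_empty, add_zero]
  rfl

theorem upto_le {v i : ℕ} (hv : v < F.V) (hi : i ≤ cdiv (F.A v) s) :
    F.upto s p v i ≤ F.count s p := by
  calc F.upto s p v i ≤ F.upto s p v (cdiv (F.A v) s) :=
        Nat.add_le_add_left (Finset.sum_le_sum_of_subset (Finset.range_subset_range.2 hi)) _
    _ = F.upto s p (v + 1) 0 := (upto_next v).symm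
    _ ≤ F.upto s p F.V 0 :=
        Nat.add_le_add_right (Finset.sum_le_sum_of_subset (Finset.range_subset_range.2 hv)) _
    _ = _ := upto_V

theorem count_le_mul_dim {n : ℕ} (hs : 0 < s) (hA : ∀ v < F.V, F.A v ≤ n) :
    F.count s p ≤ n * F.dim s := by
  rw [dim, Finset.mul_sum]
  refine Finset.sum_le_sum fun v hv => ?_
  have h1 : cdiv (F.A v) s ≤ n := (cdiv_le_iff hs).2
    ((hA v (Finset.mem_range.1 hv)).trans (Nat.le_mul_of_pos_left _ hs))
  calc _ ≤ ∑ i ∈ Finset.range (cdiv (F.A v) s), cdiv (F.B v) s :=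
        Finset.sum_le_sum fun i _ => cnt_le
    _ = cdiv (F.A v) s * cdiv (F.B v) s := by simp
    _ ≤ n * cdiv (F.B v) s := Nat.mul_le_mul_right _ h1
    _ ≤ _ := Nat.mul_le_mul_left _ (by omega)

end Rects

/-- The state before row `i` of matrix `v` is listed. -/
structure RowState (F : Rects) (t : ℕ) (lo hi : ℝ) (d : ℕ) (s₀ : State) (v i : ℕ) (s : State) :
    Prop where
  keeps : Keeps 20 11 [] [12] s₀ s
  r20 : s.wreg 20 = v
  r21 : s.wreg 21 = cdiv (F.A v) t
  r22 : s.wreg 22 = cdiv (F.B v) t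
  r23 : s.wreg 23 = i
  r24 : s.wreg 24 ≤ cdiv (F.B v) t
  le24 : i < cdiv (F.A v) t → F.rowCount t (fun x => hi ≤ x) v i ≤ s.wreg 24
  r25 : s.wreg 25 ≤ cdiv (F.B v) t
  le25 : i < cdiv (F.A v) t → F.rowCount t (fun x => lo < x) v i ≤ s.wreg 25
  r27 : s.wreg 27 = F.upto t (fun x => hi ≤ x) v i
  r28 : s.wreg 28 = F.upto t (fun x => lo < x ∧ x < hi) v i
  r29 : s.wreg 29 = d
  mem : ∀ r : ℝ → Prop, cnt r (s.rmem 12) (s.wreg 28) =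
    F.upto t (fun x => (lo < x ∧ x < hi) ∧ r x) v i

section enumerate
variable {W n t d v i : ℕ} {F : Rects} {lo hi : ℝ} {s₀ s : State}

/-- The time is stated in terms of the decrease of the two pointers `wreg 24` and `wreg 25`, so that
it can be amortised over the rows. -/
theorem rowBody_spec (hF : Holds W n F s₀) (h5 : s₀.wreg 5 = t) (h8 : s₀.rreg 8 = hi)
    (h9 : s₀.rreg 9 = lo) (ht : 0 < t) (hW : F.V * n + n * F.dim t + 2 ≤ W)
    (hW' : ∀ v < F.V, F.B v + 2 ≤ W) (hv : v < F.V)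
    (hi' : i < cdiv (F.A v) t) (hwf : WF W s) (h : RowState F t lo hi d s₀ v i s) :
    Ht W rowBody s (24 * (s.wreg 24 - F.rowCount t (fun x => hi ≤ x) v i) +
      24 * (s.wreg 25 - F.rowCount t (fun x => lo < x) v i) +
      30 * F.rowCount t (fun x => lo < x ∧ x < hi) v i + 80) fun s' =>
        RowState F t lo hi d s₀ v (i + 1) s' ∧
        s'.wreg 24 = F.rowCount t (fun x => hi ≤ x) v i ∧
        s'.wreg 25 = F.rowCount t (fun x => lo < x) v i := by
  have hiA := (lt_cdiv_iff ht).1 hi'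
  have hAn := hF.A_le v hv
  have hvn : v * n + F.A v ≤ F.V * n := by
    have := Nat.mul_le_mul_right n (Nat.succ_le_of_lt hv)
    rw [Nat.succ_mul] at this
    omega
  have hFs := hF.keep h.keeps (by norm_num) (by simp) (by simp)
  have e5 : s.wreg 5 = t := by rw [h.keeps.wreg 5 (by norm_num), h5]
  have e8 : s.rreg 8 = hi := by rw [h.keeps.rreg 8 (by norm_num), h8]
  have e9 : s.rreg 9 = lo := by rw [h.keeps.rreg 9 (by norm_num), h9]
  have hoff := hFs.off v hv (by omega)
  have hBN : ∀ j < cdiv (F.B v) t, t * j < F.B v := fun j hj => (lt_cdiv_iff ht).1 hj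
  have hanti := Rects.row_anti ht hv hi'
  have hcol : ∀ j < cdiv (F.B v) t,
      F.U v (t * i) + s.rmem 9 (s.wmem 2 (s.wmem 8 v + t * j)) = F.row t v i j := fun j hj => by
    rw [hFs.R v hv (by omega) _ (hBN j hj)]
    rfl
  set q₁ := F.rowCount t (fun x => hi ≤ x) v i with hq₁
  set q₂ := F.rowCount t (fun x => lo < x) v i with hq₂
  have hmid : ∀ r : ℝ → Prop, ∀ f f' : ℕ → ℝ, ∀ m, (∀ x < m, f' x = f x) →
      (∀ e < q₂ - q₁, f' (m + e) = F.row t v i (q₁ + e)) →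
      cnt r f' (m + (q₂ - q₁)) = cnt r f m +
        F.rowCount t (fun x => (lo < x ∧ x < hi) ∧ r x) v i := fun r f f' m h1 h2 =>
    cnt_append hanti hq₁ hq₂ h1 h2
  -- Apply `hmid` to the shifted row itself, with the trivial predicate.
  have hlen : q₂ - q₁ = F.rowCount t (fun x => lo < x ∧ x < hi) v i := by
    have := hmid (fun _ => True) (fun x => F.row t v i (q₁ + x)) (fun x => F.row t v i (q₁ + x)) 0
      (by simp) (by simp)
    rw [cnt_zero, zero_add, zero_add, cnt_true] at this
    simpa only [and_true] using this
  have hlenW : F.upto t (fun x => lo < x ∧ x < hi) v i + (q₂ - q₁) ≤ n * F.dim t := by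
    rw [hlen, ← Rects.upto_succ]
    exact (Rects.upto_le hv hi').trans (Rects.count_le_mul_dim ht hF.A_le)
  have hcW : F.upto t (fun x => hi ≤ x) v i + q₁ ≤ n * F.dim t := by
    rw [hq₁, ← Rects.upto_succ]
    exact (Rects.upto_le hv hi').trans (Rects.count_le_mul_dim ht hF.A_le)
  have hle24 := h.le24 hi'
  have hle25 := h.le25 hi'
  have h24 := h.r24
  have h25 := h.r25
  have hBW := hW' v hv
  have hB : cdiv (F.B v) t ≤ F.B v := (cdiv_le_iff ht).2 (Nat.le_mul_of_pos_left _ ht)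
  -- the row summand
  refine Ht.seq_wp (c' := 24 * (s.wreg 24 - q₁) + 24 * (s.wreg 25 - q₂) +
    30 * F.rowCount t (fun x => lo < x ∧ x < hi) v i + 71)
    (Q := fun s1 => s1 = s.putR 11 (F.U v (t * i))) hwf ?_ ?_
    (by simp [Prog.cost, WExp.cost, RExp.cost]; omega)
  · simp only [Prog.wp, WExp.ok, WExp.val, RExp.ok, RExp.val, h.r20, h.r23, e5, hFs.r0, true_and,
      hFs.U v hv _ hiA, and_true]
    omega
  rintro s1 hwf1 rfl
  -- the first threshold
  refine (shrink_spec (p := s.wreg 24) (q := q₁) hwf1 (by simp) hle24 (by omega)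
    fun x hx hx' => ?_).seq (c' := 24 * (s.wreg 25 - q₂) +
    30 * F.rowCount t (fun x => lo < x ∧ x < hi) v i + 52) ?_ ?_
  · have b1 : t * (x - 1) ≤ W ∧ s.wmem 8 v + t * (x - 1) ≤ W := by
      rcases Nat.eq_zero_or_pos x with rfl | h0
      · simp only [Nat.zero_sub, mul_zero, add_zero, zero_le, true_and]
        omega
      · have := hBN (x - 1) (by omega)
        omega
    have b2 : 1 ≤ W := by omega
    simp only [colExp, Test.ok, Test.val, WExp.ok, WExp.val, RExp.ok, RExp.val, putW_wreg,
      putR_wreg, putW_wmem, putR_wmem, putW_rreg, putR_rreg, putW_rmem, putR_rmem,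
      Nat.reduceEqDiff, if_false, if_true, h.r20, e5, e8, b1, b2, true_and]
    intro h0
    rw [hcol (x - 1) (by omega)]
    have := (cnt_iff_lt (Rects.upper_le hi) hanti (j := x - 1) (by omega)).not
    rw [not_le] at this
    rw [this]
    change ¬ x - 1 < q₁ ↔ q₁ < x
    omega
  · rintro s2 hwf2 rfl
    -- the second threshold
    refine (shrink_spec (p := s.wreg 25) (q := q₂) hwf2 (by simp) hle25 (by omega)
      fun x hx hx' => ?_).seq (c' :=
      30 * F.rowCount t (fun x => lo < x ∧ x < hi) v i + 30) ?_ ?_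
    · have b1 : t * (x - 1) ≤ W ∧ s.wmem 8 v + t * (x - 1) ≤ W := by
        rcases Nat.eq_zero_or_pos x with rfl | h0
        · simp only [Nat.zero_sub, mul_zero, add_zero, zero_le, true_and]
          omega
        · have := hBN (x - 1) (by omega)
          omega
      have b2 : 1 ≤ W := by omega
      simp only [colExp, Test.ok, Test.val, WExp.ok, WExp.val, RExp.ok, RExp.val, putW_wreg,
        putR_wreg, putW_wmem, putR_wmem, putW_rreg, putR_rreg, putW_rmem, putR_rmem,
        Nat.reduceEqDiff, if_false, if_true, h.r20, e5, e9, b1, b2, true_and]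
      intro h0
      rw [hcol (x - 1) (by omega)]
      rw [cnt_iff_lt (Rects.upper_lt lo) hanti (j := x - 1) (by omega)]
      change ¬ x - 1 < q₂ ↔ q₂ < x
      omega
    · rintro s3 hwf3 rfl
      refine Ht.seq_wp (c' := 30 * F.rowCount t (fun x => lo < x ∧ x < hi) v i + 20)
        (Q := fun s4 => s4 = ((((s.putR 11 (F.U v (t * i))).putW 24 q₁).putW 25 q₂).putW 27
          (F.upto t (fun x => hi ≤ x) v i + q₁)).putW 26 q₁) hwf3 ?_ ?_
        (by simp [Prog.cost, WExp.cost]; omega)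
      · simp only [Prog.wp, WExp.ok, WExp.val, putW_wreg, putR_wreg, Nat.reduceEqDiff, if_false,
          if_true, h.r27, true_and, and_true]
        omega
      rintro s4 hwf4 rfl
      refine (appendRow_spec (k₁ := q₁) (k₂ := q₂) (t := t) (off := s.wmem 8 v)
        (u := F.U v (t * i)) (g := F.row t v i) hwf4 (by simp) (by simp) rfl (by simp [e5])
        (by simp [h.r20]) (by simp) (fun j hj => ?_) (fun j hj => ?_) ?_ (by omega)).seq
        (c' := 5) ?_ (by rw [hlen]; omega)
      · simpa using hcol j (by omega)
      · have := hBN j (by omega)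
        omega
      · simp only [putW_wreg, putR_wreg, Nat.reduceEqDiff, if_false, h.r28]
        omega
      rintro s5 hwf5 ⟨hk5, hr5, f28, hl5, hm5⟩
      simp only [putW_wreg, putR_wreg, putW_rmem, putR_rmem, Nat.reduceEqDiff, if_false,
        h.r28] at f28 hl5 hm5
      have hr5' : ∀ i, i ≠ 26 → i ≠ 28 → i ≠ 24 → i ≠ 25 → i ≠ 27 → s5.wreg i = s.wreg i :=
        fun i h1 h2 h3 h4 h5 => by rw [hr5 i h1 h2]; simp [h1, h3, h4, h5]
      have f24 : s5.wreg 24 = q₁ := by rw [hr5 24 (by norm_num) (by norm_num)]; simp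
      have f25 : s5.wreg 25 = q₂ := by rw [hr5 25 (by norm_num) (by norm_num)]; simp
      have f27 : s5.wreg 27 = F.upto t (fun x => hi ≤ x) v i + q₁ := by
        rw [hr5 27 (by norm_num) (by norm_num)]; simp
      have f23 : s5.wreg 23 = i := by rw [hr5' 23 (by simp) (by simp) (by simp) (by simp) (by simp), h.r23]
      refine Ht.of_wp hwf5 ?_ (by simp [Prog.cost, WExp.cost])
      simp only [Prog.wp, WExp.ok, WExp.val, f23, true_and]
      have hAA : i + 1 ≤ F.A v := by
        have := Nat.le_mul_of_pos_left i ht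
        omega
      refine ⟨by omega, ⟨?_, ?_, ?_, ?_, ?_, ?_, fun h1 => ?_, ?_, fun h1 => ?_, ?_, ?_, ?_,
        fun r => ?_⟩, by simp [f24], by simp [f25]⟩
      · refine Keeps.putW (h.keeps.trans (Keeps.trans (s' := ((((s.putR 11 (F.U v (t * i))).putW
          24 q₁).putW 25 q₂).putW 27 (F.upto t (fun x => hi ≤ x) v i + q₁)).putW 26 q₁) ?_
          (hk5.mono le_rfl (by norm_num) (by simp) (by simp)))) (by simp)
        exact ((((Keeps.rfl.putR (by simp)).putW (by simp)).putW (by simp)).putW (by simp)).putW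
          (by simp)
      · simp [hr5' 20, h.r20]
      · simp [hr5' 21, h.r21]
      · simp [hr5' 22, h.r22]
      · simp
      · simp only [putW_wreg, Nat.reduceEqDiff, if_false, f24]; omega
      · simp only [putW_wreg, Nat.reduceEqDiff, if_false, f24]
        exact Rects.rowCount_anti (Rects.upper_le hi) ht hv h1
      · simp only [putW_wreg, Nat.reduceEqDiff, if_false, f25]; omega
      · simp only [putW_wreg, Nat.reduceEqDiff, if_false, f25]
        exact Rects.rowCount_anti (Rects.upper_lt lo) ht hv h1
      · simp only [putW_wreg, Nat.reduceEqDiff, if_false, f27, Rects.upto_succ]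
        rfl
      · simp only [putW_wreg, Nat.reduceEqDiff, if_false, f28, Rects.upto_succ, hlen]
      · simp [hr5' 29, h.r29]
      · simp only [putW_wreg, putW_rmem, Nat.reduceEqDiff, if_false, f28, Rects.upto_succ]
        rw [hmid r (s.rmem 12) _ _ hl5 hm5, ← h.r28, h.mem r]
    · simp only [Test.cost, WExp.cost, RExp.cost, colExp]
      omega
  · simp only [Test.cost, WExp.cost, RExp.cost, colExp]
    omega

end enumerate


/-- Division of `e` by `wreg 5`, rounded up. -/
def cdivExp (e : WExp) : WExp := .div (.sub (.add e (.reg 5)) (.const 1)) (.reg 5)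

/-- List the entries of one coarsened matrix that lie strictly between `rreg 9` and `rreg 8`. -/
def rectBody : Prog :=
  .seq (.seq (.setW 21 (cdivExp (.load 6 (.reg 20)))) (.seq (.setW 22 (cdivExp (.load 9 (.reg 20))))
    (.seq (.setW 29 (.add (.reg 29) (.add (.reg 21) (.reg 22)))) (.seq (.setW 23 (.const 0))
      (.seq (.setW 24 (.reg 22)) (.setW 25 (.reg 22)))))))
  (.seq (.loop (.wlt (.reg 23) (.reg 21)) rowBody) (.setW 20 (.add (.reg 20) (.const 1))))

/-- List the entries of all coarsened matrices strictly between `rreg 9` and `rreg 8` in the array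
`12` and put their number into `wreg 28`, the number of entries that are at least `rreg 8` into
`wreg 27`, and the number of rows and columns into `wreg 29`. -/
def enumerate : Prog :=
  .seq (.seq (.setW 20 (.const 0)) (.seq (.setW 27 (.const 0)) (.seq (.setW 28 (.const 0))
    (.setW 29 (.const 0)))))
  (.loop (.wlt (.reg 20) (.reg 4)) rectBody)

/-- The state before matrix `v` is listed. -/
structure RectState (F : Rects) (t : ℕ) (lo hi : ℝ) (s₀ : State) (v : ℕ) (s : State) : Prop where
  keeps : Keeps 20 11 [] [12] s₀ s
  r20 : s.wreg 20 = v
  r27 : s.wreg 27 = F.upto t (fun x => hi ≤ x) v 0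
  r28 : s.wreg 28 = F.upto t (fun x => lo < x ∧ x < hi) v 0
  r29 : s.wreg 29 = ∑ v' ∈ Finset.range v, (cdiv (F.A v') t + cdiv (F.B v') t)
  mem : ∀ r : ℝ → Prop, cnt r (s.rmem 12) (s.wreg 28) =
    F.upto t (fun x => (lo < x ∧ x < hi) ∧ r x) v 0

section enumerate
variable {W n t v : ℕ} {F : Rects} {lo hi : ℝ} {s₀ s : State}

theorem rectBody_spec (hF : Holds W n F s₀) (h5 : s₀.wreg 5 = t) (h8 : s₀.rreg 8 = hi)
    (h9 : s₀.rreg 9 = lo) (ht : 0 < t) (hW : F.V * n + n * F.dim t + 2 ≤ W) (hn : n + t ≤ W)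
    (hdim : F.dim t ≤ W)
    (hW' : ∀ v < F.V, F.B v + 2 + t ≤ W) (hv : v < F.V) (hwf : WF W s)
    (h : RectState F t lo hi s₀ v s) :
    Ht W rectBody s (100 * (cdiv (F.A v) t + cdiv (F.B v) t) +
      30 * ∑ i ∈ Finset.range (cdiv (F.A v) t), F.rowCount t (fun x => lo < x ∧ x < hi) v i + 60)
      (RectState F t lo hi s₀ (v + 1)) := by
  have hFs := hF.keep h.keeps (by norm_num) (by simp) (by simp)
  have e5 : s.wreg 5 = t := by rw [h.keeps.wreg 5 (by norm_num), h5]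
  have hAn := hF.A_le v hv
  have hBW := hW' v hv
  set cA := cdiv (F.A v) t with hcA
  set cB := cdiv (F.B v) t with hcB
  set d := ∑ v' ∈ Finset.range v, (cdiv (F.A v') t + cdiv (F.B v') t) + (cA + cB) with hd
  have hdW : d ≤ W := by
    refine le_trans ?_ hdim
    rw [hd, ← Finset.sum_range_succ (fun v' => cdiv (F.A v') t + cdiv (F.B v') t)]
    exact Finset.sum_le_sum_of_subset (Finset.range_subset_range.2 hv)
  refine Ht.seq_wp (c' := 100 * (cA + cB) +
    30 * ∑ i ∈ Finset.range cA, F.rowCount t (fun x => lo < x ∧ x < hi) v i + 20)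
    (Q := RowState F t lo hi d s₀ v 0) hwf ?_ ?_
    (by simp [Prog.cost, WExp.cost, cdivExp]; omega)
  · have b0 : 1 ≤ W := by omega
    have b1 : F.A v + t ≤ W := by omega
    have b2 : F.B v + t ≤ W := by omega
    have b3 : cA + cB ≤ W := by omega
    have hcA' : (F.A v + t - 1) / t = cA := rfl
    have hcB' : (F.B v + t - 1) / t = cB := rfl
    simp only [cdivExp, Prog.wp, WExp.ok, WExp.val, putW_wreg, putW_wmem, h.r20, e5, hFs.A v hv,
      hFs.B v hv, Nat.reduceEqDiff, if_false, if_true, true_and, and_true, b0, b1, b2, b3, hcA',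
      hcB', h.r29, zero_le]
    refine ⟨hdW, ?_, ?_, ?_, ?_, ?_, ?_, ?_, ?_, ?_, ?_, ?_, ?_, ?_⟩
    · exact (((((h.keeps.putW (by simp)).putW (by simp)).putW (by simp)).putW (by simp)).putW
        (by simp)).putW (by simp)
    · simp [h.r20]
    · simp [hcA]
    · simp [hcB]
    · simp
    · simp [hcB]
    · intro _
      simp only [putW_wreg, Nat.reduceEqDiff, if_false, if_true]
      exact cnt_le
    · simp [hcB]
    · intro _
      simp only [putW_wreg, Nat.reduceEqDiff, if_false, if_true]
      exact cnt_le
    · simp [h.r27]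
    · simp [h.r28]
    · simp [hd]
    · simpa using h.mem
  rintro s1 hwf1 h1
  refine Ht.seq (c := 100 * (cA + cB) +
    30 * ∑ i ∈ Finset.range cA, F.rowCount t (fun x => lo < x ∧ x < hi) v i + 10) (c' := 5)
    (Q := RowState F t lo hi d s₀ v cA) ?_ ?_ (by omega)
  -- Both pointers start at `cB` and never increase, so their moves over all rows are paid by the
  -- potential they hold at the start.
  · refine Ht.loop (fun s => ∃ i ≤ cA, RowState F t lo hi d s₀ v i s)
      (fun s => 100 * (cA - s.wreg 23) + 24 * s.wreg 24 + 24 * s.wreg 25 +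
        30 * ∑ i ∈ Finset.Ico (s.wreg 23) cA, F.rowCount t (fun x => lo < x ∧ x < hi) v i) hwf1
      ⟨0, zero_le, h1⟩ ?_ ?_ ?_ ?_
    · intro s _ _
      simp [Test.ok, WExp.ok]
    · rintro s2 hwf2 ⟨i, -, h2⟩ hb
      simp only [Test.val, WExp.val, h2.r23, h2.r21] at hb
      refine ⟨_, (rowBody_spec hF h5 h8 h9 ht hW (fun v hv => by have := hW' v hv; omega) hv hb
        hwf2 h2).mono le_rfl ?_⟩
      rintro s3 - ⟨h3, f24, f25⟩
      refine ⟨⟨i + 1, hb, h3⟩, ?_⟩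
      have g1 := h2.le24 hb
      have g2 := h2.le25 hb
      have hb' : i < cA := hb
      simp only [h3.r23, h2.r23, f24, f25, Test.cost, WExp.cost]
      rw [Finset.sum_eq_sum_Ico_succ_bot hb']
      omega
    · rintro s2 - ⟨i, hi', h2⟩ hb
      simp only [Test.val, WExp.val, h2.r23, h2.r21] at hb
      obtain rfl : i = cA := le_antisymm hi' (not_lt.1 hb)
      exact h2
    · have g1 := h1.r24
      have g2 := h1.r25
      rw [h1.r23, ← Finset.range_eq_Ico]
      simp only [Test.cost, WExp.cost]
      omega
  · rintro s2 hwf2 h2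
    refine Ht.of_wp hwf2 ?_ (by simp [Prog.cost, WExp.cost])
    have hv1 : v + 1 ≤ W := by
      have hn0 : F.V ≤ W := by
        have := hFs.r4
        rw [← this]
        exact hwf.wreg 4
      omega
    simp only [Prog.wp, WExp.ok, WExp.val, h2.r20, true_and]
    refine ⟨⟨by omega, hv1⟩, h2.keeps.putW (by simp), by simp, ?_, ?_, ?_, fun r => ?_⟩
    · simp only [putW_wreg, Nat.reduceEqDiff, if_false, h2.r27, Rects.upto_next, hcA]
    · simp only [putW_wreg, Nat.reduceEqDiff, if_false, h2.r28, Rects.upto_next, hcA]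
    · simp only [putW_wreg, Nat.reduceEqDiff, if_false, h2.r29, Finset.sum_range_succ, hd, hcA, hcB]
    · rw [Rects.upto_next]
      exact h2.mem r

theorem enumerate_spec (hF : Holds W n F s₀) (h5 : s₀.wreg 5 = t) (h8 : s₀.rreg 8 = hi)
    (h9 : s₀.rreg 9 = lo) (ht : 0 < t) (hW : F.V * n + n * F.dim t + 2 ≤ W) (hn : n + t ≤ W)
    (hdim : F.dim t ≤ W) (hW' : ∀ v < F.V, F.B v + 2 + t ≤ W) (hwf : WF W s₀) :
    Ht W enumerate s₀ (100 * F.dim t + 30 * F.count t (fun x => lo < x ∧ x < hi) + 70 * F.V + 20)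
      fun s => Keeps 20 11 [] [12] s₀ s ∧ s.wreg 27 = F.count t (fun x => hi ≤ x) ∧
        s.wreg 28 = F.count t (fun x => lo < x ∧ x < hi) ∧ s.wreg 29 = F.dim t ∧
        ∀ r : ℝ → Prop, cnt r (s.rmem 12) (s.wreg 28) =
          F.count t fun x => (lo < x ∧ x < hi) ∧ r x := by
  refine Ht.seq_wp (c' := 100 * F.dim t + 30 * F.count t (fun x => lo < x ∧ x < hi) + 70 * F.V + 10)
    (Q := RectState F t lo hi s₀ 0) hwf ?_ ?_ (by simp [Prog.cost, WExp.cost]; omega)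
  · simp only [Prog.wp, WExp.ok, WExp.val, zero_le, true_and]
    refine ⟨(((Keeps.rfl.putW (by simp)).putW (by simp)).putW (by simp)).putW (by simp), ?_, ?_,
      ?_, ?_, ?_⟩ <;> simp [Rects.upto, cnt_zero]
  rintro s1 hwf1 h1
  refine Ht.loop_count (fun v s => v ≤ F.V ∧ RectState F t lo hi s₀ v s) F.V
    (fun v => 100 * (cdiv (F.A v) t + cdiv (F.B v) t) +
      30 * ∑ i ∈ Finset.range (cdiv (F.A v) t), F.rowCount t (fun x => lo < x ∧ x < hi) v i + 60)
    hwf1 ⟨zero_le, h1⟩ ?_ ?_ ?_ ?_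
  · rintro v s - ⟨-, h⟩
    simp [Test.ok, Test.val, WExp.ok, WExp.val, h.r20, h.keeps.wreg 4, hF.r4]
  · rintro v s hv hwfs ⟨-, h⟩
    exact (rectBody_spec hF h5 h8 h9 ht hW hn hdim hW' hv hwfs h).mono le_rfl
      fun s' _ h' => ⟨hv, h'⟩
  · rintro s - ⟨-, h⟩
    refine ⟨h.keeps, ?_, ?_, h.r29, fun r => ?_⟩
    · rw [h.r27, Rects.upto_V]
    · rw [h.r28, Rects.upto_V]
    · rw [h.mem, Rects.upto_V]
  · simp only [Finset.sum_add_distrib, ← Finset.mul_sum, Finset.sum_const, Finset.card_range,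
      smul_eq_mul, Test.cost, WExp.cost]
    have e1 : F.dim t = ∑ v ∈ Finset.range F.V, cdiv (F.A v) t +
      ∑ v ∈ Finset.range F.V, cdiv (F.B v) t := Finset.sum_add_distrib
    have e2 : F.count t (fun x => lo < x ∧ x < hi) = ∑ v ∈ Finset.range F.V,
      ∑ i ∈ Finset.range (cdiv (F.A v) t), F.rowCount t (fun x => lo < x ∧ x < hi) v i := rfl
    omega

end enumerate


/-! ### Successive refinement -/

/-- Copy the `wreg 28` elements of the array `12` to the array `11`. -/
def copyMid : Prog :=
  .seq (.setW 31 (.const 0)) (.seq (.loop (.wlt (.reg 31) (.reg 28))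
    (.seq (.storeR 11 (.reg 31) (.load 12 (.reg 31))) (.setW 31 (.add (.reg 31) (.const 1)))))
    (.setW 40 (.reg 28)))

/-- The `wreg 30`-th largest coarsened entry, clamped to `[rreg 9, rreg 8]`. -/
def clampSelect (ρ : ℕ) : Prog :=
  .cond (.wlt (.reg 27) (.reg 30))
    (.cond (.wlt (.add (.reg 27) (.reg 28)) (.reg 30)) (.setR ρ (.reg 9))
      (.seq copyMid (.seq (.setW 41 (.sub (.reg 30) (.reg 27))) (.seq select (.setR ρ (.reg 90))))))
    (.setR ρ (.reg 8))

theorem copyMid_spec {W m : ℕ} {s₀ : State} (hwf : WF W s₀) (h28 : s₀.wreg 28 = m)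
    (hW : m + 1 ≤ W) : Ht W copyMid s₀ (20 * m + 20) fun s => Keeps 31 100 [] [11] s₀ s ∧
      s.wreg 40 = m ∧ ∀ e < m, s.rmem 11 e = s₀.rmem 12 e := by
  refine Ht.seq_wp (c' := 20 * m + 15) (Q := fun s => s = s₀.putW 31 0) hwf
    (by simp [Prog.wp, WExp.ok, WExp.val]) ?_ (by simp [Prog.cost, WExp.cost]; omega)
  rintro s hs rfl
  refine Ht.seq (c := 20 * m + 10) (c' := 5) (Q := fun s => Keeps 31 100 [] [11] s₀ s ∧
    ∀ e < m, s.rmem 11 e = s₀.rmem 12 e) ?_ ?_ (by omega)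
  · refine Ht.loop_count (fun j s => Keeps 31 100 [] [11] s₀ s ∧ s.wreg 31 = j ∧
      ∀ e < j, s.rmem 11 e = s₀.rmem 12 e) m (fun _ => 10) hs
      ⟨Keeps.rfl.putW (by simp), by simp, by simp⟩ ?_ ?_ ?_ ?_
    · rintro j s - ⟨hk, hj, -⟩
      simp [Test.ok, Test.val, WExp.ok, WExp.val, hj, hk.wreg 28, h28]
    · rintro j s hj hs ⟨hk, h31, hm⟩
      refine Ht.of_wp hs ?_ (by simp [Prog.cost, WExp.cost, RExp.cost])
      have h1 : 1 ≤ W := by omega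
      have h2 : j + 1 ≤ W := by omega
      simp only [Prog.wp, WExp.ok, WExp.val, RExp.ok, RExp.val, h31, putRM_wreg, true_and, h1, h2]
      refine ⟨(hk.putRM (by simp)).putW (by simp), by simp, fun e he => ?_⟩
      simp only [putW_rmem, putRM_rmem, if_true, Function.update_apply, hk.rmem 12 (by simp)]
      split_ifs with he'
      · rw [he']
      · exact hm e (by omega)
    · rintro s - ⟨hk, -, hm⟩
      exact ⟨hk, hm⟩
    · simp [Test.cost, WExp.cost]
      omega
  · rintro s hs ⟨hk, hm⟩
    refine Ht.of_wp hs ?_ (by simp [Prog.cost, WExp.cost])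
    simp only [Prog.wp, WExp.ok, WExp.val, true_and, hk.wreg 28 (by norm_num), h28]
    exact ⟨hk.putW (by simp), by simp, hm⟩

theorem clampSelect_spec {W m c j ρ : ℕ} {s₀ : State} (hwf : WF W s₀) (h28 : s₀.wreg 28 = m)
    (h27 : s₀.wreg 27 = c) (h30 : s₀.wreg 30 = j) (hρ : ρ < 90) (hW : 20 * m + 100 ≤ W)
    (hcm : c + m ≤ W) :
    Ht W (clampSelect ρ) s₀ (6020 * m + 100) fun s => Keeps 31 ρ [7] [11] s₀ s ∧
      Rects.Clamped (s₀.rmem 12) m c j (s₀.rreg 9) (s₀.rreg 8) (s.rreg ρ) := by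
  have hok : ∀ s : State, s.wreg 27 + s.wreg 28 ≤ W →
      (Test.wlt (.add (.reg 27) (.reg 28)) (.reg 30)).ok W s := by
    intro s h
    simpa [Test.ok, WExp.ok, WExp.val] using h
  refine Ht.cond (c := 6020 * m + 95) hwf (by simp [Test.ok, WExp.ok]) (fun h1 => ?_) (fun h1 => ?_)
    (by simp [Test.cost, WExp.cost]; omega)
  · simp only [Test.val, WExp.val, h27, h30] at h1
    refine Ht.cond (c := 6020 * m + 80) hwf (hok _ (by omega)) (fun h2 => ?_) (fun h2 => ?_)
      (by simp [Test.cost, WExp.cost]; omega)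
    · simp only [Test.val, WExp.val, h27, h28, h30] at h2
      refine Ht.of_wp hwf ?_ (by simp [Prog.cost, WExp.cost, RExp.cost])
      simp only [Prog.wp, RExp.ok, RExp.val, true_and]
      exact ⟨Keeps.rfl.putR le_rfl, Or.inr (Or.inr ⟨h2, by simp⟩)⟩
    · simp only [Test.val, WExp.val, h27, h28, h30] at h2
      refine (copyMid_spec hwf h28 (by omega)).seq (c' := 6000 * m + 30) ?_ (by omega)
      rintro s1 hwf1 ⟨hk1, f40, hm1⟩
      refine Ht.seq_wp (c' := 6000 * m + 20) (Q := fun s => s = s1.putW 41 (j - c)) hwf1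
        (by simp [Prog.wp, WExp.ok, WExp.val, hk1.wreg, h30, h27]) ?_
        (by simp [Prog.cost, WExp.cost]; omega)
      rintro s2 hwf2 rfl
      refine (select_spec (m := m) (q := j - c) hwf2 (by simpa using f40) (by simp) (by omega)
        (by omega) hW).seq (c' := 5) ?_ (by omega)
      rintro s3 hwf3 ⟨hk3, h3⟩
      refine Ht.of_wp hwf3 ?_ (by simp [Prog.cost, WExp.cost, RExp.cost])
      simp only [Prog.wp, RExp.ok, RExp.val, true_and]
      refine ⟨?_, Or.inr (Or.inl ⟨h1, by omega, ?_⟩)⟩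
      · refine Keeps.putR (((hk1.mono le_rfl (by omega) (by simp) (by simp)).trans
          (Keeps.rfl.putW (i := 41) (by simp))).trans (hk3.mono (by norm_num) (by omega) (by simp)
          (by simp))) le_rfl
      · simp only [putW_rmem] at h3
        simp only [putR_rreg, if_true]
        have e : ∀ p : ℝ → Prop, cnt p (s1.rmem 11) m = cnt p (s₀.rmem 12) m := fun p =>
          cnt_congr fun e he => by rw [hm1 e he]
        rw [IsKth, e, e] at h3
        exact h3
  · simp only [Test.val, WExp.val, h27, h30] at h1
    refine Ht.of_wp hwf ?_ (by simp [Prog.cost, WExp.cost, RExp.cost])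
    simp only [Prog.wp, RExp.ok, RExp.val, true_and]
    exact ⟨Keeps.rfl.putR le_rfl, Or.inl ⟨by omega, by simp⟩⟩

/-- Narrow the interval `[rreg 9, rreg 8]` by means of every `wreg 5`-th row and column, and halve
`wreg 5`. -/
def levelBody : Prog :=
  .seq enumerate (.seq (.setW 30 (.div (.sub (.add (.reg 1) (.mul (.reg 5) (.reg 5))) (.const 1))
      (.mul (.reg 5) (.reg 5))))
    (.seq (clampSelect 12) (.seq (.setW 30 (.add (.reg 30) (.reg 29)))
      (.seq (clampSelect 13) (.seq (.setR 8 (.reg 12)) (.seq (.setR 9 (.reg 13))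
        (.setW 5 (.div (.reg 5) (.const 2)))))))))

/-- The state before a refinement step. -/
structure LevelState (F : Rects) (t : ℕ) (z : ℝ) (s₀ s : State) : Prop where
  keeps : Keeps 5 8 [7] [11, 12] s₀ s
  r5 : s.wreg 5 = t
  lo_le : s.rreg 9 ≤ z
  le_hi : z ≤ s.rreg 8
  mid : F.count t (fun x => s.rreg 9 < x ∧ x < s.rreg 8) ≤ 9 * F.dim t

/-- By `LevelState.mid` at most `9 * F.dim t` entries are listed. Two selections at about `6020`
steps per entry, together with the listing, stay below `120000 * F.dim t`. -/
theorem levelBody_spec {W n t k H : ℕ} {F : Rects} {z : ℝ} {s₀ s : State} (hF : Holds W n F s₀)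
    (h1 : s₀.wreg 1 = k) (hz : F.IsAnswer k z) (ht : 0 < t) (htH : t ≤ 2 ^ H)
    (hW : (n + 190) * F.dim 1 + F.V * n + k + 2 ^ H * 2 ^ H + 2 ^ H + n + 100 ≤ W)
    (hW' : ∀ v < F.V, F.B v + 2 + 2 ^ H ≤ W) (hwf : WF W s) (h : LevelState F t z s₀ s) :
    Ht W levelBody s (120000 * F.dim t + 70 * F.V + 400) fun s' =>
      Keeps 5 8 [7] [11, 12] s₀ s' ∧ s'.wreg 5 = t / 2 ∧
      s'.rreg 9 ≤ z ∧ z ≤ s'.rreg 8 ∧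
      cdiv k (t * t) ≤ F.count t (fun x => s'.rreg 8 ≤ x) ∧
      F.count t (fun x => s'.rreg 9 < x) < cdiv k (t * t) + F.dim t := by
  have hD : F.dim t ≤ F.dim 1 := Rects.dim_anti one_pos ht
  have hFs := hF.keep h.keeps le_rfl (by simp) (by simp)
  have hnD := Nat.mul_le_mul_left n hD
  have hexp : (n + 190) * F.dim 1 = n * F.dim 1 + 190 * F.dim 1 := by ring
  have htt : t * t ≤ 2 ^ H * 2 ^ H := Nat.mul_le_mul htH htH
  have hmid := h.mid
  refine (enumerate_spec hFs h.r5 rfl rfl ht (by omega) (by omega) (by omega)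
    (fun v hv => by have := hW' v hv; omega) hwf).seq
    (c' := 115000 * F.dim t + 320) ?_ (by omega)
  rintro s1 hwf1 ⟨hk1, e27, e28, e29, hm⟩
  set lo := s.rreg 9
  set hi := s.rreg 8
  have hc : F.count t (fun x => hi ≤ x) ≤ n * F.dim t := Rects.count_le_mul_dim ht hF.A_le
  have e1 : s1.wreg 1 = k := by rw [hk1.wreg 1 (by norm_num), h.keeps.wreg 1 (by norm_num), h1]
  have e5 : s1.wreg 5 = t := by rw [hk1.wreg 5 (by norm_num), h.r5]
  have ett : 0 < t * t := Nat.mul_pos ht ht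
  have hck : cdiv k (t * t) ≤ k := (cdiv_le_iff ett).2 (Nat.le_mul_of_pos_left _ ett)
  refine Ht.seq_wp (c' := 115000 * F.dim t + 300) (Q := fun s2 => s2 = s1.putW 30 (cdiv k (t * t)))
    hwf1 ?_ ?_ (by simp [Prog.cost, WExp.cost]; omega)
  · simp only [Prog.wp, WExp.ok, WExp.val, e1, e5, true_and]
    refine ⟨by omega, rfl⟩
  rintro s2 hwf2 rfl
  refine (clampSelect_spec (ρ := 12) (j := cdiv k (t * t)) hwf2 rfl rfl (by simp) (by norm_num)
    (by simp [e28]; omega) (by simp [e27, e28]; omega)).seq (c' := 60000 * F.dim t + 150) ?_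
    (by simp [e28]; omega)
  rintro s3 hwf3 ⟨hk3, hcl3⟩
  simp only [putW_wreg, putW_rreg, putW_rmem, Nat.reduceEqDiff, if_false] at hcl3
  have f : ∀ i < 31, i ≠ 30 → s3.wreg i = s1.wreg i := fun i hi hi' => by
    rw [hk3.wreg i hi]; simp [hi']
  refine Ht.seq_wp (c' := 60000 * F.dim t + 140)
    (Q := fun s4 => s4 = s3.putW 30 (cdiv k (t * t) + F.dim t)) hwf3 ?_ ?_
    (by simp [Prog.cost, WExp.cost]; omega)
  · simp only [Prog.wp, WExp.ok, WExp.val, hk3.wreg 30 (by norm_num), putW_wreg, if_true,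
      f 29 (by norm_num) (by norm_num), e29, true_and, and_true]
    omega
  rintro s4 hwf4 rfl
  have g27 : (s3.putW 30 (cdiv k (t * t) + F.dim t)).wreg 27 = s1.wreg 27 := by simp [f]
  have g28 : (s3.putW 30 (cdiv k (t * t) + F.dim t)).wreg 28 = s1.wreg 28 := by simp [f]
  refine (clampSelect_spec (ρ := 13) (j := cdiv k (t * t) + F.dim t) hwf4 g28 g27 (by simp)
    (by norm_num) (by simp [e28]; omega) (by simp [e27, e28]; omega)).seq (c' := 15) ?_
    (by simp [e28]; omega)
  rintro s5 hwf5 ⟨hk5, hcl5⟩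
  simp only [putW_rreg, putW_rmem, hk3.rmem 12 (by simp), hk3.rreg 9 (by norm_num),
    hk3.rreg 8 (by norm_num)] at hcl5
  have r9 : s1.rreg 9 = lo := hk1.rreg 9 (by norm_num)
  have r8 : s1.rreg 8 = hi := hk1.rreg 8 (by norm_num)
  rw [r9, r8] at hcl3 hcl5
  have n1 := hz.narrow_hi ht h.lo_le h.le_hi hm e27 hcl3
  have n2 := hz.narrow_lo ht h.lo_le h.le_hi hm e27 hcl5
  refine Ht.of_wp hwf5 ?_ (by simp [Prog.cost, WExp.cost, RExp.cost])
  have b2 : 2 ≤ W := by omega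
  simp only [Prog.wp, WExp.ok, WExp.val, RExp.ok, RExp.val, putR_rreg, putR_wreg, true_and, b2,
    Nat.reduceEqDiff, if_false, hk5.wreg 5 (by norm_num), hk5.rreg 12 (by norm_num), putW_rreg]
  refine ⟨?_, by simp [f, e5], ?_⟩
  · refine Keeps.putW (Keeps.putR (Keeps.putR ?_ le_rfl) (by norm_num)) le_rfl
    refine (((h.keeps.trans (hk1.mono (by norm_num) (by norm_num) (by simp) (by simp))).trans
      (Keeps.rfl.putW (i := 30) (by simp))).trans
      (hk3.mono (by norm_num) (by norm_num) (by simp) (by simp))).trans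
      ((Keeps.rfl.putW (i := 30) (by simp)).trans
      (hk5.mono (by norm_num) (by norm_num) (by simp) (by simp)))
  · simp only [putW_rreg, putR_rreg, Nat.reduceEqDiff, if_false, if_true]
    exact ⟨n2.1, n1.1, n1.2, n2.2⟩

/-- Refine until the interval consists of the answer. -/
def levels : Prog := .loop (.wlt (.const 0) (.reg 5)) levelBody

theorem levels_spec {W n k H : ℕ} {F : Rects} {z : ℝ} {s₀ : State} (hF : Holds W n F s₀)
    (h1 : s₀.wreg 1 = k) (h5 : s₀.wreg 5 = 2 ^ H) (hz : F.IsAnswer k z)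
    (hlo : s₀.rreg 9 ≤ z) (hhi : z ≤ s₀.rreg 8) (hA : ∀ v < F.V, F.A v ≤ 2 ^ H)
    (hW : (n + 190) * F.dim 1 + F.V * n + k + 2 ^ H * 2 ^ H + 2 ^ H + n + 100 ≤ W)
    (hW' : ∀ v < F.V, F.B v + 2 + 2 ^ H ≤ W) (hwf : WF W s₀) :
    Ht W levels s₀ (120000 * ∑ c ∈ Finset.range (H + 1), F.dim (2 ^ c) +
      (H + 1) * (70 * F.V + 410) + 10) fun s => s.rreg 8 = z := by
  refine Ht.loop_count (fun j s => j ≤ H + 1 ∧ (j ≤ H → LevelState F (2 ^ (H - j)) z s₀ s) ∧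
    (H < j → s.wreg 5 = 0 ∧ s.rreg 8 = z)) (H + 1)
    (fun j => 120000 * F.dim (2 ^ (H - j)) + 70 * F.V + 400) hwf ⟨zero_le, fun _ => ?_, by simp⟩
    ?_ ?_ ?_ ?_
  -- At stride `2 ^ H` every matrix has at most one row, so the bound on the listed entries holds
  -- for any interval.
  · exact ⟨Keeps.rfl, h5, hlo, hhi, (Rects.count_le_dim (by positivity) hA).trans (Nat.le_mul_of_pos_left _ (by norm_num))⟩
  · rintro j s - ⟨hj, h2, h3⟩
    simp only [Test.ok, Test.val, WExp.ok, WExp.val, zero_le, true_and]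
    rcases Nat.lt_or_ge H j with hlt | hle
    · rw [(h3 hlt).1]
      omega
    · rw [(h2 hle).r5]
      have : 0 < 2 ^ (H - j) := by positivity
      omega
  · rintro j s hj hs ⟨-, h2, -⟩
    have h2 := h2 (by omega)
    refine (levelBody_spec hF h1 hz (by positivity) (Nat.pow_le_pow_right two_pos (Nat.sub_le H j))
      hW hW' hs h2).mono le_rfl ?_
    rintro s' - ⟨hk, e5, hlo, hhi, hc1, hc2⟩
    refine ⟨hj, fun hj' => ?_, fun hj' => ?_⟩
    · have e : 2 ^ (H - j) = 2 ^ (H - (j + 1)) * 2 := by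
        rw [← pow_succ]
        congr 1
        omega
      refine ⟨hk, by rw [e5, e, Nat.mul_div_cancel _ two_pos], hlo, hhi, ?_⟩
      rw [e] at hc1 hc2
      exact Rects.mid_le (by positivity) hc1 hc2
    · obtain rfl : j = H := by omega
      simp only [Nat.sub_self, pow_zero, mul_one, cdiv_one] at hc1 e5
      -- At stride `1` the coarse counts are exact, so the upper end has rank `k`; halving the
      -- stride then gives `0` and ends the loop.
      exact ⟨by simpa using e5, hz.unique hhi hc1⟩
  · rintro s - ⟨-, -, h3⟩
    exact (h3 (by omega)).2
  · have e := Finset.sum_range_reflect (fun c => F.dim (2 ^ c)) (H + 1)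
    simp only [Nat.add_sub_cancel] at e
    simp only [Finset.sum_add_distrib, ← Finset.mul_sum, Finset.sum_const, Finset.card_range,
      smul_eq_mul, Test.cost, WExp.cost]
    rw [← e]
    ring_nf
    omega


/-! ### Canonical decomposition of intervals -/

/-- The canonical nodes of the interval `[l, r)` of nodes in a heap-ordered binary tree, computed
in at most `d` rounds. -/
def canon : ℕ → ℕ → ℕ → List ℕ
  | 0, _, _ => []
  | d + 1, l, r => if l < r then
      (if l / 2 * 2 < l then [l] else []) ++ ((if r / 2 * 2 < r then [r - 1] else []) ++
        canon d ((l + 1) / 2) (r / 2)) else []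

theorem canon_of_le {d l r : ℕ} (h : r ≤ l) : canon d l r = [] := by
  cases d with
  | zero => rfl
  | succ d => exact if_neg (by omega)

theorem length_canon_le (d l r : ℕ) : (canon d l r).length ≤ 2 * d := by
  induction d generalizing l r with
  | zero => simp [canon]
  | succ d ih =>
    have := ih ((l + 1) / 2) (r / 2)
    rw [canon]
    split_ifs <;> simp <;> omega

/-- A round splits off `l` if it is odd and `r - 1` if `r` is odd. What is left consists of complete
pairs of siblings, which are replaced by their parents. The length at least halves, so `d` rounds
suffice for a length below `2 ^ d`. -/
theorem canon_sum {g : ℕ → ℕ} {N : ℕ} (hg : ∀ v, 1 ≤ v → v < N → g v = g (2 * v) + g (2 * v + 1))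
    {d l r : ℕ} (hl : 1 ≤ l) (hr : r ≤ 2 * N) (hd : r - l < 2 ^ d) :
    ((canon d l r).map g).sum = ∑ x ∈ Finset.Ico l r, g x := by
  induction d generalizing l r with
  | zero => rw [Finset.Ico_eq_empty (by simp at hd; omega)]; simp [canon]
  | succ d ih =>
    rw [canon]
    split_ifs with h h1 h2 h2
    all_goals try (rw [Finset.Ico_eq_empty h]; rfl)
    all_goals
      have key : ∑ x ∈ Finset.Ico ((l + 1) / 2) (r / 2), g x =
          ∑ x ∈ Finset.Ico (2 * ((l + 1) / 2)) (2 * (r / 2)), g x := by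
        obtain ⟨M, hM⟩ | hM : (∃ M, r / 2 = (l + 1) / 2 + M) ∨ r / 2 < (l + 1) / 2 := by
          rcases Nat.lt_or_ge (r / 2) ((l + 1) / 2) with h' | h'
          · exact Or.inr h'
          · exact Or.inl ⟨_, (Nat.add_sub_cancel' h').symm⟩
        · have hb : (l + 1) / 2 + M ≤ N := by omega
          have ha : 1 ≤ (l + 1) / 2 := by omega
          rw [hM]
          clear hM
          generalize (l + 1) / 2 = a at *
          induction M with
          | zero => simp
          | succ M ihM =>
            rw [← Nat.add_assoc, Finset.sum_Ico_succ_top (by omega), ihM (by omega),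
              hg _ (by omega) (by omega), Nat.mul_succ, Finset.sum_Ico_succ_top (by omega),
              Finset.sum_Ico_succ_top (by omega)]
            ring
        · rw [Finset.Ico_eq_empty (by omega), Finset.Ico_eq_empty (by omega)]
      have ih' := ih (l := (l + 1) / 2) (r := r / 2) (by omega) (by omega)
        (by rw [pow_succ] at hd; omega)
      simp only [List.map_append, List.sum_append, ih', key, List.map_cons, List.map_nil,
        List.sum_cons, List.sum_nil]
    · rw [show 2 * ((l + 1) / 2) = l + 1 by omega, Finset.sum_eq_sum_Ico_succ_bot h]
      obtain ⟨r', rfl⟩ : ∃ r', r = r' + 1 := ⟨r - 1, by omega⟩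
      rw [show 2 * ((r' + 1) / 2) = r' by omega, Finset.sum_Ico_succ_top (by omega)]
      simp; ring
    · rw [show 2 * ((l + 1) / 2) = l + 1 by omega, Finset.sum_eq_sum_Ico_succ_bot h,
        show 2 * (r / 2) = r by omega]
      simp
    · rw [show 2 * ((l + 1) / 2) = l by omega]
      obtain ⟨r', rfl⟩ : ∃ r', r = r' + 1 := ⟨r - 1, by omega⟩
      rw [show 2 * ((r' + 1) / 2) = r' by omega, Finset.sum_Ico_succ_top (by omega)]
      simp; ring
    · rw [show 2 * ((l + 1) / 2) = l by omega, show 2 * (r / 2) = r by omega]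
      simp

/-! ### Heights and leaf blocks in the heap-ordered tree. -/

/-- The height of a node in a tree with leaves `2 ^ H, …, 2 ^ (H + 1) - 1`. -/
def ht (H v : ℕ) : ℕ := H + 1 - Nat.size v

theorem size_half {v : ℕ} (hv : 1 ≤ v) : Nat.size v = Nat.size (v / 2) + 1 := by
  refine le_antisymm ?_ ?_
  · rw [Nat.size_le, pow_succ]
    have := Nat.lt_size_self (v / 2)
    omega
  · rw [Nat.succ_le_iff, Nat.lt_size]
    rcases Nat.eq_zero_or_pos (v / 2) with h | h
    · simp [h]; omega
    · obtain ⟨m, hm⟩ : ∃ m, (v / 2).size = m + 1 :=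
        ⟨(v / 2).size - 1, by have := Nat.size_pos.2 h; omega⟩
      rw [hm, pow_succ]
      have : 2 ^ m ≤ v / 2 := by rw [← Nat.lt_size, hm]; omega
      omega

theorem ht_double {H v : ℕ} (hv : 1 ≤ v) (hvH : v < 2 ^ H) :
    ht H v = ht H (2 * v) + 1 ∧ ht H v = ht H (2 * v + 1) + 1 := by
  have h1 := Nat.size_le.2 hvH
  rw [ht, ht, ht, size_half (v := 2 * v) (by omega), size_half (v := 2 * v + 1) (by omega),
    show 2 * v / 2 = v by omega, show (2 * v + 1) / 2 = v by omega]
  omega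

theorem ht_leaf {H v : ℕ} (h : 2 ^ H ≤ v) : ht H v = 0 := by
  have := Nat.lt_size.2 h
  rw [ht]
  omega

theorem ht_le {H v : ℕ} (hv : 1 ≤ v) : ht H v ≤ H := by
  have := Nat.size_pos.2 hv
  rw [ht]
  omega

/-- The block of leaves below a node. -/
def leaves (H v : ℕ) : Finset ℕ := Finset.Ico (v * 2 ^ ht H v) ((v + 1) * 2 ^ ht H v)

theorem sum_leaves (φ : ℕ → ℕ) {H v : ℕ} (hv : 1 ≤ v) (hvH : v < 2 ^ H) :
    ∑ x ∈ leaves H v, φ x = ∑ x ∈ leaves H (2 * v), φ x + ∑ x ∈ leaves H (2 * v + 1), φ x := by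
  obtain ⟨h1, h2⟩ := ht_double hv hvH
  have e : ht H (2 * v + 1) = ht H (2 * v) := by omega
  rw [leaves, leaves, leaves, e, h1, pow_succ]
  generalize 2 ^ ht H (2 * v) = w
  rw [Finset.sum_Ico_consecutive _ (Nat.mul_le_mul_right _ (Nat.le_succ _))
    (Nat.mul_le_mul_right _ (Nat.le_succ _))]
  rw [show v * (w * 2) = 2 * v * w by ring, show (v + 1) * (w * 2) = (2 * v + 1 + 1) * w by ring]

theorem canon_sum_leaves (φ : ℕ → ℕ) {H l r : ℕ} (hr : r ≤ 2 ^ H) :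
    ((canon (H + 1) (l + 2 ^ H) (r + 2 ^ H)).map fun v => ∑ x ∈ leaves H v, φ x).sum =
      ∑ x ∈ Finset.Ico (l + 2 ^ H) (r + 2 ^ H), φ x := by
  have hp : 0 < 2 ^ H := by positivity
  have h := canon_sum (g := fun v => ∑ x ∈ leaves H v, φ x) (N := 2 ^ H) (d := H + 1)
    (l := l + 2 ^ H) (r := r + 2 ^ H) (fun v hv hv' => sum_leaves φ hv hv') (by omega) (by omega)
    (by rw [pow_succ]; omega)
  rw [h]
  refine Finset.sum_congr rfl fun x hx => ?_
  have hx' : 2 ^ H ≤ x := by have := Finset.mem_Ico.1 hx; omega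
  rw [leaves, ht_leaf hx']
  simp

theorem canon_bounds {d l r v : ℕ} (hl : 1 ≤ l) (hv : v ∈ canon d l r) : 1 ≤ v ∧ v < r := by
  induction d generalizing l r with
  | zero => simp [canon] at hv
  | succ d ih =>
    by_cases h : l < r
    · have hv' : v = l ∨ v = r - 1 ∨ v ∈ canon d ((l + 1) / 2) (r / 2) := by
        rw [canon, if_pos h, List.mem_append, List.mem_append] at hv
        split_ifs at hv <;> simp at hv <;> tauto
      rcases hv' with hv' | hv' | hv'
      · omega
      · omega
      · have := ih (by omega) hv'
        omega
    · simp [canon, h] at hv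

theorem left_mem_leaves (H v : ℕ) : v * 2 ^ ht H v ∈ leaves H v := by
  have hp : 0 < 2 ^ ht H v := by positivity
  rw [leaves, Finset.mem_Ico, Nat.succ_mul]
  omega

/-- Sum the indicator of the complement of the interval: the total is zero, so no canonical node has
a leaf outside. -/
theorem canon_leaves {H l r v : ℕ} (hr : r ≤ 2 ^ H)
    (hv : v ∈ canon (H + 1) (l + 2 ^ H) (r + 2 ^ H)) :
    l + 2 ^ H ≤ v * 2 ^ ht H v ∧ (v + 1) * 2 ^ ht H v ≤ r + 2 ^ H := by
  have h := canon_sum_leaves (l := l) (fun x => if x ∈ Finset.Ico (l + 2 ^ H) (r + 2 ^ H) then 0 else 1) hr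
  rw [Finset.sum_eq_zero (fun x hx => if_pos hx), List.sum_eq_zero_iff] at h
  have h1 := h _ (List.mem_map_of_mem hv)
  rw [Finset.sum_eq_zero_iff] at h1
  have h2 : ∀ x ∈ leaves H v, x ∈ Finset.Ico (l + 2 ^ H) (r + 2 ^ H) := fun x hx => by
    by_contra hn
    have := h1 x hx
    rw [if_neg hn] at this
    omega
  have hp : 0 < 2 ^ ht H v := by positivity
  have h3 := Finset.mem_Ico.1 (h2 _ (left_mem_leaves H v))
  have h4 := Finset.mem_Ico.1 (h2 ((v + 1) * 2 ^ ht H v - 1) (by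
    rw [leaves, Finset.mem_Ico, Nat.succ_mul]; omega))
  omega

/-- Sum the indicator of the leftmost leaf of `v`: each occurrence of `v` contributes one, but the
interval contains that leaf at most once. -/
theorem count_canon_le {H l r : ℕ} (hr : r ≤ 2 ^ H) (v : ℕ) :
    (canon (H + 1) (l + 2 ^ H) (r + 2 ^ H)).count v ≤ 1 := by
  have h := canon_sum_leaves (l := l) (fun x => if x = v * 2 ^ ht H v then 1 else 0) hr
  have h1 : ∀ L : List ℕ, L.count v ≤ (L.map fun v' => ∑ x ∈ leaves H v',
      if x = v * 2 ^ ht H v then 1 else 0).sum := by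
    intro L
    induction L with
    | nil => simp
    | cons a L ih =>
      rw [List.map_cons, List.sum_cons, List.count_cons]
      by_cases ha : a = v
      · subst ha
        rw [Finset.sum_ite_eq', if_pos (left_mem_leaves H a)]
        simp only [beq_self_eq_true, if_true]
        omega
      · simp only [beq_iff_eq, ha, if_false]
        omega
  refine (h1 _).trans (h.trans_le ?_)
  rw [Finset.sum_ite_eq']
  split_ifs <;> omega

/-- A weight supported on run `b` isolates that run; it has full length by `hb`. -/
theorem BlockPerm.block {w m b : ℕ} {σ τ : ℕ → ℕ} (h : BlockPerm w m σ τ) (hw : 0 < w)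
    (hb : (b + 1) * w ≤ m) (ψ : ℕ → ℕ) :
    ∑ j ∈ Finset.range w, ψ (τ (b * w + j)) = ∑ j ∈ Finset.range w, ψ (σ (b * w + j)) := by
  have key : ∀ υ : ℕ → ℕ, ∑ o ∈ Finset.range m, (if o / w = b then ψ (υ o) else 0) =
      ∑ j ∈ Finset.range w, ψ (υ (b * w + j)) := by
    intro υ
    rw [← Finset.sum_filter, Finset.sum_bij' (i := fun o _ => o - b * w) (j := fun j _ => b * w + j)]
    · intro o ho
      simp only [Finset.mem_filter, Finset.mem_range, Nat.div_eq_iff hw] at ho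
      rw [Finset.mem_range]
      omega
    · intro j hj
      simp only [Finset.mem_filter, Finset.mem_range, Nat.div_eq_iff hw, Nat.succ_mul] at hj hb ⊢
      omega
    · intro o ho
      simp only [Finset.mem_filter, Finset.mem_range, Nat.div_eq_iff hw] at ho
      omega
    · intro j hj
      omega
    · intro o ho
      simp only [Finset.mem_filter, Finset.mem_range, Nat.div_eq_iff hw] at ho
      rw [Nat.add_sub_cancel' (by omega)]
  rw [← key, ← key]
  exact h fun o x => if o = b then ψ x else 0

/-- The nodes of height `h` are numbered from `2 ^ (H - h)` on, so the leaves below `v`, numbered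
from `0`, form run number `v - 2 ^ (H - h)` of length `2 ^ h`. -/
theorem ht_block {H v : ℕ} (hv : 1 ≤ v) (hvV : v < 2 ^ (H + 1)) :
    2 ^ (H - ht H v) ≤ v ∧ v * 2 ^ ht H v = (v - 2 ^ (H - ht H v)) * 2 ^ ht H v + 2 ^ H := by
  have h1 := Nat.size_pos.2 hv
  have h2 := Nat.size_le.2 hvV
  have h3 : 2 ^ (H - ht H v) ≤ v := by
    rw [← Nat.lt_size, ht]
    omega
  refine ⟨h3, ?_⟩
  obtain ⟨c, hc⟩ := Nat.exists_eq_add_of_le h3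
  have h4 : 2 ^ (H - ht H v) * 2 ^ ht H v = 2 ^ H := by
    rw [← pow_add, Nat.sub_add_cancel (ht_le hv)]
  rw [← h4, ← Nat.add_mul, Nat.sub_add_cancel h3]

/-- Canonical nodes of a window inside `[0, n)` have all their leaves below `n`. Their runs are
therefore complete even if `n` is not a power of two, and the merge sort level stores a
rearrangement of exactly these leaves. -/
theorem canon_sum_levels {H n l r : ℕ} {σ : ℕ → ℕ} {τ : ℕ → ℕ → ℕ} (hn : n ≤ 2 ^ H) (hr : r ≤ n)
    (hτ : ∀ h ≤ H, BlockPerm (2 ^ h) n σ (τ h)) (ψ : ℕ → ℕ) :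
    ((canon (H + 1) (l + 2 ^ H) (r + 2 ^ H)).map fun v =>
      ∑ j ∈ Finset.range (2 ^ ht H v), ψ (τ (ht H v) (v * 2 ^ ht H v - 2 ^ H + j))).sum =
      ∑ x ∈ Finset.Ico l r, ψ (σ x) := by
  have h := canon_sum_leaves (l := l) (fun x => ψ (σ (x - 2 ^ H))) (hr.trans hn)
  rw [← Finset.sum_Ico_add' (fun x => ψ (σ (x - 2 ^ H)))] at h
  simp only [Nat.add_sub_cancel] at h
  rw [← h]
  congr 1
  refine List.map_congr_left fun v hv => ?_
  obtain ⟨h1, h2⟩ := canon_bounds (by have : 0 < 2 ^ H := by positivity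
                                      omega) hv
  have h3 : v < 2 ^ (H + 1) := by rw [pow_succ]; omega
  obtain ⟨h4, h5⟩ := ht_block h1 h3
  obtain ⟨h6, h7⟩ := canon_leaves (hr.trans hn) hv
  have h8 : (v + 1) * 2 ^ ht H v = (v - 2 ^ (H - ht H v) + 1) * 2 ^ ht H v + 2 ^ H := by
    rw [Nat.succ_mul, Nat.succ_mul, h5]
    ring
  rw [leaves, h5, h8, ← Finset.sum_Ico_add' (fun x => ψ (σ (x - 2 ^ H)))]
  simp only [Nat.add_sub_cancel]
  rw [(hτ _ (ht_le h1)).block (by positivity) (by omega), Finset.sum_Ico_eq_sum_range,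
    Nat.succ_mul, Nat.add_sub_cancel_left]

/-- Each level of the tree contributes `2 ^ H`. The dummy node `0` has height `H + 1` and
contributes the additional `2 * 2 ^ H`. -/
theorem sum_ht (H g : ℕ) (hg : g ≤ H + 1) :
    ∑ v ∈ Finset.range (2 ^ g), 2 ^ ht H v = (g + 2) * 2 ^ H := by
  induction g with
  | zero => simp [ht, pow_succ]; ring
  | succ g ih =>
    rw [pow_succ, mul_two, Finset.sum_range_add, ih (by omega), show
      ∑ x ∈ Finset.range (2 ^ g), 2 ^ ht H (2 ^ g + x) = ∑ x ∈ Finset.range (2 ^ g), 2 ^ (H - g) from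
      Finset.sum_congr rfl fun x hx => ?_]
    · rw [Finset.sum_const, Finset.card_range, smul_eq_mul, ← pow_add,
        Nat.add_sub_cancel' (by omega)]
      ring
    · have h1 := Finset.mem_range.1 hx
      have h2 : Nat.size (2 ^ g + x) ≤ g + 1 := by rw [Nat.size_le, pow_succ]; omega
      have h3 : g < Nat.size (2 ^ g + x) := by rw [Nat.lt_size]; omega
      rw [ht, show Nat.size (2 ^ g + x) = g + 1 by omega, Nat.add_sub_add_right]


/-! ### Windows of feasible partners -/

/-- Binary search for the number of indices below `wreg 0` that pass a test, which has to hold on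
an initial segment; the test inspects the index in `wreg 82`. -/
def bsearch (t : Test) : Prog :=
  .seq (.setW 80 (.const 0)) (.seq (.setW 81 (.reg 0)) (.loop (.wlt (.reg 80) (.reg 81))
    (.seq (.setW 82 (.div (.add (.reg 80) (.reg 81)) (.const 2)))
      (.cond t (.setW 80 (.add (.reg 82) (.const 1))) (.setW 81 (.reg 82))))))

theorem bsearch_spec {W n H : ℕ} {t : Test} {s₀ : State} {P : ℕ → Prop} (hwf : WF W s₀)
    (h0 : s₀.wreg 0 = n) (hn : n ≤ 2 ^ H) (hP : ∀ x y, x ≤ y → y < n → P y → P x)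
    (ht : ∀ s, Keeps 80 100 [] [] s₀ s → s.wreg 82 < n → t.ok W s ∧ (t.val s ↔ P (s.wreg 82)))
    (hW : 2 * n + 2 ≤ W) :
    Ht W (bsearch t) s₀ ((H + 1) * (t.cost + 20) + 10) fun s => Keeps 80 100 [] [] s₀ s ∧
      s.wreg 80 ≤ n ∧ ∀ x < n, P x ↔ x < s.wreg 80 := by
  refine Ht.seq_wp (c' := (H + 1) * (t.cost + 20) + 8) (Q := fun s => s = s₀.putW 80 0) hwf
    (by simp [Prog.wp, WExp.ok, WExp.val]) ?_ (by simp [Prog.cost, WExp.cost]; omega)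
  rintro s1 hwf1 rfl
  refine Ht.seq_wp (c' := (H + 1) * (t.cost + 20) + 6) (Q := fun s => s = (s₀.putW 80 0).putW 81 n)
    hwf1 (by simp [Prog.wp, WExp.ok, WExp.val, h0]) ?_ (by simp [Prog.cost, WExp.cost]; omega)
  rintro s2 hwf2 rfl
  -- The bit length of the search interval drops in each round, which makes it a potential.
  refine Ht.loop (fun s => Keeps 80 100 [] [] s₀ s ∧ s.wreg 81 ≤ n ∧ s.wreg 80 ≤ s.wreg 81 ∧
    (∀ x < s.wreg 80, P x) ∧ ∀ x < n, s.wreg 81 ≤ x → ¬ P x)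
    (fun s => Nat.size (s.wreg 81 - s.wreg 80) * (t.cost + 20)) hwf2 ?_ ?_ ?_ ?_ ?_
  · refine ⟨(Keeps.rfl.putW (by norm_num)).putW (by norm_num), ?_⟩
    simp
    omega
  · rintro s - -
    simp [Test.ok, WExp.ok]
  · rintro s hs ⟨hk, h1, h2, h3, h4⟩ hb
    simp only [Test.val, WExp.val] at hb
    have b2 : 2 ≤ W := by omega
    refine ⟨t.cost + 15, Ht.seq_wp (c' := t.cost + 6) (Q := fun s' => s' = s.putW 82
      ((s.wreg 80 + s.wreg 81) / 2)) hs ?_ ?_ (by simp [Prog.cost, WExp.cost]; omega)⟩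
    · simp only [Prog.wp, WExp.ok, WExp.val, true_and, and_true, b2]
      omega
    rintro s' hs' rfl
    generalize hm : (s.wreg 80 + s.wreg 81) / 2 = m at hs' ⊢
    have hsz : ∀ a, a < s.wreg 81 - s.wreg 80 → a ≤ (s.wreg 81 - s.wreg 80) / 2 →
        Nat.size a * (t.cost + 20) + (t.cost + 20) ≤
          Nat.size (s.wreg 81 - s.wreg 80) * (t.cost + 20) := by
      intro a ha ha'
      rw [size_half (v := s.wreg 81 - s.wreg 80) (by omega), Nat.succ_mul]
      exact Nat.add_le_add_right (Nat.mul_le_mul_right _ (Nat.size_le_size ha')) _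
    have hk' : Keeps 80 100 [] [] s₀ (s.putW 82 m) := hk.putW (by norm_num)
    obtain ⟨ht1, ht2⟩ := ht _ hk' (by simp; omega)
    simp only [putW_wreg, if_true] at ht2
    refine Ht.cond (c := 4) hs' ht1 (fun hv => ?_) (fun hv => ?_) (by omega)
    · rw [ht2] at hv
      refine Ht.of_wp hs' ?_ (by simp [Prog.cost, WExp.cost])
      simp only [Prog.wp, WExp.ok, WExp.val, true_and, and_true, putW_wreg, if_true,
        Nat.reduceEqDiff, if_false, Test.cost, WExp.cost]
      refine ⟨⟨by omega, by omega⟩, ⟨hk'.putW (by norm_num), h1, by omega, fun x hx => ?_, h4⟩, ?_⟩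
      · exact hP x m (by omega) (by omega) hv
      · have := hsz (s.wreg 81 - (m + 1)) (by omega) (by omega)
        omega
    · rw [ht2] at hv
      refine Ht.of_wp hs' ?_ (by simp [Prog.cost, WExp.cost])
      simp only [Prog.wp, WExp.ok, WExp.val, true_and, and_true, putW_wreg, if_true,
        Nat.reduceEqDiff, if_false, Test.cost, WExp.cost]
      refine ⟨⟨hk'.putW (by norm_num), by omega, by omega, h3, fun x hx hmx hpx => ?_⟩, ?_⟩
      · exact hv (hP m x hmx hx hpx)
      · have := hsz (m - s.wreg 80) (by omega) (by omega)
        omega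
  · rintro s - ⟨hk, h1, h2, h3, h4⟩ hb
    simp only [Test.val, WExp.val] at hb
    refine ⟨hk, by omega, fun x hx => ⟨fun hp => ?_, fun hx' => h3 x hx'⟩⟩
    by_contra hn
    exact h4 x hx (by omega) hp
  · simp only [putW_wreg, if_true, Nat.reduceEqDiff, if_false, Nat.sub_zero, Test.cost, WExp.cost]
    have : Nat.size n ≤ H + 1 := by rw [Nat.size_le, pow_succ]; have : 0 < 2 ^ H := by positivity
                                    omega
    have := Nat.mul_le_mul_right (t.cost + 20) this
    omega

/-- The test whether the point `wreg 11` of the first and the point at position `wreg 82` of the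
second set violate a constraint. -/
def violates (r : ℕ) : Test :=
  .rlt (.add (.load (4 + r) (.reg 11)) (.load (7 + r) (.load 2 (.reg 82)))) (.reg (4 + r))

/-- Intersect the window `[wreg 78, wreg 79)` with the positions that satisfy a constraint. -/
def bound (r : ℕ) : Prog :=
  .cond (.rlt (.reg (14 + r)) (.const 0))
    (.seq (bsearch (violates r)) (.cond (.wlt (.reg 78) (.reg 80)) (.setW 78 (.reg 80)) .skip))
    (.seq (bsearch (.not (violates r)))
      (.cond (.wlt (.reg 80) (.reg 79)) (.setW 79 (.reg 80)) .skip))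

/-- The left-hand side of constraint `r` for a point of the first set and a position in the second
set. -/
noncomputable def State.lhs (s : State) (r i x : ℕ) : ℝ :=
  s.rmem (4 + r) i + s.rmem (7 + r) (s.wmem 2 x)

/-- The left-hand side of constraint `r` is monotone in the position, in the direction given by
the sign of `rreg (14 + r)`. -/
def State.Directed (s : State) (r n : ℕ) : Prop :=
  ∀ i x y, x ≤ y → y < n → (s.rreg (14 + r) < 0 → s.lhs r i x ≤ s.lhs r i y) ∧
    (¬ s.rreg (14 + r) < 0 → s.lhs r i y ≤ s.lhs r i x)

/-- Positions are ordered by descending product with the direction. If the normal points against the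
direction, the left-hand side grows with the position, the violating positions form an initial
segment, and the left end of the window is raised; otherwise the feasible positions form an initial
segment, and the right end is lowered. -/
theorem bound_spec {W n H r i : ℕ} {s₀ : State} (hwf : WF W s₀) (h0 : s₀.wreg 0 = n)
    (h11 : s₀.wreg 11 = i) (hn : n ≤ 2 ^ H) (hr : r < 2) (hmono : s₀.Directed r n)
    (hW : 2 * n + 2 ≤ W) :
    Ht W (bound r) s₀ (50 * (H + 1) + 30) fun s => Keeps 78 100 [] [] s₀ s ∧
      s.wreg 79 ≤ s₀.wreg 79 ∧ (s₀.wreg 78 ≤ n → s.wreg 78 ≤ n) ∧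
      ∀ x < n, (s.wreg 78 ≤ x ∧ x < s.wreg 79) ↔ (s₀.wreg 78 ≤ x ∧ x < s₀.wreg 79) ∧
        ¬ s₀.lhs r i x < s₀.rreg (4 + r) := by
  have ht : ∀ s, Keeps 80 100 [] [] s₀ s → s.wreg 82 < n → (violates r).ok W s ∧
      ((violates r).val s ↔ s₀.lhs r i (s.wreg 82) < s₀.rreg (4 + r)) := by
    intro s hk hs
    simp only [violates, Test.ok, Test.val, RExp.ok, RExp.val, WExp.ok, WExp.val, State.lhs,
      hk.rmem _ (List.not_mem_nil), hk.wmem _ (List.not_mem_nil), hk.wreg 11 (by norm_num), h11,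
      hk.rreg (4 + r) (by omega), true_and]
  refine Ht.cond (c := 50 * (H + 1) + 20) hwf (by simp [Test.ok, RExp.ok]) (fun hb => ?_)
    (fun hb => ?_) (by simp [Test.cost, RExp.cost]; omega)
  · simp only [Test.val, RExp.val, Rat.cast_zero] at hb
    refine (bsearch_spec (H := H) (P := fun x => s₀.lhs r i x < s₀.rreg (4 + r)) hwf h0 hn
      (fun x y hxy hy h => ((hmono i x y hxy hy).1 hb).trans_lt h) ht hW).seq (c' := 8) ?_
      (by simp [violates, Test.cost, RExp.cost, WExp.cost]; omega)
    rintro s hs ⟨hk, h1, h2⟩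
    have e78 := hk.wreg 78 (by norm_num)
    have e79 := hk.wreg 79 (by norm_num)
    refine Ht.of_wp hs ?_ (by simp [Prog.cost, WExp.cost, Test.cost])
    simp only [Prog.wp, Test.ok, Test.val, WExp.ok, WExp.val, true_and, putW_wreg, if_true,
      Nat.reduceEqDiff, if_false]
    have hk' := hk.mono (c' := 78) (by norm_num) le_rfl (List.Subset.refl _) (List.Subset.refl _)
    refine ⟨fun h => ⟨hk'.putW (by norm_num), by omega, by omega, fun x hx => ?_⟩,
      fun h => ⟨hk', by omega, by omega, fun x hx => ?_⟩⟩
    · rw [h2 x hx]; omega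
    · rw [h2 x hx]; omega
  · simp only [Test.val, RExp.val, Rat.cast_zero] at hb
    refine (bsearch_spec (t := .not (violates r)) (H := H) (P := fun x => ¬ s₀.lhs r i x < s₀.rreg (4 + r)) hwf h0 hn
      (fun x y hxy hy h => fun h' => h (((hmono i x y hxy hy).2 hb).trans_lt h'))
      (fun s hk hs => ⟨(ht s hk hs).1, not_congr (ht s hk hs).2⟩) hW).seq (c' := 8) ?_
      (by simp [violates, Test.cost, RExp.cost, WExp.cost]; omega)
    rintro s hs ⟨hk, h1, h2⟩
    have e78 := hk.wreg 78 (by norm_num)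
    have e79 := hk.wreg 79 (by norm_num)
    refine Ht.of_wp hs ?_ (by simp [Prog.cost, WExp.cost, Test.cost])
    simp only [Prog.wp, Test.ok, Test.val, WExp.ok, WExp.val, true_and, putW_wreg, if_true,
      Nat.reduceEqDiff, if_false]
    have hk' := hk.mono (c' := 78) (by norm_num) le_rfl (List.Subset.refl _) (List.Subset.refl _)
    refine ⟨fun h => ⟨hk'.putW (by norm_num), by omega, by omega, fun x hx => ?_⟩,
      fun h => ⟨hk', by omega, by omega, fun x hx => ?_⟩⟩
    · rw [h2 x hx]; omega
    · rw [h2 x hx]; omega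

/-- Compute the window of the positions that satisfy both constraints. -/
def window : Prog :=
  .seq (.setW 78 (.const 0)) (.seq (.setW 79 (.reg 0)) (.seq (bound 0) (bound 1)))

theorem State.Directed.keep {s s' : State} {r n : ℕ} (h : s.Directed r n) (hr : r < 2) {c : ℕ}
    {lw lr : List ℕ} (hk : Keeps c 16 lw lr s s') (h2 : 2 ∉ lw) (h4 : 4 + r ∉ lr) (h7 : 7 + r ∉ lr) :
    s'.Directed r n := by
  intro i x y hxy hy
  simp only [State.lhs, hk.rmem _ h4, hk.rmem _ h7, hk.wmem _ h2, hk.rreg (14 + r) (by omega)]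
  exact h i x y hxy hy

theorem window_spec {W n H i : ℕ} {s₀ : State} (hwf : WF W s₀) (h0 : s₀.wreg 0 = n)
    (h11 : s₀.wreg 11 = i) (hn : n ≤ 2 ^ H) (hmono : ∀ r < 2, s₀.Directed r n)
    (hW : 2 * n + 2 ≤ W) :
    Ht W window s₀ (100 * (H + 1) + 70) fun s => Keeps 78 100 [] [] s₀ s ∧ s.wreg 79 ≤ n ∧
      s.wreg 78 ≤ n ∧ ∀ x < n, (s.wreg 78 ≤ x ∧ x < s.wreg 79) ↔
        ∀ r < 2, ¬ s₀.lhs r i x < s₀.rreg (4 + r) := by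
  refine Ht.seq_wp (c' := 100 * (H + 1) + 65) (Q := fun s => s = s₀.putW 78 0) hwf
    (by simp [Prog.wp, WExp.ok, WExp.val]) ?_ (by simp [Prog.cost, WExp.cost]; omega)
  rintro s1 hwf1 rfl
  refine Ht.seq_wp (c' := 100 * (H + 1) + 60) (Q := fun s => s = (s₀.putW 78 0).putW 79 n)
    hwf1 (by simp [Prog.wp, WExp.ok, WExp.val, h0]) ?_ (by simp [Prog.cost, WExp.cost]; omega)
  rintro s2 hwf2 rfl
  have hk2 : Keeps 78 100 [] [] s₀ ((s₀.putW 78 0).putW 79 n) :=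
    (Keeps.rfl.putW (by norm_num)).putW (by norm_num)
  refine (bound_spec (H := H) (r := 0) (i := i) hwf2 (by simpa using h0) (by simpa using h11) hn
    (by norm_num) ((hmono 0 (by norm_num)).keep (by norm_num) (hk2.mono le_rfl (by norm_num)
    (List.Subset.refl _) (List.Subset.refl _)) (by simp) (by simp) (by simp)) hW).seq
    (c' := 50 * (H + 1) + 30) ?_ (by omega)
  rintro s3 hwf3 ⟨hk3, h1, h2, h3⟩
  have hk3' := hk2.trans hk3
  refine (bound_spec (H := H) (r := 1) (i := i) hwf3 (by rw [hk3'.wreg 0 (by norm_num), h0])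
    (by rw [hk3'.wreg 11 (by norm_num), h11]) hn
    (by norm_num) ((hmono 1 (by norm_num)).keep (by norm_num) (hk3'.mono le_rfl (by norm_num)
    (List.Subset.refl _) (List.Subset.refl _)) (by simp) (by simp) (by simp)) hW).mono le_rfl ?_
  rintro s4 - ⟨hk4, h4, h5, h6⟩
  simp only [putW_wreg, if_true, Nat.reduceEqDiff, if_false] at h1 h2 h3
  refine ⟨hk3'.trans hk4, by omega, h5 (h2 (by omega)), fun x hx => ?_⟩
  have e1 : s3.lhs 1 i x = s₀.lhs 1 i x := by
    simp only [State.lhs, hk3'.rmem _ (List.not_mem_nil), hk3'.wmem _ (List.not_mem_nil)]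
  rw [h6 x hx, h3 x hx, e1, hk3'.rreg _ (by norm_num)]
  have e0 : ((s₀.putW 78 0).putW 79 n).lhs 0 i x = s₀.lhs 0 i x := rfl
  rw [e0]
  constructor
  · rintro ⟨⟨-, ha⟩, hb⟩ r hr
    interval_cases r
    · exact ha
    · exact hb
  · intro h
    exact ⟨⟨⟨Nat.zero_le _, hx⟩, h 0 (by norm_num)⟩, h 1 (by norm_num)⟩


/-! ### Filling the rows of the nodes -/

/-- The rows stored at the nodes: `S v φ` is the sum of the values of `φ` at the row entries of
the node `v`; rows are descending and bounded below by `y`. -/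
structure Listed (n V : ℕ) (S : ℕ → (ℝ → ℕ) → ℕ) (y : ℝ) (s : State) : Prop where
  sum : ∀ v < V, ∀ φ : ℝ → ℕ, ∑ i ∈ Finset.range (s.wmem 6 v), φ (s.rmem 13 (v * n + i)) = S v φ
  anti : ∀ v < V, ∀ i i', i ≤ i' → i' < s.wmem 6 v →
    s.rmem 13 (v * n + i') ≤ s.rmem 13 (v * n + i)
  low : ∀ v < V, ∀ i < s.wmem 6 v, y ≤ s.rmem 13 (v * n + i)

theorem Listed.card {n V v : ℕ} {S : ℕ → (ℝ → ℕ) → ℕ} {y : ℝ} {s : State} (h : Listed n V S y s)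
    (hv : v < V) : s.wmem 6 v = S v fun _ => 1 := by
  simpa using h.sum v hv fun _ => 1

theorem Listed.keep {n V : ℕ} {S : ℕ → (ℝ → ℕ) → ℕ} {y : ℝ} {s s' : State} (h : Listed n V S y s)
    (h6 : s'.wmem 6 = s.wmem 6) (h13 : s'.rmem 13 = s.rmem 13) : Listed n V S y s' := by
  obtain ⟨h1, h2, h3⟩ := h
  rw [← h6, ← h13] at *
  exact ⟨h1, h2, h3⟩

/-- Append the key of the point `wreg 11` to the row of the node `wreg 85`. -/
def appendNode : Prog :=
  .seq (.storeR 13 (.add (.mul (.reg 85) (.reg 0)) (.load 6 (.reg 85))) (.load 6 (.reg 11)))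
    (.storeW 6 (.reg 85) (.add (.load 6 (.reg 85)) (.const 1)))

/-- The rows of different nodes are stored at distance `n`, so they do not overlap as long as no row
exceeds `n` entries. Appending the lower bound `y` of all stored keys keeps the rows descending. -/
theorem appendNode_spec {W n V v : ℕ} {S : ℕ → (ℝ → ℕ) → ℕ} {y : ℝ} {s : State} (hwf : WF W s)
    (h0 : s.wreg 0 = n) (h85 : s.wreg 85 = v) (hy : s.rmem 6 (s.wreg 11) = y)
    (hL : Listed n V S y s) (hv : v < V) (hS : ∀ v' < V, S v' (fun _ => 1) ≤ n)
    (hSv : S v (fun _ => 1) < n) (hW : V * n + 1 ≤ W) :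
    Ht W appendNode s 20 fun s' => Keeps 100 100 [6] [13] s s' ∧
      Listed n V (fun v' φ => S v' φ + if v' = v then φ y else 0) y s' := by
  have hc : s.wmem 6 v < n := by rw [hL.card hv]; exact hSv
  have hc' : ∀ v' < V, s.wmem 6 v' ≤ n := fun v' hv' => by rw [hL.card hv']; exact hS v' hv'
  have hvn : v * n + n ≤ V * n := by rw [← Nat.succ_mul]; exact Nat.mul_le_mul_right n hv
  have hn : n ≤ V * n := by omega
  refine Ht.of_wp hwf ?_ (by simp [appendNode, Prog.cost, WExp.cost, RExp.cost])
  simp only [appendNode, Prog.wp, WExp.ok, WExp.val, RExp.ok, RExp.val, true_and, h0, h85, putRM_wreg,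
    putRM_wmem, hy]
  refine ⟨⟨by omega, by omega⟩, ⟨by omega, by omega⟩,
    (Keeps.rfl.putRM (by simp)).putWM (by simp), ?_⟩
  generalize hs' : (s.putRM 13 (v * n + s.wmem 6 v) y).putWM 6 v (s.wmem 6 v + 1) = s'
  have e6 : ∀ v', s'.wmem 6 v' = if v' = v then s.wmem 6 v + 1 else s.wmem 6 v' := by
    intro v'
    simp [← hs', Function.update_apply]
  have e13 : ∀ x, s'.rmem 13 x = if x = v * n + s.wmem 6 v then y else s.rmem 13 x := by
    intro x
    simp [← hs', Function.update_apply]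
  have old : ∀ v' < V, ∀ i < s.wmem 6 v', s'.rmem 13 (v' * n + i) = s.rmem 13 (v' * n + i) := by
    intro v' hv' i hi
    rw [e13, if_neg]
    intro he
    have hi' := hc' v' hv'
    rcases lt_trichotomy v' v with h | rfl | h
    · have := Nat.mul_le_mul_right n (Nat.succ_le_of_lt h)
      rw [Nat.succ_mul] at this
      omega
    · omega
    · have := Nat.mul_le_mul_right n (Nat.succ_le_of_lt h)
      rw [Nat.succ_mul] at this
      omega
  have new : s'.rmem 13 (v * n + s.wmem 6 v) = y := by rw [e13, if_pos rfl]
  refine ⟨fun v' hv' φ => ?_, fun v' hv' i i' hii hi' => ?_, fun v' hv' i hi => ?_⟩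
  · rw [e6, ← hL.sum v' hv' φ]
    split_ifs with h
    · subst h
      rw [Finset.sum_range_succ, new]
      congr 1
      exact Finset.sum_congr rfl fun i hi => by rw [old _ hv' _ (Finset.mem_range.1 hi)]
    · rw [Nat.add_zero]
      exact Finset.sum_congr rfl fun i hi => by rw [old _ hv' _ (Finset.mem_range.1 hi)]
  · rw [e6] at hi'
    split_ifs at hi' with h
    · subst h
      rcases Nat.lt_or_ge i' (s.wmem 6 v') with h1 | h1
      · rw [old _ hv' _ h1, old _ hv' _ (by omega)]
        exact hL.anti _ hv' _ _ hii h1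
      · obtain rfl : i' = s.wmem 6 v' := by omega
        rw [new]
        rcases Nat.lt_or_ge i (s.wmem 6 v') with h2 | h2
        · rw [old _ hv' _ h2]
          exact hL.low _ hv' _ h2
        · obtain rfl : i = s.wmem 6 v' := by omega
          rw [new]
    · rw [old _ hv' _ hi', old _ hv' _ (by omega)]
      exact hL.anti _ hv' _ _ hii hi'
  · rw [e6] at hi
    split_ifs at hi with h
    · subst h
      rcases Nat.lt_or_ge i (s.wmem 6 v') with h2 | h2
      · rw [old _ hv' _ h2]
        exact hL.low _ hv' _ h2
      · obtain rfl : i = s.wmem 6 v' := by omega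
        rw [new]
    · rw [old _ hv' _ hi]
      exact hL.low _ hv' _ hi

/-- Append the key of the point `wreg 11` at the canonical nodes of `[wreg 78, wreg 79)`. -/
def appendCanon : Prog :=
  .loop (.wlt (.reg 78) (.reg 79))
    (.seq (.cond (.wlt (.mul (.div (.reg 78) (.const 2)) (.const 2)) (.reg 78))
      (.seq (.setW 85 (.reg 78)) appendNode) .skip)
    (.seq (.cond (.wlt (.mul (.div (.reg 79) (.const 2)) (.const 2)) (.reg 79))
      (.seq (.setW 85 (.sub (.reg 79) (.const 1))) appendNode) .skip)
    (.seq (.setW 78 (.div (.add (.reg 78) (.const 1)) (.const 2)))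
      (.setW 79 (.div (.reg 79) (.const 2))))))

/-- The rows after the canonical nodes in the list `K` have been treated. -/
def Pending (n V : ℕ) (S : ℕ → (ℝ → ℕ) → ℕ) (y : ℝ) (C : List ℕ) (s₀ : State) (l r : ℕ)
    (rest : List ℕ) (s : State) : Prop :=
  Keeps 78 100 [6] [13] s₀ s ∧ s.wreg 78 = l ∧ s.wreg 79 = r ∧ ∃ K, K ++ rest = C ∧
    Listed n V (fun v φ => S v φ + K.count v * φ y) y s

/-- Serves both ends of a round of `canon`: `c` is the parity condition, and the list of treated
nodes grows by `v` exactly when it holds. -/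
theorem appendIf_spec {W n V l r v : ℕ} {S : ℕ → (ℝ → ℕ) → ℕ} {y : ℝ} {C rest : List ℕ}
    {s₀ s : State} {b : Test} {e : WExp} (hwf : WF W s) (h0 : s₀.wreg 0 = n)
    (hy : s₀.rmem 6 (s₀.wreg 11) = y) (hC : ∀ v ∈ C, v < V)
    (hS : ∀ v < V, S v (fun _ => 1) + C.count v ≤ n) (hW : V * n + 1 ≤ W) (hb : b.ok W s)
    (he : e.ok W s) (hev : e.val s = v) (hbc : b.cost ≤ 10) (hec : e.cost ≤ 5)
    {c : Prop} [Decidable c] (hbv : b.val s ↔ c)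
    (h : Pending n V S y C s₀ l r ((if c then [v] else []) ++ rest) s) :
    Ht W (.cond b (.seq (.setW 85 e) appendNode) .skip) s 40 (Pending n V S y C s₀ l r rest) := by
  obtain ⟨hk, h78, h79, K, hK, hL⟩ := h
  refine Ht.cond (c := 28) hwf hb (fun hv => ?_) (fun hv => ?_) (by omega)
  · rw [hbv] at hv
    rw [if_pos hv] at hK
    refine Ht.seq_wp (c' := 20) (Q := fun s' => s' = s.putW 85 v) hwf ⟨he, by rw [hev]⟩ ?_
      (by simp [Prog.cost]; omega)
    rintro s' hwf' rfl
    have hvC : v ∈ C := by rw [← hK]; simp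
    have hcnt : ∀ v', K.count v' + (if v' = v then 1 else 0) ≤ C.count v' := by
      intro v'
      rw [← hK, List.count_append, List.count_append, List.count_singleton]
      simp only [beq_iff_eq, eq_comm (a := v)]
      omega
    refine (appendNode_spec (v := v) (y := y)
      (S := fun v φ => S v φ + K.count v * φ y) hwf' (by simp [hk.wreg, h0]) (by simp)
      (by simp [hk.wreg, hk.rmem, hy]) (hL.keep rfl rfl) (hC v hvC) (fun v' hv' => ?_) ?_ hW).mono
      le_rfl ?_
    · have := hS v' hv'
      have := hcnt v'
      simp only [mul_one]
      omega
    · have := hS v (hC v hvC)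
      have := hcnt v
      simp only [mul_one]
      simp only [if_true] at this
      omega
    · rintro s'' - ⟨hk'', hL''⟩
      refine ⟨(hk.putW (by norm_num)).trans (hk''.mono (by norm_num) le_rfl (List.Subset.refl _)
        (List.Subset.refl _)), by simp [hk''.wreg, h78], by simp [hk''.wreg, h79], K ++ [v],
        by simpa using hK, ?_⟩
      convert hL'' using 3 with v' φ
      rw [List.count_append, List.count_singleton]
      simp only [beq_iff_eq, eq_comm (a := v)]
      split_ifs <;> ring
  · rw [hbv] at hv
    rw [if_neg hv] at hK
    exact Ht.of_wp hwf ⟨hk, h78, h79, K, by simpa using hK, hL⟩ (by simp [Prog.cost])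

theorem appendCanon_spec {W n V l r d : ℕ} {S : ℕ → (ℝ → ℕ) → ℕ} {y : ℝ} {C : List ℕ}
    {s₀ : State} (hwf : WF W s₀) (h0 : s₀.wreg 0 = n) (hy : s₀.rmem 6 (s₀.wreg 11) = y)
    (h78 : s₀.wreg 78 = l) (h79 : s₀.wreg 79 = r) (hCl : C = canon d l r) (hC : ∀ v ∈ C, v < V)
    (hd : r - l < 2 ^ d) (hS : ∀ v < V, S v (fun _ => 1) + C.count v ≤ n) (hW : V * n + 1 ≤ W)
    (hrW : r + 2 ≤ W) (hL : Listed n V S y s₀) :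
    Ht W appendCanon s₀ (110 * d + 10) fun s => Keeps 78 100 [6] [13] s₀ s ∧
      Listed n V (fun v φ => S v φ + C.count v * φ y) y s := by
  refine Ht.loop (fun s => ∃ d' l' r', r' - l' < 2 ^ d' ∧ r' ≤ r ∧
      Pending n V S y C s₀ l' r' (canon d' l' r') s)
    (fun s => Nat.size (s.wreg 79 - s.wreg 78) * 110) hwf
    ⟨d, l, r, hd, le_rfl, Keeps.rfl, h78, h79, [], by simpa using hCl.symm, by simpa using hL⟩
    ?_ ?_ ?_ ?_
  · rintro s - -
    simp [Test.ok, WExp.ok]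
  · rintro s hs ⟨d', l', r', hd', hr', hp⟩ hb
    have e78 := hp.2.1
    have e79 := hp.2.2.1
    simp only [Test.val, WExp.val, e78, e79] at hb
    obtain ⟨d', rfl⟩ : ∃ e, d' = e + 1 := ⟨d' - 1, by
      rcases Nat.eq_zero_or_pos d' with h | h
      · subst h; simp at hd'; omega
      · omega⟩
    rw [canon, if_pos hb] at hp
    have b2 : 2 ≤ W := by omega
    refine ⟨100, (appendIf_spec hs h0 hy hC hS hW (v := l') (c := l' / 2 * 2 < l') ?_
      (by simp [WExp.ok]) (by simpa [WExp.val] using e78) (by simp [Test.cost, WExp.cost])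
      (by simp [WExp.cost]) (by simp [Test.val, WExp.val, e78]) hp).seq (c' := 60) ?_ (by omega)⟩
    · simp only [Test.ok, WExp.ok, WExp.val, e78, true_and, b2, and_true]
      omega
    rintro s1 hs1 hp1
    have e78' := hp1.2.1
    have e79' := hp1.2.2.1
    refine (appendIf_spec hs1 h0 hy hC hS hW (v := r' - 1) (c := r' / 2 * 2 < r') ?_
      (by simp [WExp.ok]; omega) (by simp [WExp.val, e79']) (by simp [Test.cost, WExp.cost])
      (by simp [WExp.cost]) (by simp [Test.val, WExp.val, e79']) hp1).seq (c' := 20) ?_ (by omega)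
    · simp only [Test.ok, WExp.ok, WExp.val, e79', true_and, b2, and_true]
      omega
    rintro s2 hs2 ⟨hk2, f78, f79, K, hK, hL2⟩
    refine Ht.of_wp hs2 ?_ (by simp [Prog.cost, WExp.cost])
    simp only [Prog.wp, WExp.ok, WExp.val, f78, f79, true_and, b2, and_true, putW_wreg, if_true,
      Nat.reduceEqDiff, if_false, e78, e79, Test.cost, WExp.cost]
    refine ⟨⟨by omega, by omega⟩, ⟨d', (l' + 1) / 2, r' / 2, by rw [pow_succ] at hd'; omega,
      by omega, ⟨(hk2.putW (by norm_num)).putW (by norm_num), by simp, by simp, K, hK,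
      hL2.keep rfl rfl⟩⟩, ?_⟩
    have h1 := size_half (v := r' - l') (by omega)
    have h2 : Nat.size (r' / 2 - (l' + 1) / 2) ≤ Nat.size ((r' - l') / 2) :=
      Nat.size_le_size (by omega)
    omega
  · rintro s - ⟨d', l', r', hd', hr', hk, e78, e79, K, hK, hL'⟩ hb
    simp only [Test.val, WExp.val, e78, e79] at hb
    rw [canon_of_le (by omega), List.append_nil] at hK
    rw [← hK]
    exact ⟨hk, hL'⟩
  · simp only [h78, h79, Test.cost, WExp.cost]
    have := Nat.size_le.2 hd
    omega


/-- Treat the `wreg 10`-th point of the first set. -/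
def buildRow : Prog :=
  .seq (.setW 11 (.load 0 (.add (.reg 3) (.reg 10)))) (.seq window
    (.seq (.setW 13 (.add (.reg 13) (.sub (.reg 79) (.reg 78))))
    (.seq (.setW 78 (.add (.reg 78) (.reg 5))) (.seq (.setW 79 (.add (.reg 79) (.reg 5)))
    (.seq appendCanon (.setW 10 (.add (.reg 10) (.const 1))))))))

/-- Treat all points of the first set. -/
def buildRows : Prog :=
  .seq (.setW 13 (.const 0)) (.seq (.setW 10 (.const 0)) (.loop (.wlt (.reg 10) (.reg 0)) buildRow))

/-- The canonical nodes of a window. -/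
def nodes (H : ℕ) (w : ℕ × ℕ) : List ℕ := canon (H + 1) (w.1 + 2 ^ H) (w.2 + 2 ^ H)

/-- The row sums after the points with the keys `y 0, …, y (j - 1)` have been treated. -/
def rowSum (H : ℕ) (ω : ℕ → ℕ × ℕ) (y : ℕ → ℝ) (j v : ℕ) (φ : ℝ → ℕ) : ℕ :=
  ∑ t ∈ Finset.range j, (nodes H (ω t)).count v * φ (y t)

/-- `w` is the window of the positions that are feasible for the `t`-th point. -/
def State.IsWindow (s : State) (n base t : ℕ) (w : ℕ × ℕ) : Prop :=
  w.1 ≤ n ∧ w.2 ≤ n ∧ ∀ x < n, (w.1 ≤ x ∧ x < w.2) ↔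
    ∀ r < 2, ¬ s.lhs r (s.wmem 0 (base + t)) x < s.rreg (4 + r)

/-- The key of the `t`-th point. -/
def State.key (s : State) (base t : ℕ) : ℝ := s.rmem 6 (s.wmem 0 (base + t))

/-- The state after `j` points have been treated. -/
structure BuildState (n H base : ℕ) (s₀ : State) (ω : ℕ → ℕ × ℕ) (j : ℕ) (s : State) : Prop where
  keeps : Keeps 10 100 [6] [13] s₀ s
  windows : ∀ t < j, s₀.IsWindow n base t (ω t)
  total : s.wreg 13 = ∑ t ∈ Finset.range j, ((ω t).2 - (ω t).1)
  listed : Listed n (2 ^ (H + 1)) (rowSum H ω (s₀.key base) j) (s₀.key base (min j (n - 1))) s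

theorem rowSum_congr {H j : ℕ} {ω ω' : ℕ → ℕ × ℕ} {y : ℕ → ℝ} (h : ∀ t < j, ω t = ω' t) :
    rowSum H ω y j = rowSum H ω' y j := by
  funext v φ
  exact Finset.sum_congr rfl fun t ht => by rw [h t (Finset.mem_range.1 ht)]

theorem buildRow_spec {W n H base j : ℕ} {s₀ s : State} {ω : ℕ → ℕ × ℕ} (h0 : s₀.wreg 0 = n)
    (h3 : s₀.wreg 3 = base) (h5 : s₀.wreg 5 = 2 ^ H) (hn : n ≤ 2 ^ H)
    (hmono : ∀ r < 2, s₀.Directed r n)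
    (hsort : ∀ t t', t ≤ t' → t' < n → s₀.key base t' ≤ s₀.key base t)
    (hW : 2 ^ (H + 1) * n + 2 ^ (H + 1) + n * n + base + 2 * n + 2 ≤ W) (hwf : WF W s)
    (hj : j < n) (h10 : s.wreg 10 = j) (hs : BuildState n H base s₀ ω j s) :
    Ht W buildRow s (220 * (H + 1) + 130) fun s' => s'.wreg 10 = j + 1 ∧
      ∃ ω, BuildState n H base s₀ ω (j + 1) s' := by
  obtain ⟨hk, hwin, htot, hL⟩ := hs
  have hpow : 2 ^ (H + 1) = 2 ^ H * 2 := pow_succ 2 H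
  have e6 := hk.rmem 6 (by simp)
  refine Ht.seq_wp (c' := 220 * (H + 1) + 120)
    (Q := fun s' => s' = s.putW 11 (s₀.wmem 0 (base + j))) hwf ?_ ?_
    (by simp [Prog.cost, WExp.cost]; omega)
  · simp only [Prog.wp, WExp.ok, WExp.val, hk.wreg 3 (by norm_num), h3, h10, hk.wmem 0 (by simp),
      true_and, and_true]
    omega
  rintro s1 hwf1 rfl
  have hk1 : Keeps 10 100 [6] [13] s₀ (s.putW 11 (s₀.wmem 0 (base + j))) := hk.putW (by norm_num)
  refine (window_spec (n := n) (H := H) (i := s₀.wmem 0 (base + j)) hwf1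
    (by rw [hk1.wreg 0 (by norm_num), h0]) (by simp) hn (fun r hr => (hmono r hr).keep hr
    (hk1.mono le_rfl (by norm_num) (List.Subset.refl _) (List.Subset.refl _)) (by simp)
    (by simp; omega) (by simp; omega)) (by omega)).seq (c' := 120 * (H + 1) + 40) ?_ (by omega)
  rintro s2 hwf2 ⟨hk2, hr, hl, hw⟩
  generalize hl' : s2.wreg 78 = l at hl hw
  generalize hr' : s2.wreg 79 = r at hr hw
  have hk2' : Keeps 10 100 [6] [13] s₀ s2 :=
    hk1.trans (hk2.mono (by norm_num) le_rfl (by simp) (by simp))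
  have e13 : s2.wreg 13 = ∑ t ∈ Finset.range j, ((ω t).2 - (ω t).1) := by
    rw [hk2.wreg 13 (by norm_num)]
    simpa using htot
  have htn : ∑ t ∈ Finset.range j, ((ω t).2 - (ω t).1) ≤ j * n := by
    calc _ ≤ ∑ _t ∈ Finset.range j, n := Finset.sum_le_sum fun t ht => by
          have := (hwin t (Finset.mem_range.1 ht)).2.1
          omega
      _ = j * n := by simp
  have hjn : j * n + n ≤ n * n := by rw [← Nat.succ_mul]; exact Nat.mul_le_mul_right n hj
  set T := ∑ t ∈ Finset.range j, ((ω t).2 - (ω t).1)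
  refine Ht.seq_wp (c' := 120 * (H + 1) + 30) (Q := fun s' => s' = s2.putW 13 (T + (r - l))) hwf2 ?_
    ?_ (by simp [Prog.cost, WExp.cost]; omega)
  · simp only [Prog.wp, WExp.ok, WExp.val, e13, hl', hr', true_and, and_true]
    omega
  rintro s3 hwf3 rfl
  refine Ht.seq_wp (c' := 120 * (H + 1) + 25)
    (Q := fun s' => s' = (s2.putW 13 (T + (r - l))).putW 78 (l + 2 ^ H)) hwf3 ?_
    ?_ (by simp [Prog.cost, WExp.cost]; omega)
  · simp only [Prog.wp, WExp.ok, WExp.val, hl', hk2'.wreg 5 (by norm_num), h5, true_and, and_true,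
      putW_wreg, Nat.reduceEqDiff, if_false]
    omega
  rintro s4 hwf4 rfl
  refine Ht.seq_wp (c' := 120 * (H + 1) + 20)
    (Q := fun s' => s' = ((s2.putW 13 (T + (r - l))).putW 78 (l + 2 ^ H)).putW 79 (r + 2 ^ H))
    hwf4 ?_ ?_ (by simp [Prog.cost, WExp.cost]; omega)
  · simp only [Prog.wp, WExp.ok, WExp.val, hr', hk2'.wreg 5 (by norm_num), h5, true_and, and_true,
      putW_wreg, Nat.reduceEqDiff, if_false]
    omega
  rintro s5 hwf5 rfl
  generalize hs5 : ((s2.putW 13 (T + (r - l))).putW 78 (l + 2 ^ H)).putW 79 (r + 2 ^ H) = s5 at hwf5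
  have hk5 : Keeps 10 100 [6] [13] s₀ s5 := by
    rw [← hs5]
    exact ((hk2'.putW (by norm_num)).putW (by norm_num)).putW (by norm_num)
  have f10 : s5.wreg 10 = j := by simp [← hs5, hk2.wreg, h10]
  have f11 : s5.wreg 11 = s₀.wmem 0 (base + j) := by simp [← hs5, hk2.wreg]
  have f13 : s5.wreg 13 = T + (r - l) := by simp [← hs5]
  have hp : 0 < 2 ^ H := by positivity
  have hwin' : s₀.IsWindow n base j (l, r) := by
    refine ⟨hl, hr, fun x hx => (hw x hx).trans ?_⟩
    have e4 := hk.rmem 4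
    refine forall₂_congr fun r hr => ?_
    have h4 := hk1.rmem (4 + r) (by simp; omega)
    have h7 := hk1.rmem (7 + r) (by simp; omega)
    rw [State.lhs, State.lhs, h4, h7, hk1.wmem 2 (by simp), hk1.rreg _ (by omega)]
  -- A point occurs at most once at a node, so before point `j` every row has at most `j < n`
  -- entries and room for one more.
  have hone : ∀ v, rowSum H ω (s₀.key base) j v (fun _ => 1) ≤ j := fun v => by
    calc _ ≤ ∑ _t ∈ Finset.range j, 1 := Finset.sum_le_sum fun t ht => by
          rw [mul_one]
          exact count_canon_le ((hwin t (Finset.mem_range.1 ht)).2.1.trans hn) v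
      _ = j := by simp
  refine (appendCanon_spec (n := n) (V := 2 ^ (H + 1)) (d := H + 1) (C := nodes H (l, r))
    (S := rowSum H ω (s₀.key base) j) (y := s₀.key base j) (l := l + 2 ^ H) (r := r + 2 ^ H) hwf5
    (by rw [hk5.wreg 0 (by norm_num), h0]) (by rw [f11, hk5.rmem 6 (by simp)]; rfl)
    (by simp [← hs5]) (by simp [← hs5]) rfl (fun v hv => ?_) (by omega) (fun v hv => ?_) (by omega)
    (by omega) ?_).seq (c' := 5) ?_ (by omega)
  · have := canon_bounds (by omega) hv
    omega
  · have h1 := hone v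
    have h2 : (nodes H (l, r)).count v ≤ 1 := count_canon_le (hr.trans hn) v
    omega
  · have hL' := hL.keep (s' := s5) (by simp [← hs5, hk2.wmem]) (by simp [← hs5, hk2.rmem])
    -- The lower bound kept for the rows is the key of the next point; the cap `n - 1` only matters
    -- after the last point.
    rwa [show min j (n - 1) = j by omega] at hL'
  rintro s6 hwf6 ⟨hk6, hL6⟩
  refine Ht.of_wp hwf6 ?_ (by simp [Prog.cost, WExp.cost])
  have b1 : 1 ≤ W := by omega
  simp only [Prog.wp, WExp.ok, WExp.val, hk6.wreg 10 (by norm_num), f10, true_and, and_true, b1,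
    putW_wreg, if_true]
  refine ⟨by omega, Function.update ω j (l, r), ?_, fun t ht => ?_, ?_, ?_⟩
  · exact (hk5.trans (hk6.mono (by norm_num) le_rfl (List.Subset.refl _)
      (List.Subset.refl _))).putW (by norm_num)
  · rw [Function.update_apply]
    split_ifs with h
    · rwa [h]
    · exact hwin t (by omega)
  · simp only [putW_wreg, Nat.reduceEqDiff, if_false, hk6.wreg 13 (by norm_num), f13]
    rw [Finset.sum_range_succ, Function.update_self]
    congr 1
    exact Finset.sum_congr rfl fun t ht => by
      rw [Function.update_of_ne (Finset.mem_range.1 ht).ne]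
  · have e : rowSum H (Function.update ω j (l, r)) (s₀.key base) (j + 1) = fun v φ =>
        rowSum H ω (s₀.key base) j v φ + (nodes H (l, r)).count v * φ (s₀.key base j) := by
      funext v φ
      rw [rowSum, Finset.sum_range_succ, Function.update_self, ← rowSum,
        rowSum_congr (ω' := ω) fun t ht => Function.update_of_ne ht.ne _ _]
    rw [e]
    refine ⟨hL6.sum, hL6.anti, fun v hv i hi => le_trans (hsort _ _ ?_ ?_) (hL6.low v hv i hi)⟩
    · omega
    · omega

theorem buildRows_spec {W n H base : ℕ} {s₀ : State} (hwf : WF W s₀) (h0 : s₀.wreg 0 = n)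
    (h3 : s₀.wreg 3 = base) (h5 : s₀.wreg 5 = 2 ^ H) (hn : n ≤ 2 ^ H)
    (h6 : ∀ v, s₀.wmem 6 v = 0) (hmono : ∀ r < 2, s₀.Directed r n)
    (hsort : ∀ t t', t ≤ t' → t' < n → s₀.key base t' ≤ s₀.key base t)
    (hW : 2 ^ (H + 1) * n + 2 ^ (H + 1) + n * n + base + 2 * n + 2 ≤ W) :
    Ht W buildRows s₀ (n * (220 * (H + 1) + 140) + 10) fun s =>
      ∃ ω, BuildState n H base s₀ ω n s := by
  refine Ht.seq_wp (c' := n * (220 * (H + 1) + 140) + 8) (Q := fun s => s = s₀.putW 13 0) hwf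
    (by simp [Prog.wp, WExp.ok, WExp.val]) ?_ (by simp [Prog.cost, WExp.cost]; omega)
  rintro s1 hwf1 rfl
  refine Ht.seq_wp (c' := n * (220 * (H + 1) + 140) + 6)
    (Q := fun s => s = (s₀.putW 13 0).putW 10 0) hwf1
    (by simp [Prog.wp, WExp.ok, WExp.val]) ?_ (by simp [Prog.cost, WExp.cost]; omega)
  rintro s2 hwf2 rfl
  refine Ht.loop_count (fun j s => s.wreg 10 = j ∧ ∃ ω, BuildState n H base s₀ ω j s) n
    (fun _ => 220 * (H + 1) + 130) hwf2 ⟨by simp, fun _ => (0, 0),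
    (Keeps.rfl.putW (by norm_num)).putW (by norm_num), by simp, by simp, ?_⟩ ?_ ?_ ?_ ?_
  · refine ⟨fun v _ φ => ?_, fun v _ i i' _ hi => ?_, fun v _ i hi => ?_⟩
    · simp [h6, rowSum]
    · simp [h6] at hi
    · simp [h6] at hi
  · rintro j s - ⟨h10, ω, hs⟩
    simp only [Test.ok, Test.val, WExp.ok, WExp.val, h10, hs.keeps.wreg 0 (by norm_num), h0,
      true_and]
  · rintro j s hj hs ⟨h10, ω, hb⟩
    exact buildRow_spec h0 h3 h5 hn hmono hsort hW hs hj h10 hb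
  · rintro s - ⟨-, h⟩
    exact h
  · simp only [Finset.sum_const, Finset.card_range, smul_eq_mul, Test.cost, WExp.cost]
    ring_nf
    omega


/-! ### The node arrays and the resulting family of matrices -/

/-- Compute the height, the size, and the position of the block of every node. -/
def buildNodes : Prog :=
  .seq (.storeW 10 (.const 0) (.add (.div (.reg 3) (.reg 0)) (.const 1)))
  (.seq (.storeW 9 (.const 0) (.reg 4)) (.seq (.setW 10 (.const 1))
  (.loop (.wlt (.reg 10) (.reg 4))
    (.seq (.storeW 10 (.reg 10) (.sub (.load 10 (.div (.reg 10) (.const 2))) (.const 1)))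
    (.seq (.storeW 9 (.reg 10) (.div (.load 9 (.div (.reg 10) (.const 2))) (.const 2)))
    (.seq (.storeW 8 (.reg 10) (.add (.mul (.load 10 (.reg 10)) (.reg 0))
      (.sub (.mul (.reg 10) (.load 9 (.reg 10))) (.reg 5))))
    (.setW 10 (.add (.reg 10) (.const 1)))))))))

theorem ht_succ {H v : ℕ} (hv : 1 ≤ v) (hvV : v < 2 ^ (H + 1)) : ht H (v / 2) = ht H v + 1 := by
  have h1 := Nat.size_le.2 hvV
  have h2 := size_half hv
  rw [ht, ht]
  omega

theorem mul_pow_ht_le {H v : ℕ} (hv : v < 2 ^ (H + 1)) : v * 2 ^ ht H v ≤ 2 ^ (H + 1) := by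
  have h1 := Nat.size_le.2 hv
  calc v * 2 ^ ht H v ≤ 2 ^ Nat.size v * 2 ^ ht H v :=
        Nat.mul_le_mul_right _ (Nat.lt_size_self v).le
    _ = 2 ^ (H + 1) := by rw [← pow_add, ht, Nat.add_sub_cancel' h1]

/-- The offset of the block of a node. -/
def blockStart (H n v : ℕ) : ℕ := ht H v * n + (v * 2 ^ ht H v - 2 ^ H)

theorem buildNodes_spec {W n H : ℕ} {s₀ : State} (hwf : WF W s₀) (hn : 0 < n)
    (h0 : s₀.wreg 0 = n) (h3 : s₀.wreg 3 = H * n) (h4 : s₀.wreg 4 = 2 ^ (H + 1))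
    (h5 : s₀.wreg 5 = 2 ^ H) (hW : H * n + 2 ^ (H + 1) + H + 2 ≤ W) :
    Ht W buildNodes s₀ (2 ^ (H + 1) * 50 + 30) fun s => Keeps 10 100 [8, 9, 10] [] s₀ s ∧
      (∀ v < 2 ^ (H + 1), s.wmem 9 v = 2 ^ ht H v) ∧
      ∀ v < 2 ^ (H + 1), 1 ≤ v → s.wmem 8 v = blockStart H n v := by
  have hV : 0 < 2 ^ (H + 1) := by positivity
  have b1 : 1 ≤ W := by omega
  have b2 : 2 ≤ W := by omega
  refine Ht.seq_wp (c' := 2 ^ (H + 1) * 50 + 20) (Q := fun s => s = s₀.putWM 10 0 (H + 1)) hwf ?_ ?_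
    (by simp [Prog.cost, WExp.cost]; omega)
  · simp only [Prog.wp, WExp.ok, WExp.val, h3, h0, Nat.mul_div_cancel _ hn, true_and, b1, and_true,
      Nat.zero_le]
    omega
  rintro s1 hwf1 rfl
  refine Ht.seq_wp (c' := 2 ^ (H + 1) * 50 + 10)
    (Q := fun s => s = (s₀.putWM 10 0 (H + 1)).putWM 9 0 (2 ^ (H + 1))) hwf1
    (by simp [Prog.wp, WExp.ok, WExp.val, h4]) ?_ (by simp [Prog.cost, WExp.cost]; omega)
  rintro s2 hwf2 rfl
  refine Ht.seq_wp (c' := 2 ^ (H + 1) * 50 + 5) (Q := fun s =>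
    s = ((s₀.putWM 10 0 (H + 1)).putWM 9 0 (2 ^ (H + 1))).putW 10 1) hwf2
    (by simp [Prog.wp, WExp.ok, WExp.val, b1]) ?_ (by simp [Prog.cost, WExp.cost]; omega)
  rintro s3 hwf3 rfl
  -- Node `0` acts as the parent of the root, so every height and size is obtained from that of node
  -- `v / 2`.
  have hsz0 : ht H 0 = H + 1 := by simp [ht]
  refine Ht.loop_count (fun j s => j ≤ 2 ^ (H + 1) - 1 ∧ Keeps 10 100 [8, 9, 10] [] s₀ s ∧
    s.wreg 10 = j + 1 ∧
    (∀ v < j + 1, s.wmem 10 v = ht H v) ∧ (∀ v < j + 1, s.wmem 9 v = 2 ^ ht H v) ∧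
      ∀ v < j + 1, 1 ≤ v → s.wmem 8 v = blockStart H n v) (2 ^ (H + 1) - 1) (fun _ => 40) hwf3
      ?_ ?_ ?_ ?_ ?_
  · refine ⟨by omega, ((Keeps.rfl.putWM (by simp)).putWM (by simp)).putW (by norm_num), by simp,
      fun v hv => ?_, fun v hv => ?_, fun v hv hv' => by omega⟩
    · obtain rfl : v = 0 := by omega
      simp [hsz0]
    · obtain rfl : v = 0 := by omega
      simp [hsz0]
  · rintro j s - ⟨hj, hk, h10, -⟩
    simp only [Test.ok, Test.val, WExp.ok, WExp.val, h10, hk.wreg 4 (by norm_num), h4, true_and]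
    omega
  · rintro j s hj hs ⟨-, hk, h10, hm10, hm9, hm8⟩
    refine Ht.of_wp hs ?_ (by simp [Prog.cost, WExp.cost])
    have hvV : j + 1 < 2 ^ (H + 1) := by omega
    have e1 := ht_succ (H := H) (v := j + 1) (by omega) hvV
    have e2 : (j + 1) / 2 < j + 1 := by omega
    have e3 : 2 ^ ht H ((j + 1) / 2) / 2 = 2 ^ ht H (j + 1) := by
      rw [e1, pow_succ, Nat.mul_div_cancel _ two_pos]
    have e4 := mul_pow_ht_le hvV
    have e5 : ht H (j + 1) * n ≤ H * n := Nat.mul_le_mul_right n (ht_le (by omega))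
    simp only [Prog.wp, WExp.ok, WExp.val, h10, true_and, and_true, b1, b2, putWM_wreg, putWM_wmem,
      if_true, Nat.reduceEqDiff, if_false, Function.update_self, hm10 _ e2, hm9 _ e2, e3,
      hk.wreg 0 (by norm_num), h0, hk.wreg 5 (by norm_num), h5]
    have e6 : ht H ((j + 1) / 2) - 1 = ht H (j + 1) := by omega
    rw [e6]
    refine ⟨⟨by omega, by omega, by omega⟩, by omega, by omega, ((((hk.putWM (by simp)).putWM
      (by simp)).putWM (by simp)).putW (by norm_num)), by simp, fun v hv => ?_, fun v hv => ?_,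
      fun v hv hv' => ?_⟩
    · simp only [putW_wmem, putWM_wmem, Nat.reduceEqDiff, if_false, if_true, Function.update_apply]
      split_ifs with h
      · rw [h]
      · exact hm10 v (by omega)
    · simp only [putW_wmem, putWM_wmem, Nat.reduceEqDiff, if_false, if_true, Function.update_apply]
      split_ifs with h
      · rw [h]
      · exact hm9 v (by omega)
    · simp only [putW_wmem, putWM_wmem, Nat.reduceEqDiff, if_false, if_true, Function.update_apply]
      split_ifs with h
      · rw [h, blockStart]
      · exact hm8 v (by omega) hv'
  · rintro s - ⟨-, hk, -, -, hm9, hm8⟩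
    exact ⟨hk, fun v hv => hm9 v (by omega), fun v hv => hm8 v (by omega)⟩
  · simp only [Finset.sum_const, Finset.card_range, smul_eq_mul, Test.cost, WExp.cost]
    omega

theorem sum_count_mul {V : ℕ} {L : List ℕ} (hL : ∀ v ∈ L, v < V) (f : ℕ → ℕ) :
    ∑ v ∈ Finset.range V, L.count v * f v = (L.map f).sum := by
  induction L with
  | nil => simp
  | cons a L ih =>
    simp only [List.count_cons, add_mul, Finset.sum_add_distrib, List.map_cons, List.sum_cons]
    rw [ih fun v hv => hL v (List.mem_cons_of_mem _ hv), add_comm]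
    congr 1
    simp only [beq_iff_eq, ite_mul, one_mul, zero_mul]
    rw [Finset.sum_ite_eq, if_pos (Finset.mem_range.2 (hL a List.mem_cons_self))]

/-- The levels of the merge sort of the second set by the objective. -/
structure Levels (n H : ℕ) (s : State) : Prop where
  perm : ∀ h ≤ H, BlockPerm (2 ^ h) n (fun e => s.wmem 2 e) (fun e => s.wmem 2 (h * n + e))
  sorted : ∀ h ≤ H, RunSorted (2 ^ h) n (s.rmem 9) (fun e => s.wmem 2 (h * n + e))

theorem nodes_bounds {H n v : ℕ} {w : ℕ × ℕ} (hn : n ≤ 2 ^ H) (hw : w.2 ≤ n) (hv : v ∈ nodes H w) :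
    1 ≤ v ∧ v < 2 ^ (H + 1) := by
  have hp : 0 < 2 ^ H := by positivity
  have := canon_bounds (by omega) hv
  rw [pow_succ]
  omega

/-- The family of matrices stored in memory. -/
theorem exists_rects {W n H base : ℕ} {s₀ s : State} {ω : ℕ → ℕ × ℕ} (hn : n ≤ 2 ^ H)
    (h0 : s₀.wreg 0 = n) (h4 : s₀.wreg 4 = 2 ^ (H + 1))
    (h9 : ∀ v < 2 ^ (H + 1), s₀.wmem 9 v = 2 ^ ht H v)
    (h8 : ∀ v < 2 ^ (H + 1), 1 ≤ v → s₀.wmem 8 v = blockStart H n v)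
    (hlev : Levels n H s₀) (hW : (H + 1) * n ≤ W) (hs : BuildState n H base s₀ ω n s) :
    ∃ F : Rects, Holds W n F s ∧ F.V = 2 ^ (H + 1) ∧ (∀ v < F.V, F.B v = 2 ^ ht H v) ∧
      ∑ v ∈ Finset.range F.V, F.A v ≤ n * (2 * (H + 1)) ∧
      ∀ p, F.count 1 p = ∑ t ∈ Finset.range n, ∑ x ∈ Finset.Ico (ω t).1 (ω t).2,
        open Classical in if p (s₀.key base t + s₀.rmem 9 (s₀.wmem 2 x)) then (1 : ℕ) else 0 := by
  classical
  have hlt : ∀ t < n, ∀ v ∈ nodes H (ω t), 1 ≤ v ∧ v < 2 ^ (H + 1) := fun t ht v hv =>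
    nodes_bounds hn (hs.windows t ht).2.1 hv
  have hcard : ∀ v < 2 ^ (H + 1), s.wmem 6 v = ∑ t ∈ Finset.range n, (nodes H (ω t)).count v :=
    fun v hv => by rw [hs.listed.card hv]; simp [rowSum]
  have hA : ∀ v < 2 ^ (H + 1), s.wmem 6 v ≤ n := fun v hv => by
    rw [hcard v hv]
    calc _ ≤ ∑ _t ∈ Finset.range n, 1 := Finset.sum_le_sum fun t ht =>
          count_canon_le ((hs.windows t (Finset.mem_range.1 ht)).2.1.trans hn) v
      _ = n := by simp
  -- A node with a nonempty row is canonical for some window; hence its block ends before position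
  -- `n` and is a complete run of its level.
  have hmem : ∀ v < 2 ^ (H + 1), 0 < s.wmem 6 v → 1 ≤ v ∧ 2 ^ (H - ht H v) ≤ v ∧
      (v - 2 ^ (H - ht H v) + 1) * 2 ^ ht H v ≤ n ∧
      blockStart H n v = ht H v * n + (v - 2 ^ (H - ht H v)) * 2 ^ ht H v := by
    intro v hv hpos
    rw [hcard v hv] at hpos
    obtain ⟨t, ht, hc⟩ := Finset.exists_ne_zero_of_sum_ne_zero hpos.ne'
    have ht' := Finset.mem_range.1 ht
    have hvm : v ∈ nodes H (ω t) := List.count_pos_iff.1 (Nat.pos_of_ne_zero hc)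
    have h1 := hlt t ht' v hvm
    obtain ⟨h2, h3⟩ := ht_block h1.1 h1.2
    have h5 := (canon_leaves ((hs.windows t ht').2.1.trans hn) hvm).2
    have h6 := (hs.windows t ht').2.1
    refine ⟨h1.1, h2, ?_, ?_⟩
    · rw [Nat.succ_mul] at h5 ⊢
      omega
    · rw [blockStart, h3, Nat.add_sub_cancel]
  have k2 := hs.keeps.wmem 2 (by simp)
  have k8 := hs.keeps.wmem 8 (by simp)
  have k9 := hs.keeps.wmem 9 (by simp)
  have r9 := hs.keeps.rmem 9 (by simp)
  refine ⟨⟨2 ^ (H + 1), s.wmem 6, fun v => 2 ^ ht H v, fun v i => s.rmem 13 (v * n + i),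
    fun v j => s₀.rmem 9 (s₀.wmem 2 (blockStart H n v + j)), hs.listed.anti,
    fun v hv hpos j j' hjj hj' => ?_⟩,
    ⟨?_, ?_, fun _ _ => rfl, fun v hv => by rw [k9, h9 v hv], fun _ _ _ _ => rfl,
      fun v hv hpos j hj => by rw [r9, k2, k8, h8 v hv (hmem v hv hpos).1],
      fun v hv hpos => ?_, hA⟩, rfl, fun _ _ => rfl, ?_, fun p => ?_⟩
  · obtain ⟨h1, h2, h3, h5⟩ := hmem v hv hpos
    rw [Nat.succ_mul] at h3
    rw [h5, Nat.add_assoc, Nat.add_assoc]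
    refine hlev.sorted _ (ht_le h1) _ _ (by omega) (by omega) ?_
    rw [div_eq_of_mem_block (B := v - 2 ^ (H - ht H v)) rfl (by omega) (by omega),
      div_eq_of_mem_block (B := v - 2 ^ (H - ht H v)) rfl (by omega) (by omega)]
  · rw [hs.keeps.wreg 0 (by norm_num), h0]
  · rw [hs.keeps.wreg 4 (by norm_num), h4]
  · obtain ⟨h1, h2, h3, h5⟩ := hmem v hv hpos
    rw [k8, h8 v hv h1, h5]
    rw [Nat.succ_mul] at h3 hW
    have : ht H v * n ≤ H * n := Nat.mul_le_mul_right n (ht_le h1)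
    change _ + 2 ^ ht H v ≤ W
    omega
  · simp only
    -- Counting the row entries by points instead of nodes: each point lies at no more than `2 * (H
    -- + 1)` nodes.
    rw [Finset.sum_congr rfl fun v hv => hcard v (Finset.mem_range.1 hv), Finset.sum_comm]
    calc _ = ∑ t ∈ Finset.range n, (nodes H (ω t)).length := Finset.sum_congr rfl fun t ht => by
          have := sum_count_mul (fun v hv => (hlt t (Finset.mem_range.1 ht) v hv).2) fun _ => 1
          simpa using this
      _ ≤ ∑ _t ∈ Finset.range n, 2 * (H + 1) := Finset.sum_le_sum fun t _ => length_canon_le _ _ _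
      _ = _ := by simp
  · simp only [Rects.count, cdiv_one, one_mul]
    have h1 : ∀ v ∈ Finset.range (2 ^ (H + 1)), ∑ i ∈ Finset.range (s.wmem 6 v),
        cnt p (fun j => s.rmem 13 (v * n + i) + s₀.rmem 9 (s₀.wmem 2 (blockStart H n v + j)))
          (2 ^ ht H v) = ∑ t ∈ Finset.range n, (nodes H (ω t)).count v *
        cnt p (fun j => s₀.key base t + s₀.rmem 9 (s₀.wmem 2 (blockStart H n v + j)))
          (2 ^ ht H v) := fun v hv =>
      hs.listed.sum v (Finset.mem_range.1 hv) fun y =>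
        cnt p (fun j => y + s₀.rmem 9 (s₀.wmem 2 (blockStart H n v + j))) (2 ^ ht H v)
    rw [Finset.sum_congr rfl h1, Finset.sum_comm]
    refine Finset.sum_congr rfl fun t ht => ?_
    have ht' := Finset.mem_range.1 ht
    rw [sum_count_mul (fun v hv => (hlt t ht' v hv).2) fun v =>
      cnt p (fun j => s₀.key base t + s₀.rmem 9 (s₀.wmem 2 (blockStart H n v + j))) (2 ^ RealRAM.ht H v)]
    have h2 := canon_sum_levels (l := (ω t).1) hn (hs.windows t ht').2.1 hlev.perm
      fun x => if p (s₀.key base t + s₀.rmem 9 x) then (1 : ℕ) else 0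
    rw [← h2, nodes]
    simp only [cnt, blockStart, Nat.add_assoc]

/-- A geometric series, with one unit per term for rounding up. -/
theorem sum_cdiv_pow_le (a M : ℕ) :
    ∑ c ∈ Finset.range M, cdiv a (2 ^ c) ≤ 2 * a + M := by
  have h1 : ∀ c ∈ Finset.range M, cdiv a (2 ^ c) ≤ a / 2 ^ c + 1 := fun c _ => by
    have hp : 0 < 2 ^ c := by positivity
    rw [cdiv_le_iff hp]
    have := Nat.lt_mul_div_succ a hp
    omega
  refine (Finset.sum_le_sum h1).trans ?_
  rw [Finset.sum_add_distrib]
  have := Nat.geom_sum_le (le_refl 2) a M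
  simp at this ⊢
  omega

/-- The rounding loss is proportional to the number of matrices times the number of strides; with
`O(n)` tree nodes and `H + 1` strides it is again `O(n log n)`. -/
theorem Rects.sum_dim_le (F : Rects) (M : ℕ) :
    ∑ c ∈ Finset.range M, F.dim (2 ^ c) ≤ 2 * F.dim 1 + 2 * M * F.V := by
  simp only [Rects.dim, cdiv_one]
  rw [Finset.sum_comm]
  calc _ ≤ ∑ v ∈ Finset.range F.V, (2 * (F.A v + F.B v) + 2 * M) := Finset.sum_le_sum fun v _ => by
        rw [Finset.sum_add_distrib]
        have h1 := sum_cdiv_pow_le (F.A v) M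
        have h2 := sum_cdiv_pow_le (F.B v) M
        omega
    _ = _ := by
      rw [Finset.sum_add_distrib, ← Finset.mul_sum]
      simp
      ring


/-! ### Preparation -/

/-- A linear form with coefficients in two registers, at the current point of a point set. -/
def linExp (a b x : ℕ) : RExp :=
  .add (.mul (.reg a) (.load x (.reg 10))) (.mul (.reg b) (.load (x + 1) (.reg 10)))

/-- The value of `linExp`. -/
noncomputable def State.lin (s : State) (a b x i : ℕ) : ℝ :=
  s.rreg a * s.rmem x i + s.rreg b * s.rmem (x + 1) i

/-- Find a vector parallel to both constraints and its products with the constraints. -/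
def direction : Prog :=
  .seq (.cond (.rlt (.const 0) (.add (.mul (.reg 0) (.reg 0)) (.mul (.reg 1) (.reg 1))))
      (.seq (.setR 16 (.reg 0)) (.setR 17 (.reg 1)))
      (.seq (.setR 16 (.reg 2)) (.setR 17 (.reg 3))))
    (.seq (.setR 14 (.add (.mul (.reg 0) (.reg 16)) (.mul (.reg 1) (.reg 17))))
      (.setR 15 (.add (.mul (.reg 2) (.reg 16)) (.mul (.reg 3) (.reg 17)))))

theorem direction_spec {W : ℕ} {s₀ : State} (hwf : WF W s₀) :
    Ht W direction s₀ 50 fun s => Keeps 100 14 [] [] s₀ s ∧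
      (s.rreg 16 = s₀.rreg 0 ∧ s.rreg 17 = s₀.rreg 1 ∧ 0 < s₀.rreg 0 * s₀.rreg 0 + s₀.rreg 1 * s₀.rreg 1 ∨
       s.rreg 16 = s₀.rreg 2 ∧ s.rreg 17 = s₀.rreg 3 ∧
        ¬ 0 < s₀.rreg 0 * s₀.rreg 0 + s₀.rreg 1 * s₀.rreg 1) ∧
      s.rreg 14 = s₀.rreg 0 * s.rreg 16 + s₀.rreg 1 * s.rreg 17 ∧
      s.rreg 15 = s₀.rreg 2 * s.rreg 16 + s₀.rreg 3 * s.rreg 17 := by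
  refine Ht.of_wp hwf ?_ (by simp [direction, Prog.cost, RExp.cost, Test.cost])
  simp only [direction, Prog.wp, RExp.ok, RExp.val, Test.ok, Test.val, true_and, and_true,
    Rat.cast_zero, putR_rreg, Nat.reduceEqDiff, if_false, if_true]
  refine ⟨fun h => ⟨?_, Or.inl h⟩,
    fun h => ⟨?_, Or.inr h⟩⟩
  all_goals
    exact (((Keeps.rfl.putR (by norm_num)).putR (by norm_num)).putR (by norm_num)).putR (by norm_num)

/-- Evaluate the linear forms at all points and initialise the orders. -/
def evaluate : Prog :=
  .seq (.setW 10 (.const 0)) (.loop (.wlt (.reg 10) (.reg 0))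
    (.seq (.storeR 4 (.reg 10) (linExp 0 1 0)) (.seq (.storeR 5 (.reg 10) (linExp 2 3 0))
    (.seq (.storeR 6 (.reg 10) (linExp 6 7 0)) (.seq (.storeR 7 (.reg 10) (linExp 0 1 2))
    (.seq (.storeR 8 (.reg 10) (linExp 2 3 2)) (.seq (.storeR 9 (.reg 10) (linExp 6 7 2))
    (.seq (.storeR 10 (.reg 10) (linExp 16 17 2)) (.seq (.storeW 0 (.reg 10) (.reg 10))
    (.seq (.storeW 1 (.reg 10) (.reg 10)) (.setW 10 (.add (.reg 10) (.const 1)))))))))))))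

/-- The values of the linear forms. -/
structure Evaluated (s₀ : State) (j : ℕ) (s : State) : Prop where
  a₀P : ∀ i < j, s.rmem 4 i = s₀.lin 0 1 0 i
  a₁P : ∀ i < j, s.rmem 5 i = s₀.lin 2 3 0 i
  fP : ∀ i < j, s.rmem 6 i = s₀.lin 6 7 0 i
  a₀Q : ∀ i < j, s.rmem 7 i = s₀.lin 0 1 2 i
  a₁Q : ∀ i < j, s.rmem 8 i = s₀.lin 2 3 2 i
  fQ : ∀ i < j, s.rmem 9 i = s₀.lin 6 7 2 i
  uQ : ∀ i < j, s.rmem 10 i = s₀.lin 16 17 2 i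

theorem evaluate_spec {W n : ℕ} {s₀ : State} (hwf : WF W s₀) (h0 : s₀.wreg 0 = n)
    (hW : n + 1 ≤ W) : Ht W evaluate s₀ (150 * n + 10) fun s =>
      Keeps 10 100 [0, 1] [4, 5, 6, 7, 8, 9, 10] s₀ s ∧ Evaluated s₀ n s ∧
      (∀ i < n, s.wmem 0 i = i) ∧ ∀ i < n, s.wmem 1 i = i := by
  refine Ht.seq_wp (c' := 150 * n + 8) (Q := fun s => s = s₀.putW 10 0) hwf
    (by simp [Prog.wp, WExp.ok, WExp.val]) ?_ (by simp [Prog.cost, WExp.cost]; omega)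
  rintro s1 hwf1 rfl
  refine Ht.loop_count (fun j s => s.wreg 10 = j ∧
      Keeps 10 100 [0, 1] [4, 5, 6, 7, 8, 9, 10] s₀ s ∧ Evaluated s₀ j s ∧
      (∀ i < j, s.wmem 0 i = i) ∧ ∀ i < j, s.wmem 1 i = i) n (fun _ => 140) hwf1 ?_ ?_ ?_ ?_ ?_
  · exact ⟨by simp, Keeps.rfl.putW (by norm_num), ⟨by simp, by simp, by simp, by simp, by simp,
      by simp, by simp⟩, by simp, by simp⟩
  · rintro j s - ⟨h10, hk, -⟩
    simp only [Test.ok, Test.val, WExp.ok, WExp.val, h10, hk.wreg 0 (by norm_num), h0, true_and]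
  · rintro j s hj hs ⟨h10, hk, ⟨h1, h2, h3, h4, h5, h6, h7⟩, h8, h9⟩
    refine Ht.of_wp hs ?_ (by simp [Prog.cost, WExp.cost, RExp.cost, linExp])
    have m0 := hk.rmem 0 (by simp)
    have m1 := hk.rmem 1 (by simp)
    have m2 := hk.rmem 2 (by simp)
    have m3 := hk.rmem 3 (by simp)
    have b1 : 1 ≤ W := by omega
    simp only [linExp, Prog.wp, WExp.ok, WExp.val, RExp.ok, RExp.val, true_and, and_true, b1,
      putRM_wreg, putWM_wreg, putRM_rreg, putRM_rmem, Nat.reduceAdd, Nat.reduceEqDiff, if_false,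
      zero_add, h10, m0, m1, m2, m3, hk.rreg 0 (by norm_num), hk.rreg 1 (by norm_num),
      hk.rreg 2 (by norm_num), hk.rreg 3 (by norm_num), hk.rreg 6 (by norm_num),
      hk.rreg 7 (by norm_num), hk.rreg 16 (by norm_num), hk.rreg 17 (by norm_num),
      OfNat.zero_ne_ofNat, OfNat.one_ne_ofNat]
    have aux : ∀ (f g : ℕ → ℝ), (∀ i < j, f i = g i) → ∀ i < j + 1,
        Function.update f j (g j) i = g i := by
      intro f g hfg i hi
      rw [Function.update_apply]
      split_ifs with h
      · rw [h]
      · exact hfg i (by omega)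
    have aux' : ∀ f : ℕ → ℕ, (∀ i < j, f i = i) → ∀ i < j + 1, Function.update f j j i = i := by
      intro f hf i hi
      rw [Function.update_apply]
      split_ifs with h
      · rw [h]
      · exact hf i (by omega)
    refine ⟨by omega, by simp, ?_, ⟨?_, ?_, ?_, ?_, ?_, ?_, ?_⟩, ?_, ?_⟩
    · refine Keeps.putW (Keeps.putWM (Keeps.putWM ?_ (by simp)) (by simp)) (by norm_num)
      exact ((((((hk.putRM (by simp)).putRM (by simp)).putRM (by simp)).putRM (by simp)).putRM
        (by simp)).putRM (by simp)).putRM (by simp)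
    · simpa [State.lin] using aux _ _ h1
    · simpa [State.lin] using aux _ _ h2
    · simpa [State.lin] using aux _ _ h3
    · simpa [State.lin] using aux _ _ h4
    · simpa [State.lin] using aux _ _ h5
    · simpa [State.lin] using aux _ _ h6
    · simpa [State.lin] using aux _ _ h7
    · simpa using aux' _ h8
    · simpa using aux' _ h9
  · rintro s - ⟨-, h⟩
    exact h
  · simp only [Finset.sum_const, Finset.card_range, smul_eq_mul, Test.cost, WExp.cost]
    omega

/-- Sort the first `wreg 0` indices in the array `a` by the keys `K`, keeping all levels. -/
def sortBy (a K : ℕ) : Prog :=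
  .seq (.seq (.setW 60 (.reg 0)) (.seq (.setW 70 (.const 0)) (.seq (.setW 71 (.reg 0))
    (.seq (.setW 72 (.const 1)) (.setW 73 (.reg 0)))))) (passes a K)

/-- The result of sorting. -/
structure SortState (a K n H : ℕ) (s₀ s : State) : Prop where
  keeps : Keeps 60 100 [a] [] s₀ s
  low : ∀ x < n, s.wmem a x = s₀.wmem a x
  r70 : s.wreg 70 = H * n
  r72 : s.wreg 72 = 2 ^ H
  perm : ∀ h ≤ H, BlockPerm (2 ^ h) n (s₀.wmem a) (fun e => s.wmem a (h * n + e))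
  sorted : ∀ h ≤ H, RunSorted (2 ^ h) n (s₀.rmem K) (fun e => s.wmem a (h * n + e))

theorem sortBy_spec {W a K n H : ℕ} {s₀ : State} (hH : Nat.clog 2 n = H) (hwf : WF W s₀) (h0 : s₀.wreg 0 = n)
    (hW : (H + 1) * n + n * 2 + 2 ≤ W) :
    Ht W (sortBy a K) s₀ (H * (70 * n + 50) + 30)
      (SortState a K n H s₀) := by
  subst hH
  have b1 : 1 ≤ W := by omega
  refine Ht.seq_wp (c' := Nat.clog 2 n * (70 * n + 50) + 10) (Q := fun s => s =
    ((((s₀.putW 60 n).putW 70 0).putW 71 n).putW 72 1).putW 73 n) hwf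
    (by simp [Prog.wp, WExp.ok, WExp.val, h0, b1]) ?_ (by simp [Prog.cost, WExp.cost]; omega)
  rintro s1 hwf1 rfl
  refine (passes_spec (base := 0) (m := n) (lim := n) hwf1 (by simp) (by simp) (by simp) (by simp)
    (by simp) (by omega)).mono le_rfl ?_
  rintro s - hs
  refine ⟨Keeps.trans ?_ (hs.keeps.mono (by norm_num) le_rfl (List.Subset.refl _)
    (List.Subset.refl _)), fun x hx => hs.mem_low x (by omega), ?_, hs.r72, fun h hh => ?_,
    fun h hh => ?_⟩
  · exact ((((Keeps.rfl.putW (by norm_num)).putW (by norm_num)).putW (by norm_num)).putW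
      (by norm_num)).putW (by norm_num)
  · rw [hs.r70, zero_add]
  · have h1 := (hs.level h hh).1
    simp only [zero_add] at h1
    exact h1
  · have h1 := (hs.level h hh).2
    simp only [zero_add] at h1
    exact h1

/-- Copy the sorted order in the array `1` to the array `2`. -/
def copyOrder : Prog :=
  .seq (.setW 10 (.const 0)) (.loop (.wlt (.reg 10) (.reg 0))
    (.seq (.storeW 2 (.reg 10) (.load 1 (.add (.reg 3) (.reg 10))))
      (.setW 10 (.add (.reg 10) (.const 1)))))

theorem copyOrder_spec {W n base : ℕ} {s₀ : State} (hwf : WF W s₀) (h0 : s₀.wreg 0 = n)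
    (h3 : s₀.wreg 3 = base) (hW : base + n + 1 ≤ W) : Ht W copyOrder s₀ (25 * n + 10) fun s =>
      Keeps 10 100 [2] [] s₀ s ∧ ∀ i < n, s.wmem 2 i = s₀.wmem 1 (base + i) := by
  refine Ht.seq_wp (c' := 25 * n + 8) (Q := fun s => s = s₀.putW 10 0) hwf
    (by simp [Prog.wp, WExp.ok, WExp.val]) ?_ (by simp [Prog.cost, WExp.cost]; omega)
  rintro s1 hwf1 rfl
  refine Ht.loop_count (fun j s => s.wreg 10 = j ∧ Keeps 10 100 [2] [] s₀ s ∧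
    ∀ i < j, s.wmem 2 i = s₀.wmem 1 (base + i)) n (fun _ => 15) hwf1
    ⟨by simp, Keeps.rfl.putW (by norm_num), by simp⟩ ?_ ?_ ?_ ?_
  · rintro j s - ⟨h10, hk, -⟩
    simp only [Test.ok, Test.val, WExp.ok, WExp.val, h10, hk.wreg 0 (by norm_num), h0, true_and]
  · rintro j s hj hs ⟨h10, hk, h2⟩
    refine Ht.of_wp hs ?_ (by simp [Prog.cost, WExp.cost])
    have b1 : 1 ≤ W := by omega
    simp only [Prog.wp, WExp.ok, WExp.val, true_and, and_true, b1, putWM_wreg, h10,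
      hk.wreg 3 (by norm_num), h3, hk.wmem 1 (by simp)]
    refine ⟨by omega, by omega, by simp, (hk.putWM (by simp)).putW (by norm_num), fun i hi => ?_⟩
    simp only [putW_wmem, putWM_wmem, if_true, Function.update_apply]
    split_ifs with h
    · rw [h]
    · exact h2 i (by omega)
  · rintro s - ⟨-, h⟩
    exact h
  · simp only [Finset.sum_const, Finset.card_range, smul_eq_mul, Test.cost, WExp.cost]
    omega

theorem BlockPerm.symm {w m : ℕ} {σ τ : ℕ → ℕ} (h : BlockPerm w m σ τ) : BlockPerm w m τ σ :=
  fun φ => (h φ).symm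

theorem BlockPerm.congr {w m : ℕ} {σ σ' τ : ℕ → ℕ} (h : BlockPerm w m σ τ)
    (h' : ∀ e < m, σ e = σ' e) : BlockPerm w m σ' τ := fun φ => by
  rw [h φ]
  exact Finset.sum_congr rfl fun e he => by rw [h' e (Finset.mem_range.1 he)]

theorem RunSorted.of_le {w m : ℕ} {κ : ℕ → ℝ} {σ : ℕ → ℕ} (h : RunSorted w m κ σ) (hm : m ≤ w) :
    ∀ o o', o ≤ o' → o' < m → κ (σ o') ≤ κ (σ o) := fun o o' ho ho' =>
  h o o' ho ho' (by rw [Nat.div_eq_of_lt (by omega), Nat.div_eq_of_lt (by omega)])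

/-- Sort the points and set up the parameters of the tree. -/
def arrange : Prog :=
  .seq direction (.seq evaluate (.seq (sortBy 0 6) (.seq (.setW 3 (.reg 70)) (.seq
    (.setW 5 (.reg 72)) (.seq (.setW 4 (.mul (.reg 5) (.const 2))) (.seq (sortBy 1 10)
    (.seq copyOrder (sortBy 2 9))))))))

/-- The state after `arrange`. -/
structure Arranged (n H : ℕ) (s₀ s : State) : Prop where
  r0 : s.wreg 0 = n
  r1 : s.wreg 1 = s₀.wreg 1
  r3 : s.wreg 3 = H * n
  r4 : s.wreg 4 = 2 ^ (H + 1)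
  r5 : s.wreg 5 = 2 ^ H
  rreg : ∀ i < 8, s.rreg i = s₀.rreg i
  m6 : s.wmem 6 = s₀.wmem 6
  dir : s.rreg 16 = s₀.rreg 0 ∧ s.rreg 17 = s₀.rreg 1 ∧
        0 < s₀.rreg 0 * s₀.rreg 0 + s₀.rreg 1 * s₀.rreg 1 ∨
      s.rreg 16 = s₀.rreg 2 ∧ s.rreg 17 = s₀.rreg 3 ∧
        ¬ 0 < s₀.rreg 0 * s₀.rreg 0 + s₀.rreg 1 * s₀.rreg 1
  dir₀ : s.rreg 14 = s₀.rreg 0 * s.rreg 16 + s₀.rreg 1 * s.rreg 17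
  dir₁ : s.rreg 15 = s₀.rreg 2 * s.rreg 16 + s₀.rreg 3 * s.rreg 17
  input : ∀ a < 4, s.rmem a = s₀.rmem a
  values : Evaluated s n s
  permP : BlockPerm (2 ^ H) n (fun e => e) (fun e => s.wmem 0 (H * n + e))
  sortP : ∀ t t', t ≤ t' → t' < n → s.key (H * n) t' ≤ s.key (H * n) t
  permQ : BlockPerm (2 ^ H) n (fun e => e) (fun e => s.wmem 2 e)
  sortQ : ∀ x y, x ≤ y → y < n → s.rmem 10 (s.wmem 2 y) ≤ s.rmem 10 (s.wmem 2 x)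
  levels : Levels n H s

/-- `P` is sorted by the objective in array `0`, and `Q` by the direction in array `1`. The
resulting order of `Q` becomes the start of array `2`, which is then merge sorted by the objective.
Thus level `h` of that array treats blocks of `2 ^ h` positions that are consecutive along the
direction. -/
theorem arrange_spec {W n H : ℕ} {s₀ : State} (hH : Nat.clog 2 n = H) (hwf : WF W s₀)
    (h0 : s₀.wreg 0 = n) (hW : (H + 1) * n + n * 2 + 2 ^ (H + 1) + 2 ≤ W) :
    Ht W arrange s₀ (3 * (H * (70 * n + 50)) + 175 * n + 200) (Arranged n H s₀) := by
  have hn : n ≤ 2 ^ H := hH ▸ Nat.le_pow_clog one_lt_two n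
  have hbn : (H + 1) * n = H * n + n := Nat.succ_mul _ _
  have hpow : 2 ^ (H + 1) = 2 ^ H * 2 := pow_succ 2 H
  refine (direction_spec hwf).seq (c' := 3 * (H * (70 * n + 50)) + 175 * n + 150) ?_ (by omega)
  rintro s1 hwf1 ⟨hk1, hd, hd0, hd1⟩
  refine (evaluate_spec (n := n) hwf1 (by rw [hk1.wreg 0 (by norm_num), h0]) (by omega)).seq
    (c' := 3 * (H * (70 * n + 50)) + 25 * n + 140) ?_ (by omega)
  rintro s2 hwf2 ⟨hk2, hE, ho0, ho1⟩
  have e20 : s2.wreg 0 = n := by rw [hk2.wreg 0 (by norm_num), hk1.wreg 0 (by norm_num), h0]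
  refine (sortBy_spec (a := 0) (K := 6) hH hwf2 e20 (by omega)).seq
    (c' := 2 * (H * (70 * n + 50)) + 25 * n + 110) ?_ (by omega)
  rintro s3 hwf3 h3
  refine Ht.seq_wp (c' := 2 * (H * (70 * n + 50)) + 25 * n + 105)
    (Q := fun s => s = s3.putW 3 (H * n)) hwf3
    (by simp [Prog.wp, WExp.ok, WExp.val, h3.r70]) ?_ (by simp [Prog.cost, WExp.cost]; omega)
  rintro s4 hwf4 rfl
  refine Ht.seq_wp (c' := 2 * (H * (70 * n + 50)) + 25 * n + 100)
    (Q := fun s => s = (s3.putW 3 (H * n)).putW 5 (2 ^ H)) hwf4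
    (by simp [Prog.wp, WExp.ok, WExp.val, h3.r72]) ?_ (by simp [Prog.cost, WExp.cost]; omega)
  rintro s5 hwf5 rfl
  have b2 : 2 ≤ W := by omega
  refine Ht.seq_wp (c' := 2 * (H * (70 * n + 50)) + 25 * n + 90)
    (Q := fun s => s = ((s3.putW 3 (H * n)).putW 5 (2 ^ H)).putW 4 (2 ^ (H + 1))) hwf5
    (by simp [Prog.wp, WExp.ok, WExp.val, b2, ← hpow]; omega) ?_
    (by simp [Prog.cost, WExp.cost]; omega)
  rintro s6 hwf6 hs6
  have g0 : s6.wreg 0 = n := by simp [hs6, h3.keeps.wreg, e20]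
  have g1 : s6.wreg 1 = s₀.wreg 1 := by simp [hs6, h3.keeps.wreg, hk2.wreg, hk1.wreg]
  have g3 : s6.wreg 3 = H * n := by simp [hs6]
  have g4 : s6.wreg 4 = 2 ^ (H + 1) := by simp [hs6]
  have g5 : s6.wreg 5 = 2 ^ H := by simp [hs6]
  have gw : s6.wmem = s3.wmem := by simp [hs6]
  have gr : s6.rmem = s3.rmem := by simp [hs6]
  have gg : s6.rreg = s3.rreg := by simp [hs6]
  clear hs6
  refine (sortBy_spec (a := 1) (K := 10) hH hwf6 g0 (by omega)).seq
    (c' := H * (70 * n + 50) + 25 * n + 60) ?_ (by omega)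
  rintro s7 hwf7 h7
  refine (copyOrder_spec (n := n) (base := H * n) hwf7 (by rw [h7.keeps.wreg 0 (by norm_num), g0])
    (by rw [h7.keeps.wreg 3 (by norm_num), g3]) (by omega)).seq
    (c' := H * (70 * n + 50) + 50) ?_ (by omega)
  rintro s8 hwf8 ⟨hk8, h8⟩
  refine (sortBy_spec (a := 2) (K := 9) hH hwf8 (by
    rw [hk8.wreg 0 (by norm_num), h7.keeps.wreg 0 (by norm_num), g0]) (by omega)).mono (by omega) ?_
  rintro s9 - h9
  have hk9 : Keeps 10 100 [1, 2] [] s6 s9 :=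
    ((h7.keeps.mono (by norm_num) le_rfl (by simp) (by simp)).trans
      (hk8.mono le_rfl le_rfl (by simp) (by simp))).trans
      (h9.keeps.mono (by norm_num) le_rfl (by simp) (by simp))
  have R : ∀ a, s9.rmem a = s2.rmem a := fun a => by
    rw [hk9.rmem a List.not_mem_nil, gr, h3.keeps.rmem a List.not_mem_nil]
  have RR : ∀ i < 100, s9.rreg i = s1.rreg i := fun i hi => by
    rw [hk9.rreg i hi, gg, h3.keeps.rreg i hi, hk2.rreg i hi]
  have R1 : ∀ a < 4, s9.rmem a = s1.rmem a := fun a ha => by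
    rw [R, hk2.rmem a (by simp; omega)]
  have R7 : ∀ a, s6.rmem a = s9.rmem a := fun a => (hk9.rmem a List.not_mem_nil).symm
  have R8 : ∀ a, s8.rmem a = s9.rmem a := fun a => (h9.keeps.rmem a List.not_mem_nil).symm
  have hlin : ∀ a b x i, a < 100 → b < 100 → x < 3 → s9.lin a b x i = s1.lin a b x i := by
    intro a b x i ha hb hx
    rw [State.lin, State.lin, RR a ha, RR b hb, R1 x (by omega), R1 (x + 1) (by omega)]
  have w0 : s9.wmem 0 = s3.wmem 0 := by rw [hk9.wmem 0 (by simp), gw]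
  have w2 : ∀ x < n, s9.wmem 2 x = s7.wmem 1 (H * n + x) := fun x hx => by
    rw [h9.low x hx, h8 x hx]
  have w6 : ∀ i < n, s6.wmem 1 i = i := fun i hi => by
    rw [gw, h3.keeps.wmem 1 (by simp), ho1 i hi]
  refine ⟨by rw [hk9.wreg 0 (by norm_num), g0], by rw [hk9.wreg 1 (by norm_num), g1],
    by rw [hk9.wreg 3 (by norm_num), g3], by rw [hk9.wreg 4 (by norm_num), g4],
    by rw [hk9.wreg 5 (by norm_num), g5], fun i hi => ?_, ?_, ?_, ?_, ?_, fun a ha => ?_,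
    ?_, ?_, fun t t' htt ht => ?_, ?_, fun x y hxy hy => ?_, ⟨fun h hh => ?_, fun h hh => ?_⟩⟩
  · rw [RR i (by omega), hk1.rreg i (by omega)]
  · rw [hk9.wmem 6 (by simp), gw, h3.keeps.wmem 6 (by simp), hk2.wmem 6 (by simp),
      hk1.wmem 6 (by simp)]
  · rw [RR 16 (by norm_num), RR 17 (by norm_num)]
    exact hd
  · rw [RR 14 (by norm_num), RR 16 (by norm_num), RR 17 (by norm_num), hd0]
  · rw [RR 15 (by norm_num), RR 16 (by norm_num), RR 17 (by norm_num), hd1]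
  · rw [R1 a ha, hk1.rmem a List.not_mem_nil]
  · obtain ⟨h1, h2, h3, h4, h5, h6, h7⟩ := hE
    refine ⟨fun i hi => ?_, fun i hi => ?_, fun i hi => ?_, fun i hi => ?_, fun i hi => ?_,
      fun i hi => ?_, fun i hi => ?_⟩
    all_goals rw [R, hlin _ _ _ _ (by norm_num) (by norm_num) (by norm_num)]
    · exact h1 i hi
    · exact h2 i hi
    · exact h3 i hi
    · exact h4 i hi
    · exact h5 i hi
    · exact h6 i hi
    · exact h7 i hi
  · rw [w0]
    exact (h3.perm H le_rfl).congr ho0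
  · rw [State.key, State.key, w0, R]
    exact (h3.sorted H le_rfl).of_le hn t t' htt ht
  · refine BlockPerm.symm (BlockPerm.congr (BlockPerm.symm ((h7.perm H le_rfl).congr w6)) ?_)
    intro e he
    rw [w2 e he]
  · rw [w2 x (by omega), w2 y hy, ← R7]
    exact (h7.sorted H le_rfl).of_le hn x y hxy hy
  · exact (h9.perm h hh).congr fun e he => (h9.low e he).symm
  · rw [← R8]
    exact h9.sorted h hh


/-! ### Correctness of the representation -/

/-- Parallelism gives `|(u, v)|² (a, b) = (a u + b v) (u, v)`, so the two linear forms are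
proportional and the sign of `a u + b v` decides the sense. For `(u, v) = 0` the form `(a, b)`
vanishes by `h0`. -/
theorem parallel_mono {a b u v x y x' y' : ℝ} (hp : a * v = b * u)
    (h0 : u * u + v * v = 0 → a = 0 ∧ b = 0) (h : u * x' + v * y' ≤ u * x + v * y) :
    (a * u + b * v < 0 → a * x + b * y ≤ a * x' + b * y') ∧
      (¬ a * u + b * v < 0 → a * x' + b * y' ≤ a * x + b * y) := by
  have key : (u * u + v * v) * (a * (x - x') + b * (y - y')) =
      (a * u + b * v) * (u * (x - x') + v * (y - y')) := by
    linear_combination (v * (x - x') - u * (y - y')) * hp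
  rcases (add_nonneg (mul_self_nonneg u) (mul_self_nonneg v)).eq_or_lt with h1 | h1
  · obtain ⟨rfl, rfl⟩ := h0 h1.symm
    simp
  · have h2 : 0 ≤ u * (x - x') + v * (y - y') := by linarith
    refine ⟨fun h3 => ?_, fun h3 => ?_⟩
    · have : a * (x - x') + b * (y - y') ≤ 0 := by
        by_contra! h4
        have := mul_pos h1 h4
        have := mul_nonneg (neg_nonneg.2 h3.le) h2
        linarith
      linarith
    · have : 0 ≤ a * (x - x') + b * (y - y') := by
        by_contra! h4
        have := mul_pos_of_neg_of_neg (neg_lt_zero.2 h1) h4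
        have := mul_nonneg (not_lt.1 h3) h2
        linarith
      linarith

/-- The direction is the first normal, or the second one if the first is zero; it therefore vanishes
only if both normals do, which is what `parallel_mono` asks for. -/
theorem Arranged.directed {n H : ℕ} {s₀ s : State} (h : Arranged n H s₀ s)
    (hdet : s₀.rreg 0 * s₀.rreg 3 - s₀.rreg 1 * s₀.rreg 2 = 0) : ∀ r < 2, s.Directed r n := by
  intro r hr i x y hxy hy
  have hlt : ∀ e < n, s.wmem 2 e < n := h.permQ.forall (p := fun x => x < n) fun e he => he
  have hu := h.sortQ x y hxy hy
  rw [h.values.uQ _ (hlt x (by omega)), h.values.uQ _ (hlt y hy), State.lin, State.lin] at hu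
  have d0 := h.dir₀
  have d1 := h.dir₁
  rw [← h.rreg 0 (by norm_num), ← h.rreg 1 (by norm_num)] at d0
  rw [← h.rreg 2 (by norm_num), ← h.rreg 3 (by norm_num)] at d1
  have hd := h.dir
  rw [← h.rreg 0 (by norm_num), ← h.rreg 1 (by norm_num), ← h.rreg 2 (by norm_num),
    ← h.rreg 3 (by norm_num)] at hd hdet
  have z0 : s.rreg 0 * s.rreg 0 + s.rreg 1 * s.rreg 1 = 0 → s.rreg 0 = 0 ∧ s.rreg 1 = 0 := by
    intro hz
    constructor <;> nlinarith [mul_self_nonneg (s.rreg 0), mul_self_nonneg (s.rreg 1)]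
  have z1 : s.rreg 2 * s.rreg 2 + s.rreg 3 * s.rreg 3 = 0 → s.rreg 2 = 0 ∧ s.rreg 3 = 0 := by
    intro hz
    constructor <;> nlinarith [mul_self_nonneg (s.rreg 2), mul_self_nonneg (s.rreg 3)]
  have z2 : ¬ 0 < s.rreg 0 * s.rreg 0 + s.rreg 1 * s.rreg 1 → s.rreg 0 = 0 ∧ s.rreg 1 = 0 :=
    fun hz => z0 (le_antisymm (not_lt.1 hz) (add_nonneg (mul_self_nonneg _) (mul_self_nonneg _)))
  interval_cases r
  · have hp : s.rreg 0 * s.rreg 17 = s.rreg 1 * s.rreg 16 := by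
      rcases hd with ⟨e1, e2, -⟩ | ⟨e1, e2, -⟩ <;> rw [e1, e2] <;> linarith
    have := parallel_mono hp (fun hz => by
      rcases hd with ⟨e1, e2, -⟩ | ⟨e1, e2, hd⟩
      · rw [e1, e2] at hz; exact z0 hz
      · exact z2 hd) hu
    simp only [State.lhs, Nat.add_zero, h.values.a₀Q _ (hlt x (by omega)),
      h.values.a₀Q _ (hlt y hy), State.lin, d0]
    exact ⟨fun h1 => by linarith [this.1 h1], fun h1 => by linarith [this.2 h1]⟩
  · have hp : s.rreg 2 * s.rreg 17 = s.rreg 3 * s.rreg 16 := by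
      rcases hd with ⟨e1, e2, -⟩ | ⟨e1, e2, -⟩ <;> rw [e1, e2] <;> linarith
    have := parallel_mono hp (fun hz => by
      rcases hd with ⟨e1, e2, hd⟩ | ⟨e1, e2, hd⟩
      · rw [e1, e2] at hz; exact absurd hz hd.ne'
      · rw [e1, e2] at hz; exact z1 hz) hu
    simp only [State.lhs, Nat.reduceAdd, h.values.a₁Q _ (hlt x (by omega)),
      h.values.a₁Q _ (hlt y hy), State.lin, d1]
    exact ⟨fun h1 => by linarith [this.1 h1], fun h1 => by linarith [this.2 h1]⟩

/-- The condition that a pair of points is feasible with an objective value satisfying `p`. -/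
def State.Good (s : State) (p : ℝ → Prop) (i j : ℕ) : Prop :=
  (∀ r < 2, ¬ s.rmem (4 + r) i + s.rmem (7 + r) j < s.rreg (4 + r)) ∧ p (s.rmem 6 i + s.rmem 9 j)

-- Both orders are permutations of the indices, so sums over sorted positions are sums over the
-- original points, and membership in a window is feasibility of the pair.
open Classical in
theorem sum_windows {n H : ℕ} {s₀ s : State} (h : Arranged n H s₀ s) {ω : ℕ → ℕ × ℕ}
    (hω : ∀ t < n, s.IsWindow n (H * n) t (ω t)) (p : ℝ → Prop) :
    (∑ t ∈ Finset.range n, ∑ x ∈ Finset.Ico (ω t).1 (ω t).2,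
      if p (s.key (H * n) t + s.rmem 9 (s.wmem 2 x)) then (1 : ℕ) else 0) =
      ∑ i ∈ Finset.range n, ∑ j ∈ Finset.range n, if s.Good p i j then (1 : ℕ) else 0 := by
  have h1 := h.permP.sum fun i => ∑ j ∈ Finset.range n, if s.Good p i j then (1 : ℕ) else 0
  rw [← h1]
  refine Finset.sum_congr rfl fun t ht => ?_
  have ht' := Finset.mem_range.1 ht
  have h2 := h.permQ.sum fun j => if s.Good p (s.wmem 0 (H * n + t)) j then (1 : ℕ) else 0
  rw [← h2]
  obtain ⟨-, hr, hw⟩ := hω t ht'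
  have e : Finset.Ico (ω t).1 (ω t).2 =
      (Finset.range n).filter fun x => (ω t).1 ≤ x ∧ x < (ω t).2 := by
    ext x
    simp only [Finset.mem_Ico, Finset.mem_filter, Finset.mem_range]
    omega
  rw [e, Finset.sum_filter]
  refine Finset.sum_congr rfl fun x hx => ?_
  rw [← ite_and]
  exact if_congr (and_congr (hw x (Finset.mem_range.1 hx)) Iff.rfl) rfl rfl

open Classical in
/-- Counting in the constrained Minkowski sum. -/
theorem countP_selection {n : ℕ} (A : Matrix (Fin 2) (Fin 2) ℝ) (b f : Fin 2 → ℝ)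
    (P Q : Fin n → Fin 2 → ℝ) (p : ℝ → Prop) :
    ((constrainedMinkowskiSum A b (familyMultiset P) (familyMultiset Q)).map
      fun r => f 0 * r 0 + f 1 * r 1).countP p = ∑ i : Fin n, ∑ j : Fin n,
      if A.mulVec (P i + Q j) ≥ b ∧ p (f 0 * (P i + Q j) 0 + f 1 * (P i + Q j) 1)
        then (1 : ℕ) else 0 := by
  have e : familyMultiset P ×ˢ familyMultiset Q =
      ((Finset.univ : Finset (Fin n × Fin n)).val.map fun z => (P z.1, Q z.2)) := by
    rw [familyMultiset, familyMultiset, ← Finset.univ_product_univ, Finset.product_val]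
    change Multiset.product _ _ = Multiset.map _ (Multiset.product _ _)
    simp only [Multiset.product, Multiset.map_bind, Multiset.bind_map, Multiset.map_map]
    rfl
  rw [constrainedMinkowskiSum, Multiset.countP_map, Multiset.filter_filter, e, Multiset.map_map,
    Multiset.filter_map, Multiset.card_map, ← Finset.filter_val, Finset.card_val,
    Finset.card_filter, Fintype.sum_prod_type]
  simp only [Function.comp, and_comm]

/-! ### The `k`-th largest element characterised by counts. -/

theorem kthLargest_eq_none {M : Multiset ℝ} {k : ℕ} (hk : 1 ≤ k) (h : M.card < k) :
    kthLargest M k = none := by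
  rw [kthLargest, List.getElem?_eq_none_iff, Multiset.length_sort]
  omega

-- In the descending list no entry from position `k - 1` on exceeds the one there, and the first `k`
-- entries are all at least as large. Because of ties only these two inequalities are available,
-- which is the form used in `Rects.IsAnswer`.
open Classical in
theorem exists_kthLargest {M : Multiset ℝ} {k : ℕ} (hk : 1 ≤ k) (h : k ≤ M.card) :
    ∃ z, kthLargest M k = some z ∧ M.countP (fun x => z < x) < k ∧
      k ≤ M.countP fun x => z ≤ x := by
  have hlen : (M.sort (· ≥ ·)).length = M.card := Multiset.length_sort ..
  have hs : (M.sort (· ≥ ·)).Pairwise (· ≥ ·) := Multiset.pairwise_sort ..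
  have hM : M = (M.sort (· ≥ ·) : Multiset ℝ) := (Multiset.sort_eq ..).symm
  rw [kthLargest]
  generalize M.sort (· ≥ ·) = L at *
  subst hM
  have hk' : k - 1 < L.length := by omega
  refine ⟨L[k - 1], List.getElem?_eq_getElem hk', ?_, ?_⟩
  · have hc : ∀ q : ℝ → Bool, L.countP q = (L.take (k - 1)).countP q + (L.drop (k - 1)).countP q :=
      fun q => by rw [← List.countP_append, List.take_append_drop]
    rw [Multiset.coe_countP, hc]
    have h1 : (L.drop (k - 1)).countP (fun x => decide (L[k - 1] < x)) = 0 := by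
      rw [List.countP_eq_zero]
      intro x hx
      obtain ⟨i, hi, rfl⟩ := List.mem_iff_getElem.1 hx
      rw [List.getElem_drop]
      simp only [decide_eq_true_eq, not_lt]
      rcases Nat.eq_zero_or_pos i with rfl | hi0
      · simp
      · exact List.pairwise_iff_getElem.1 hs _ _ _ _ (by omega)
    have h2 := List.countP_le_length (p := fun x => decide (L[k - 1] < x)) (l := L.take (k - 1))
    rw [List.length_take] at h2
    omega
  · rw [Multiset.coe_countP]
    calc k = (L.take k).length := by rw [List.length_take]; omega
      _ = (L.take k).countP (fun x => decide (L[k - 1] ≤ x)) := by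
        rw [eq_comm, List.countP_eq_length]
        intro x hx
        obtain ⟨i, hi, rfl⟩ := List.mem_iff_getElem.1 hx
        rw [List.getElem_take]
        rw [List.length_take] at hi
        simp only [decide_eq_true_eq]
        rcases Nat.lt_or_ge i (k - 1) with h3 | h3
        · exact List.pairwise_iff_getElem.1 hs _ _ _ _ h3
        · have : i = k - 1 := by omega
          simp [this]
      _ ≤ _ := (List.take_sublist k L).countP_le

open Classical in
theorem sum_good {n k H : ℕ} {A : Matrix (Fin 2) (Fin 2) ℝ} {b f : Fin 2 → ℝ}
    {P Q : Fin n → Fin 2 → ℝ} {s : State} (h : Arranged n H (initState k A b f P Q) s)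
    (p : ℝ → Prop) :
    (∑ i ∈ Finset.range n, ∑ j ∈ Finset.range n, if s.Good p i j then (1 : ℕ) else 0) =
      ((constrainedMinkowskiSum A b (familyMultiset P) (familyMultiset Q)).map
        fun r => f 0 * r 0 + f 1 * r 1).countP p := by
  rw [countP_selection, Finset.sum_range]
  refine Finset.sum_congr rfl fun i _ => ?_
  rw [Finset.sum_range]
  refine Finset.sum_congr rfl fun j _ => if_congr ?_ rfl rfl
  have P0 : s.rmem 0 i = P i 0 := by
    rw [h.input 0 (by norm_num)]; exact (dif_pos i.2)
  have P1 : s.rmem 1 i = P i 1 := by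
    rw [h.input 1 (by norm_num)]; exact (dif_pos i.2)
  have Q0 : s.rmem 2 j = Q j 0 := by
    rw [h.input 2 (by norm_num)]; exact (dif_pos j.2)
  have Q1 : s.rmem 3 j = Q j 1 := by
    rw [h.input 3 (by norm_num)]; exact (dif_pos j.2)
  have R0 : s.rreg 0 = A 0 0 := h.rreg 0 (by norm_num)
  have R1 : s.rreg 1 = A 0 1 := h.rreg 1 (by norm_num)
  have R2 : s.rreg 2 = A 1 0 := h.rreg 2 (by norm_num)
  have R3 : s.rreg 3 = A 1 1 := h.rreg 3 (by norm_num)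
  have R4 : s.rreg 4 = b 0 := h.rreg 4 (by norm_num)
  have R5 : s.rreg 5 = b 1 := h.rreg 5 (by norm_num)
  have R6 : s.rreg 6 = f 0 := h.rreg 6 (by norm_num)
  have R7 : s.rreg 7 = f 1 := h.rreg 7 (by norm_num)
  have e6 : s.rmem 6 i + s.rmem 9 j = f 0 * (P i + Q j) 0 + f 1 * (P i + Q j) 1 := by
    rw [h.values.fP i i.2, h.values.fQ j j.2, State.lin, State.lin, P0, P1, Q0, Q1, R6, R7]
    simp only [Pi.add_apply]
    ring
  have e0 : s.rmem 4 i + s.rmem 7 j = A.mulVec (P i + Q j) 0 := by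
    rw [h.values.a₀P i i.2, h.values.a₀Q j j.2, State.lin, State.lin, P0, P1, Q0, Q1, R0, R1]
    simp only [Matrix.mulVec, dotProduct, Fin.sum_univ_two, Pi.add_apply]
    ring
  have e1 : s.rmem 5 i + s.rmem 8 j = A.mulVec (P i + Q j) 1 := by
    rw [h.values.a₁P i i.2, h.values.a₁Q j j.2, State.lin, State.lin, P0, P1, Q0, Q1, R2, R3]
    simp only [Matrix.mulVec, dotProduct, Fin.sum_univ_two, Pi.add_apply]
    ring
  rw [State.Good, e6]
  refine and_congr_left fun _ => ⟨fun h1 => ?_, fun h1 r hr => ?_⟩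
  · refine Fin.forall_fin_two.2 ⟨?_, ?_⟩
    · have := h1 0 (by norm_num)
      simp only [Nat.add_zero] at this
      rw [e0, R4] at this
      exact not_lt.1 this
    · have := h1 1 (by norm_num)
      simp only [Nat.reduceAdd] at this
      rw [e1, R5] at this
      exact not_lt.1 this
  · interval_cases r
    · simp only [Nat.add_zero]
      rw [e0, R4]
      exact not_lt.2 (h1 0)
    · simp only [Nat.reduceAdd]
      rw [e1, R5]
      exact not_lt.2 (h1 1)


/-! ### The whole program -/

theorem Arranged.keep {n H : ℕ} {s₀ s s' : State} (h : Arranged n H s₀ s)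
    (hk : Keeps 10 100 [8, 9, 10] [] s s') : Arranged n H s₀ s' := by
  have hr : s'.rmem = s.rmem := funext fun a => hk.rmem a List.not_mem_nil
  have h0 : s'.wmem 0 = s.wmem 0 := hk.wmem 0 (by simp)
  have h2 : s'.wmem 2 = s.wmem 2 := hk.wmem 2 (by simp)
  have hlin : ∀ a b x i, a < 100 → b < 100 → s'.lin a b x i = s.lin a b x i :=
    fun a b x i ha hb => by rw [State.lin, State.lin, hk.rreg a ha, hk.rreg b hb, hr]
  have hkey : s'.key = s.key := by
    funext b t
    rw [State.key, State.key, hr, h0]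
  refine ⟨?_, ?_, ?_, ?_, ?_, fun i hi => ?_, ?_, ?_, ?_, ?_, ?_, ?_, ?_, ?_, ?_, ?_, ?_⟩
  · rw [hk.wreg 0 (by norm_num), h.r0]
  · rw [hk.wreg 1 (by norm_num), h.r1]
  · rw [hk.wreg 3 (by norm_num), h.r3]
  · rw [hk.wreg 4 (by norm_num), h.r4]
  · rw [hk.wreg 5 (by norm_num), h.r5]
  · rw [hk.rreg i (by omega), h.rreg i hi]
  · rw [hk.wmem 6 (by simp), h.m6]
  · rw [hk.rreg 16 (by norm_num), hk.rreg 17 (by norm_num)]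
    exact h.dir
  · rw [hk.rreg 14 (by norm_num), hk.rreg 16 (by norm_num), hk.rreg 17 (by norm_num)]
    exact h.dir₀
  · rw [hk.rreg 15 (by norm_num), hk.rreg 16 (by norm_num), hk.rreg 17 (by norm_num)]
    exact h.dir₁
  · rw [hr]
    exact h.input
  · obtain ⟨h1, h2, h3, h4, h5, h6, h7⟩ := h.values
    refine ⟨fun i hi => ?_, fun i hi => ?_, fun i hi => ?_, fun i hi => ?_, fun i hi => ?_,
      fun i hi => ?_, fun i hi => ?_⟩
    all_goals rw [hr, hlin _ _ _ _ (by norm_num) (by norm_num)]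
    · exact h1 i hi
    · exact h2 i hi
    · exact h3 i hi
    · exact h4 i hi
    · exact h5 i hi
    · exact h6 i hi
    · exact h7 i hi
  · rw [h0]
    exact h.permP
  · rw [hkey]
    exact h.sortP
  · rw [h2]
    exact h.permQ
  · rw [h2, hr]
    exact h.sortQ
  · refine ⟨?_, ?_⟩
    · rw [h2]
      exact h.levels.perm
    · rw [h2, hr]
      exact h.levels.sorted

/-- Search for the answer in the interval between the extreme objective values. -/
def finish : Prog :=
  .seq (.setR 8 (.add (.load 6 (.load 0 (.reg 3))) (.load 9 (.load 2 (.reg 3)))))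
  (.seq (.setR 9 (.add (.load 6 (.load 0 (.add (.reg 3) (.sub (.reg 0) (.const 1)))))
    (.load 9 (.load 2 (.add (.reg 3) (.sub (.reg 0) (.const 1)))))))
  (.seq levels (.seq (.setR 0 (.reg 8)) (.setW 0 (.const 1)))))

/-- The program for nonempty point sets. -/
def solve : Prog :=
  .seq arrange (.seq buildNodes (.seq buildRows
    (.cond (.wlt (.reg 13) (.reg 1)) (.setW 0 (.const 0)) finish)))

/-- The program. -/
def mainProg : Prog := .cond (.wlt (.const 0) (.reg 0)) solve .skip

theorem finish_spec {W n k H : ℕ} {F : Rects} {z : ℝ} {s₁ s₀ : State} (hn0 : 0 < n)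
    (hn : n ≤ 2 ^ H) (hlev : Levels n H s₁)
    (hsort : ∀ t t', t ≤ t' → t' < n → s₁.key (H * n) t' ≤ s₁.key (H * n) t)
    {ω : ℕ → ℕ × ℕ} (hb : BuildState n H (H * n) s₁ ω n s₀) (hF : Holds W n F s₀)
    (hcount : ∀ p, F.count 1 p = ∑ t ∈ Finset.range n, ∑ x ∈ Finset.Ico (ω t).1 (ω t).2,
        open Classical in if p (s₁.key (H * n) t + s₁.rmem 9 (s₁.wmem 2 x)) then (1 : ℕ) else 0)
    (h1 : s₀.wreg 1 = k) (h3 : s₀.wreg 3 = H * n) (h5 : s₀.wreg 5 = 2 ^ H) (hk : 1 ≤ k)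
    (hz : F.IsAnswer k z) (hT : k ≤ F.count 1 fun _ => True)
    (hW : (n + 190) * F.dim 1 + F.V * n + k + 2 ^ H * 2 ^ H + 2 ^ H + n + 100 + H * n ≤ W)
    (hW' : ∀ v < F.V, F.B v + 2 + 2 ^ H ≤ W) (hwf : WF W s₀) :
    Ht W finish s₀ (120000 * ∑ c ∈ Finset.range (H + 1), F.dim (2 ^ c) +
      (H + 1) * (70 * F.V + 410) + 60) fun s => s.Outputs (some z) := by
  classical
  have k0 := hb.keeps.wmem 0 (by simp)
  have k2 := hb.keeps.wmem 2 (by simp)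
  have k6 := hb.keeps.rmem 6 (by simp)
  have k9 := hb.keeps.rmem 9 (by simp)
  have h0 := hF.r0
  have hQ := (hlev.sorted H le_rfl).of_le hn
  -- Level `H` is a single sorted run, so its first and last entries are the extreme objective
  -- values on `Q`.
  have hQ1 : ∀ e < n, s₁.rmem 9 (s₁.wmem 2 e) ≤ s₁.rmem 9 (s₁.wmem 2 (H * n)) :=
    (hlev.perm H le_rfl).symm.forall
      (p := fun x => s₁.rmem 9 x ≤ s₁.rmem 9 (s₁.wmem 2 (H * n))) fun e he => hQ 0 e (by omega) he
  have hQ2 : ∀ e < n, s₁.rmem 9 (s₁.wmem 2 (H * n + (n - 1))) ≤ s₁.rmem 9 (s₁.wmem 2 e) :=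
    (hlev.perm H le_rfl).symm.forall
      (p := fun x => s₁.rmem 9 (s₁.wmem 2 (H * n + (n - 1))) ≤ s₁.rmem 9 x)
      fun e he => hQ e (n - 1) (by omega) (by omega)
  generalize hhi : s₁.key (H * n) 0 + s₁.rmem 9 (s₁.wmem 2 (H * n)) = hi
  generalize hlo : s₁.key (H * n) (n - 1) + s₁.rmem 9 (s₁.wmem 2 (H * n + (n - 1))) = lo
  have hlt : ∀ t ∈ Finset.range n, ∀ x ∈ Finset.Ico (ω t).1 (ω t).2, t < n ∧ x < n :=
    fun t ht x hx => ⟨Finset.mem_range.1 ht, (Finset.mem_Ico.1 hx).2.trans_le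
      (hb.windows t (Finset.mem_range.1 ht)).2.1⟩
  -- Beyond `hi` there is no entry at all, contradicting `1 ≤ k`; below `lo` every entry would
  -- exceed `z`, contradicting that there are at least `k` of them.
  have zhi : z ≤ hi := by
    by_contra! hlt'
    have h2 := hz.2
    rw [hcount, Finset.sum_eq_zero fun t ht => Finset.sum_eq_zero fun x hx => if_neg ?_] at h2
    · omega
    · obtain ⟨ht', hx'⟩ := hlt t ht x hx
      have := hsort 0 t (by omega) ht'
      have := hQ1 x hx'
      exact not_le.2 (by linarith)
  have zlo : lo ≤ z := by
    by_contra! hlt'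
    have h2 := hz.1
    have e : F.count 1 (fun x => z < x) = F.count 1 fun _ => True := by
      rw [hcount, hcount]
      refine Finset.sum_congr rfl fun t ht => Finset.sum_congr rfl fun x hx => ?_
      rw [if_pos trivial, if_pos]
      obtain ⟨ht', hx'⟩ := hlt t ht x hx
      have := hsort t (n - 1) (by omega) (by omega)
      have := hQ2 x hx'
      linarith
    omega
  refine Ht.seq_wp (c' := 120000 * ∑ c ∈ Finset.range (H + 1), F.dim (2 ^ c) +
      (H + 1) * (70 * F.V + 410) + 45) (Q := fun s => s = s₀.putR 8 hi) hwf ?_ ?_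
    (by simp [Prog.cost, WExp.cost, RExp.cost]; omega)
  · simp only [Prog.wp, RExp.ok, RExp.val, WExp.ok, WExp.val, true_and, h3, k0, k2, k6, k9, ← hhi,
      State.key, Nat.add_zero]
  rintro s2 hwf2 rfl
  refine Ht.seq_wp (c' := 120000 * ∑ c ∈ Finset.range (H + 1), F.dim (2 ^ c) +
      (H + 1) * (70 * F.V + 410) + 20) (Q := fun s => s = (s₀.putR 8 hi).putR 9 lo) hwf2 ?_ ?_
    (by simp [Prog.cost, WExp.cost, RExp.cost]; omega)
  · simp only [Prog.wp, RExp.ok, RExp.val, WExp.ok, WExp.val, true_and, putR_wreg, putR_wmem,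
      putR_rmem, h3, h0, k0, k2, k6, k9, ← hlo, State.key, and_true]
    omega
  rintro s3 hwf3 rfl
  have hk3 : Keeps 100 8 [] [] s₀ ((s₀.putR 8 hi).putR 9 lo) :=
    (Keeps.rfl.putR le_rfl).putR (by norm_num)
  refine (levels_spec (hF.keep hk3 (by norm_num) (by simp) (by simp)) h1 h5 hz (by simpa using zlo)
    (by simpa using zhi) (fun v hv => (hF.A_le v hv).trans hn) (by omega) hW' hwf3).seq (c' := 10) ?_
    (by omega)
  rintro s4 hwf4 h8
  refine Ht.of_wp hwf4 ?_ (by simp [Prog.cost, WExp.cost, RExp.cost])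
  have b1 : 1 ≤ W := by omega
  simp only [Prog.wp, RExp.ok, RExp.val, WExp.ok, WExp.val, true_and, b1]
  exact ⟨by simp, by simpa using h8⟩

/-- The time bound. -/
def timeBound (n : ℕ) : ℕ := 5000000 * (n * (Nat.clog 2 n + 1)) + 20

theorem solve_spec {W n k : ℕ} {A : Matrix (Fin 2) (Fin 2) ℝ} {b f : Fin 2 → ℝ}
    {P Q : Fin n → Fin 2 → ℝ} (hk : 1 ≤ k) (hA : A.det = 0) (hn0 : 0 < n)
    (hwf : WF W (initState k A b f P Q)) (hW : 2000 * (n + k + 2) ^ 3 ≤ W) :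
    Ht W solve (initState k A b f P Q) (5000000 * (n * (Nat.clog 2 n + 1)))
      fun s => s.Outputs (selectionAnswer A b f (familyMultiset P) (familyMultiset Q) k) := by
  classical
  have hn : n ≤ 2 ^ Nat.clog 2 n := Nat.le_pow_clog one_lt_two n
  have hn2 : 2 ^ Nat.clog 2 n ≤ 2 * n := by
    rcases Nat.lt_or_ge 1 n with h | h
    · have h1 := Nat.pow_pred_clog_lt_self one_lt_two h
      have h2 : 0 < Nat.clog 2 n := Nat.clog_pos one_lt_two h
      obtain ⟨m, hm⟩ := Nat.exists_eq_succ_of_ne_zero h2.ne'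
      rw [hm] at h1 ⊢
      rw [Nat.pred_succ] at h1
      rw [pow_succ]
      omega
    · obtain rfl : n = 1 := by omega
      simp
  have hHn : Nat.clog 2 n ≤ n := (Nat.clog_le_iff_le_pow one_lt_two).2 Nat.lt_two_pow_self.le
  generalize hH : Nat.clog 2 n = H at hn hn2 hHn ⊢
  have hpow : 2 ^ (H + 1) = 2 ^ H * 2 := pow_succ 2 H
  have bX : n * (H + 1) = H * n + n := by ring
  generalize hN : n + k + 2 = N at hW
  have hN4 : 4 ≤ N := by omega
  have bN2 : 4 * N ≤ N ^ 2 := by nlinarith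
  have bN3 : 4 * N ^ 2 ≤ N ^ 3 := by rw [pow_succ N 2, mul_comm]; exact Nat.mul_le_mul_left _ hN4
  have bnn : n * n ≤ N ^ 2 := by rw [sq]; exact Nat.mul_le_mul (by omega) (by omega)
  have bHn : H * n ≤ N ^ 2 := by rw [sq]; exact Nat.mul_le_mul (by omega) (by omega)
  have bpn : 2 ^ H * n ≤ 2 * N ^ 2 := by
    calc 2 ^ H * n ≤ (2 * n) * n := Nat.mul_le_mul_right n hn2
      _ = 2 * (n * n) := by ring
      _ ≤ _ := by omega
  have bpp : 2 ^ H * 2 ^ H ≤ 4 * N ^ 2 := by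
    calc 2 ^ H * 2 ^ H ≤ (2 * n) * (2 * n) := Nat.mul_le_mul hn2 hn2
      _ = 4 * (n * n) := by ring
      _ ≤ _ := by omega
  have bVn : 2 ^ (H + 1) * n = 2 * (2 ^ H * n) := by rw [hpow]; ring
  have bHX : H ≤ H * n := Nat.le_mul_of_pos_right H hn0
  have hbn : (H + 1) * n = H * n + n := Nat.succ_mul _ _
  have bH70 : H * (70 * n + 50) = 70 * (H * n) + 50 * H := by ring
  refine (arrange_spec hH hwf rfl (by omega)).seq (c' := 4700000 * (n * (H + 1))) ?_ (by omega)
  rintro s1 hwf1 ha1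
  refine (buildNodes_spec (n := n) (H := H) hwf1 hn0 ha1.r0 ha1.r3 ha1.r4 ha1.r5 (by omega)).seq
    (c' := 4600000 * (n * (H + 1)) - 100 * n) ?_ (by omega)
  rintro s2 hwf2 ⟨hk2, h9, h8⟩
  have ha2 := ha1.keep hk2
  have hdet : (initState k A b f P Q).rreg 0 * (initState k A b f P Q).rreg 3 -
      (initState k A b f P Q).rreg 1 * (initState k A b f P Q).rreg 2 = 0 := by
    rw [← hA, Matrix.det_fin_two]
    rfl
  have b220 : n * (220 * (H + 1) + 140) = 220 * (n * (H + 1)) + 140 * n := by ring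
  refine (buildRows_spec (n := n) (H := H) (base := H * n) hwf2 ha2.r0 ha2.r3 ha2.r5 hn
    (fun v => by rw [ha2.m6]; rfl) (ha2.directed hdet) ha2.sortP (by omega)).seq
    (c' := 4500000 * (n * (H + 1))) ?_ (by omega)
  rintro s3 hwf3 ⟨ω, hb⟩
  obtain ⟨F, hF, hV, hB, hFA, hcount⟩ := exists_rects (W := W) hn ha2.r0 ha2.r4 h9 h8 ha2.levels
    (by omega) hb
  have hM : ∀ p, F.count 1 p = ((constrainedMinkowskiSum A b (familyMultiset P)
      (familyMultiset Q)).map fun r => f 0 * r 0 + f 1 * r 1).countP p := fun p => by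
    rw [hcount, ← sum_good ha2, ← sum_windows ha2 hb.windows]
  have e13 : s3.wreg 13 = F.count 1 fun _ => True := by
    rw [hb.total, hcount]
    simp
  have hcard : s3.wreg 13 = ((constrainedMinkowskiSum A b (familyMultiset P)
      (familyMultiset Q)).map fun r => f 0 * r 0 + f 1 * r 1).card := by
    rw [e13, hM]
    rw [@Multiset.countP_eq_card]
    exact fun _ _ => trivial
  have e1 : s3.wreg 1 = k := by rw [hb.keeps.wreg 1 (by norm_num), ha2.r1]; rfl
  have hBsum : ∑ v ∈ Finset.range F.V, F.B v = (H + 3) * 2 ^ H := by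
    rw [Finset.sum_congr rfl fun v hv => hB v (Finset.mem_range.1 hv), hV, sum_ht H (H + 1) le_rfl]
  have bH2 : (H + 3) * 2 ^ H ≤ 6 * (n * (H + 1)) := by
    calc (H + 3) * 2 ^ H ≤ (H + 3) * (2 * n) := Nat.mul_le_mul_left _ hn2
      _ = 2 * (H * n) + 6 * n := by ring
      _ ≤ _ := by omega
  have hdim : F.dim 1 ≤ 8 * (n * (H + 1)) := by
    simp only [Rects.dim, cdiv_one]
    rw [Finset.sum_add_distrib, hBsum]
    have : n * (2 * (H + 1)) = 2 * (n * (H + 1)) := by ring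
    omega
  -- The dominant term of the word bound is of order `n * F.dim 1`. Estimated by `1536 * N ^ 3`, it
  -- leaves room for the remaining terms within `2000 * N ^ 3`.
  have hdimN : (n + 190) * F.dim 1 ≤ 48 * N * (32 * N ^ 2) := Nat.mul_le_mul (by omega) (by omega)
  have hN3 : 48 * N * (32 * N ^ 2) = 1536 * N ^ 3 := by ring
  have hVp : F.V * n = 2 * (2 ^ H * n) := by rw [hV, bVn]
  have hBle : ∀ v < F.V, F.B v + 2 + 2 ^ H ≤ W := fun v hv => by
    have : 2 ^ ht H v ≤ 2 ^ (H + 1) := Nat.pow_le_pow_right two_pos (Nat.sub_le _ _)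
    rw [hB v hv]
    omega
  refine Ht.cond (c := 4400000 * (n * (H + 1))) hwf3 (by simp [Test.ok, WExp.ok]) (fun hlt => ?_)
    (fun hlt => ?_) (by simp [Test.cost, WExp.cost]; omega)
  · simp only [Test.val, WExp.val, hcard, e1] at hlt
    rw [selectionAnswer, kthLargest_eq_none hk hlt]
    refine Ht.of_wp hwf3 ?_ (by simp [Prog.cost, WExp.cost]; omega)
    simp [Prog.wp, WExp.ok, WExp.val, State.Outputs]
  · simp only [Test.val, WExp.val, e1] at hlt
    obtain ⟨z, hz, hz1, hz2⟩ := exists_kthLargest hk (hcard ▸ not_lt.1 hlt)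
    rw [selectionAnswer, hz]
    refine (finish_spec hn0 hn ha2.levels ha2.sortP hb hF hcount e1
      (by rw [hb.keeps.wreg 3 (by norm_num), ha2.r3]) (by rw [hb.keeps.wreg 5 (by norm_num), ha2.r5])
      hk ⟨by rwa [hM], by rwa [hM]⟩ (e13 ▸ not_lt.1 hlt) (by omega) hBle hwf3).mono ?_
      fun _ _ h => h
    have hs := F.sum_dim_le (H + 1)
    have e2 : 2 * (H + 1) * F.V = 4 * ((H + 1) * 2 ^ H) := by rw [hV, hpow]; ring
    have e3 : (H + 1) * 2 ^ H ≤ 2 * (n * (H + 1)) := by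
      calc (H + 1) * 2 ^ H ≤ (H + 1) * (2 * n) := Nat.mul_le_mul_left _ hn2
        _ = _ := by ring
    have e4 : (H + 1) * (70 * F.V + 410) = 140 * ((H + 1) * 2 ^ H) + 410 * (H + 1) := by
      rw [hV, hpow]; ring
    omega

theorem timeBound_isBigO :
    (fun n : ℕ => (timeBound n : ℝ)) =O[atTop] fun n : ℕ => (n : ℝ) * Real.log (n : ℝ) := by
  refine IsBigO.of_bound 100000000 ?_
  filter_upwards [eventually_ge_atTop 2] with n hn
  have hn' : (2 : ℝ) ≤ n := by exact_mod_cast hn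
  -- This gives both `1 / log 2 < 2` and, for `n ≥ 2`, `1 < 2 * log n`, which absorb the change of
  -- base and the additive constants.
  have hlog2 : (0.5 : ℝ) < Real.log 2 := by linarith [Real.log_two_gt_d9]
  have hlog : Real.log 2 ≤ Real.log n := Real.log_le_log two_pos hn'
  have h1 : (Nat.clog 2 n : ℝ) ≤ Nat.log 2 n + 1 := by
    exact_mod_cast (Nat.clog_le_iff_le_pow one_lt_two).2 (Nat.lt_pow_succ_log_self one_lt_two n).le
  have h2 : (Nat.log 2 n : ℝ) ≤ 2 * Real.log n := by
    refine (Real.natLog_le_logb n 2).trans ?_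
    rw [Real.logb, Nat.cast_ofNat, div_le_iff₀ (by linarith)]
    nlinarith
  have h3 : (Nat.clog 2 n : ℝ) + 1 ≤ 6 * Real.log n := by linarith
  have h4 : 0 ≤ (n : ℝ) * Real.log n := by nlinarith
  have h5 : (n : ℝ) * (Nat.clog 2 n + 1) ≤ n * (6 * Real.log n) :=
    mul_le_mul_of_nonneg_left h3 (by linarith)
  have h6 : (1 : ℝ) ≤ n * Real.log n := by nlinarith
  rw [Real.norm_of_nonneg (Nat.cast_nonneg _), Real.norm_of_nonneg h4, timeBound]
  push_cast
  nlinarith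

end RealRAM

theorem mainTheorem10 :
    ∃ (prog : RealRAM.Prog) (d : ℕ) (T : ℕ → ℕ),
      ((fun n : ℕ => (T n : ℝ)) =O[atTop] fun n : ℕ => (n : ℝ) * Real.log (n : ℝ)) ∧
      ∀ (n k : ℕ) (A : Matrix (Fin 2) (Fin 2) ℝ) (b f : Fin 2 → ℝ) (P Q : Fin n → Fin 2 → ℝ),
        1 ≤ k → A.det = 0 →
        ∃ (t : ℕ) (s : RealRAM.State),
          RealRAM.Run ((n + k + 2) ^ d) prog (RealRAM.initState k A b f P Q) t s ∧
          t ≤ T n ∧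
          s.Outputs (selectionAnswer A b f (familyMultiset P) (familyMultiset Q) k) := by
  refine ⟨RealRAM.mainProg, 10, RealRAM.timeBound, RealRAM.timeBound_isBigO,
    fun n k A b f P Q hk hA => ?_⟩
  have hN : 3 ≤ n + k + 2 := by omega
  have h10 : n + k + 2 ≤ (n + k + 2) ^ 10 := Nat.le_self_pow (by norm_num) _
  -- The exponent `10` leaves a factor of at least `3 ^ 7 = 2187` over the cube.
  have h3 : 2000 * (n + k + 2) ^ 3 ≤ (n + k + 2) ^ 10 := by
    rw [show (n + k + 2) ^ 10 = (n + k + 2) ^ 7 * (n + k + 2) ^ 3 by ring]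
    exact Nat.mul_le_mul_right _ ((by norm_num : 2000 ≤ 3 ^ 7).trans (Nat.pow_le_pow_left hN 7))
  have hwf : RealRAM.WF ((n + k + 2) ^ 10) (RealRAM.initState k A b f P Q) := by
    refine ⟨fun i => ?_, fun a j => Nat.zero_le _⟩
    rcases i with _ | _ | i
    · exact le_trans (by omega : n ≤ n + k + 2) h10
    · exact le_trans (by omega : k ≤ n + k + 2) h10
    · exact Nat.zero_le _
  have main : RealRAM.Ht ((n + k + 2) ^ 10) RealRAM.mainProg (RealRAM.initState k A b f P Q)
      (RealRAM.timeBound n)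
      fun s => s.Outputs (selectionAnswer A b f (familyMultiset P) (familyMultiset Q) k) := by
    refine RealRAM.Ht.cond (c := 5000000 * (n * (Nat.clog 2 n + 1)) + 1) hwf
      (by simp [RealRAM.Test.ok, RealRAM.WExp.ok]) (fun hv => ?_) (fun hv => ?_)
      (by simp [RealRAM.Test.cost, RealRAM.WExp.cost, RealRAM.timeBound]; omega)
    · have hn : 0 < n := hv
      exact (RealRAM.solve_spec hk hA hn hwf h3).mono (by omega) fun _ _ h => h
    -- For empty input, word register `0` already holds `0`, which is the report that there is no
    -- answer.
    · obtain rfl : n = 0 := Nat.eq_zero_of_not_pos hv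
      refine RealRAM.Ht.of_wp hwf ?_ (by simp [RealRAM.Prog.cost])
      have : selectionAnswer A b f (familyMultiset P) (familyMultiset Q) k = none := by
        refine RealRAM.kthLargest_eq_none hk ?_
        simp [constrainedMinkowskiSum, familyMultiset]
        omega
      rw [this]
      rfl
  obtain ⟨t, s, ht, hr, -, hs⟩ := main
  exact ⟨t, s, hr, ht, hs⟩
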